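/- Let $\mathbb F$ be a field of characteristic $0$, let $q^{1/2}$ be an indeterminate, $[n]=\frac{q^n-q^{-n}}{q-q^{-1}}$, and let $\mathbb A_0\subset\mathbb F(q^{1/2})$ be the ring of rational functions in $q^{1/2}$ that are regular at $q^{1/2}=0$. Let $U_q$ be the quantum affine algebra of type $A_1^{(1)}$ in Drinfeld's realization, i.e. the associative $\mathbb F(q^{1/2})$-algebra with generators $x^{\pm}_k$ ($k\in\mathbb Z$), $h_l$ ($l\in\mathbb Z\setminus\{0\}$), $K^{\pm1}$, $D^{\pm1}$, $\gamma^{\pm 1/2}$ and relations: $K^{\pm1}$, $D^{\pm1}$, $\gamma^{\pm1/2}$ are mutually inverse pairs; $\gamma^{\pm1/2}$ is central; $[h_k,K]=[D,K]=0$; and $$[h_k,h_l]=\delta_{k+l,0}\tfrac{[2k]}{k}\tfrac{\gamma^k-\gamma^{-k}}{q-q^{-1}},\quad Dh_kD^{-1}=q^kh_k,\quad Dx^\pm_kD^{-1}=q^kx^\pm_k,\quad Kx^\pm_kK^{-1}=q^{\pm2}x_k^\pm,$$ $$[h_k,x^\pm_l]=\pm\tfrac{[2k]}{k}\gamma^{\mp|k|/2}x^\pm_{k+l},\qquad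 x^\pm_{k+1}x^\pm_l-q^{\pm2}x^\pm_lx^\pm_{k+1}=q^{\pm2}x^\pm_kx^\pm_{l+1}-x^\pm_{l+1}x^\pm_k,$$ $$[x^+_k,x^-_l]=\tfrac1{q-q^{-1}}\bigl(\gamma^{(k-l)/2}\psi(k+l)-\gamma^{(l-k)/2}\phi(k+l)\bigr),$$ where $\sum_{k\ge0}\psi(k)z^{-k}=K\exp\bigl((q-q^{-1})\sum_{k\ge1}h_kz^{-k}\bigr)$, $\sum_{k\ge0}\phi(-k)z^{k}=K^{-1}\exp\bigl(-(q-q^{-1})\sum_{k\ge1}h_{-k}z^{k}\bigr)$, and $\psi(-k)=\phi(k)=0$ for $k>0$. Let $\lambda$ be a weight in the weight lattice of $A_1^{(1)}$, given by the integers $\lambda(h),\lambda(c),\lambda(d)$, with $\lambda(c)=0$ and $\lambda(h)\ne0$. The reduced quantized imaginary Verma module is $\tilde M_q(\lambda)=U_q/J^q(\lambda)$, where $J^q(\lambda)$ is the left ideal generated by all $x^+_k$, all $h_l$, $K^{\pm1}-q^{\pm\lambda(h)}$, $\gamma^{\pm1/2}-q^{\pm\lambda(c)/2}$ and $D^{\pm1}-q^{\pm\lambda(d)}$;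 let $v_\lambda$ be the image of $1$. Write $x_{\mathbf n}=x^-_{n_1}\cdots x^-_{n_k}$ for $\mathbf n=(n_1,\dots,n_k)\in\mathbb Z^k$, $k\ge0$. Let $\tilde x^-_m$ be left multiplication by $x^-_m$ on $\tilde M_q(\lambda)$. Let $\sum_{r\ge0}g(r)t^r$ be the Taylor series of $\frac{q^{-2}t-1}{t-q^{-2}}$ at $t=0$, and let $\tilde\Omega_\psi(m)$, $m\in\mathbb Z$, be the $\mathbb F(q^{1/2})$-linear operator on $\tilde M_q(\lambda)$ with $$\tilde\Omega_\psi(m)\bigl(x_{\mathbf n}v_\lambda\bigr)=\sum_{l=1}^{k}\ \sum_{\substack{r_1,\dots,r_{l-1}\ge0\\ r_1+\cdots+r_{l-1}=m+n_l}}\Bigl(\prod_{j<l}g(r_j)\Bigr)\,x^-_{n_1+r_1}\cdots x^-_{n_{l-1}+r_{l-1}}\,x^-_{n_{l+1}}\cdots x^-_{n_k}v_\lambda$$ for every $k\ge0$ and every $\mathbf n\in\mathbb Z^k$. Let $\mathcal L(\lambda)\subset\tilde M_q(\lambda)$ be the $\mathbb A_0$-span of the vectors $x_{\mathbf i}v_\lambda$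 with $k\ge 0$ and $i_1\ge\cdots\ge i_k$, and let $\mathcal B(\lambda)$ be the set of their classes in $\mathcal L(\lambda)/q\mathcal L(\lambda)$. **Theorem.** The operators $\tilde\Omega_\psi(m)$ are well defined, and $(\mathcal L,\mathcal B)=(\mathcal L(\lambda),\mathcal B(\lambda))$ is an imaginary crystal basis of $\tilde M_q(\lambda)$. That is, with $P=\{-k\alpha+m\delta\mid k>0,\ m\in\mathbb Z\}\cup\{0\}$, where $\alpha(h)=2$, $\alpha(c)=\alpha(d)=0$, $\delta(h)=\delta(c)=0$, $\delta(d)=1$, and with $M_\mu=\{x\in\tilde M_q(\lambda)\mid Kx=q^{\mu(h)}x,\ Dx=q^{\mu(d)}x\}$: 1. $\mathcal L$ is an imaginary crystal lattice: it is a free $\mathbb A_0$-module; the natural map $\mathbb F(q^{1/2})\otimes_{\mathbb A_0}\mathcal L\to\tilde M_q(\lambda)$ is an isomorphism; $\mathcal L=\bigoplus_{\mu\in\lambda+P}\mathcal L_\mu$ with $\mathcal L_\mu=\mathcal L\cap M_\mu$; and $\tilde\Omega_\psi(m)\mathcal L\subseteq\mathcal L$, $\tilde x^-_m\mathcal L\subseteq\mathcal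 L$ for all $m\in\mathbb Z$. 2. $\mathcal B\subset\mathcal L/q\mathcal L$ maps bijectively onto an $\mathbb F$-basis of $\mathbb F\otimes_{\mathbb A_0}\mathcal L\cong\mathcal L/q^{1/2}\mathcal L$ (with $\mathbb A_0\to\mathbb F$ the evaluation at $q^{1/2}=0$). 3. $\mathcal B=\bigcup_{\mu\in\lambda+P}\mathcal B_\mu$, where $\mathcal B_\mu$ is the intersection of $\mathcal B$ with the image of $\mathcal L_\mu$ in $\mathcal L/q\mathcal L$. 4. For the induced operators on $\mathcal L/q\mathcal L$, $\tilde x^-_m\mathcal B\subset\pm\mathcal B\cup\{0\}$ and $\tilde\Omega_\psi(m)\mathcal B\subset\pm\mathcal B\cup\{0\}$ for all $m\in\mathbb Z$. 5. For $m\in\mathbb Z$ and $b\in\mathcal B$, if $\tilde\Omega_\psi(-m)b\ne0$ and $\tilde x^-_mb\neq0$, then $\tilde x^-_m\tilde\Omega_\psi(-m)b=\tilde\Omega_\psi(-m)\tilde x^-_mb$. Moreover, for $m\in\mathbb Z$ and $b\in\mathcal B$: if $\tilde x^-_mb\ne0$ then $\tilde\Omega_\psi(-m)\tilde x^-_mb=b$,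 and if $\tilde\Omega_\psi(-m)b\ne0$ then $\tilde x^-_m\tilde\Omega_\psi(-m)b=b$. -/

import Mathlib

noncomputable section

namespace ImaginaryCrystal

open Polynomial

universe u

/-- The ground field `𝔽(q^{1/2})`; the indeterminate of `RatFunc F` plays the role of `q^{1/2}`. -/
abbrev Kq (F : Type u) [Field F] : Type u := RatFunc F

/-- The element `q^{1/2}`. -/
def qHalf (F : Type u) [Field F] : Kq F := RatFunc.X

/-- The element `q`. -/
def qElt (F : Type u) [Field F] : Kq F := qHalf F ^ 2

/-- The quantum integer `[n] = (q^n - q^{-n}) / (q - q^{-1})`. -/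
def qInt (F : Type u) [Field F] (n : ℤ) : Kq F :=
  (qElt F ^ n - qElt F ^ (-n)) / (qElt F - (qElt F)⁻¹)

/-! ### The quantum affine algebra in its Drinfeld realization -/

/-- Generators `x⁺_k`, `x⁻_k`, `h_l` (`l ≠ 0`), `K^{±1}`, `D^{±1}`, `γ^{±1/2}`. -/
inductive Gen : Type
  | xp (k : ℤ)
  | xm (k : ℤ)
  | h (l : {l : ℤ // l ≠ 0})
  | K
  | Kinv
  | D
  | Dinv
  | gam
  | gamInv

/-- The free algebra on the generators. -/
abbrev FreeGen (F : Type u) [Field F] : Type u := FreeAlgebra (Kq F) Gen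

/-- A generator in the free algebra. -/
def gen (F : Type u) [Field F] (g : Gen) : FreeGen F := FreeAlgebra.ι (Kq F) g

/-- The power `γ^{n/2}`. -/
def gamPow (F : Type u) [Field F] (n : ℤ) : FreeGen F :=
  if 0 ≤ n then gen F Gen.gam ^ n.toNat else gen F Gen.gamInv ^ (-n).toNat

/-- The coefficient of `X^n` in `exp Y = ∑_j Y^j / j!`, for a power series `Y` without constant
term (so that `Y^j` contributes only for `j ≤ n`). -/
def expCoeff (F : Type u) [Field F] (n : ℕ) (Y : PowerSeries (FreeGen F)) : FreeGen F :=
  ∑ j ∈ Finset.range (n + 1), ((Nat.factorial j : Kq F)⁻¹) • PowerSeries.coeff n (Y ^ j)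

/-- `ψ(k)`, from `∑_{k ≥ 0} ψ(k) z^{-k} = K exp((q - q^{-1}) ∑_{k ≥ 1} h_k z^{-k})`, and
`ψ(k) = 0` for `k < 0`. -/
def psi (F : Type u) [Field F] (k : ℤ) : FreeGen F :=
  if 0 ≤ k then
    gen F Gen.K * expCoeff F k.toNat (PowerSeries.mk fun n : ℕ =>
      if hn : (n : ℤ) ≠ 0 then (qElt F - (qElt F)⁻¹) • gen F (Gen.h ⟨(n : ℤ), hn⟩) else 0)
  else 0

/-- `φ(k)`, from `∑_{k ≥ 0} φ(-k) z^k = K^{-1} exp(-(q - q^{-1}) ∑_{k ≥ 1} h_{-k} z^k)`, and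
`φ(k) = 0` for `k > 0`. -/
def phi (F : Type u) [Field F] (k : ℤ) : FreeGen F :=
  if k ≤ 0 then
    gen F Gen.Kinv * expCoeff F (-k).toNat (PowerSeries.mk fun n : ℕ =>
      if hn : -(n : ℤ) ≠ 0 then
        (-(qElt F - (qElt F)⁻¹)) • gen F (Gen.h ⟨-(n : ℤ), hn⟩) else 0)
  else 0

/-- The defining relations. -/
inductive Rel (F : Type u) [Field F] : FreeGen F → FreeGen F → Prop
  | D_Dinv : Rel F (gen F .D * gen F .Dinv) 1
  | Dinv_D : Rel F (gen F .Dinv * gen F .D) 1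
  | K_Kinv : Rel F (gen F .K * gen F .Kinv) 1
  | Kinv_K : Rel F (gen F .Kinv * gen F .K) 1
  | gam_gamInv : Rel F (gen F .gam * gen F .gamInv) 1
  | gamInv_gam : Rel F (gen F .gamInv * gen F .gam) 1
  | gam_central (g : Gen) : Rel F (gen F .gam * gen F g) (gen F g * gen F .gam)
  | gamInv_central (g : Gen) : Rel F (gen F .gamInv * gen F g) (gen F g * gen F .gamInv)
  | h_h (k l : {l : ℤ // l ≠ 0}) :
      Rel F (gen F (.h k) * gen F (.h l) - gen F (.h l) * gen F (.h k))
        (if k.1 + l.1 = 0 then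
          (qInt F (2 * k.1) / (k.1 : Kq F) / (qElt F - (qElt F)⁻¹)) •
            (gamPow F (2 * k.1) - gamPow F (-(2 * k.1)))
        else 0)
  | h_K (k : {l : ℤ // l ≠ 0}) : Rel F (gen F (.h k) * gen F .K) (gen F .K * gen F (.h k))
  | D_K : Rel F (gen F .D * gen F .K) (gen F .K * gen F .D)
  | D_h (k : {l : ℤ // l ≠ 0}) :
      Rel F (gen F .D * gen F (.h k) * gen F .Dinv) ((qElt F ^ k.1) • gen F (.h k))
  | D_xp (k : ℤ) :
      Rel F (gen F .D * gen F (.xp k) * gen F .Dinv) ((qElt F ^ k) • gen F (.xp k))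
  | D_xm (k : ℤ) :
      Rel F (gen F .D * gen F (.xm k) * gen F .Dinv) ((qElt F ^ k) • gen F (.xm k))
  | K_xp (k : ℤ) :
      Rel F (gen F .K * gen F (.xp k) * gen F .Kinv) ((qElt F ^ (2 : ℤ)) • gen F (.xp k))
  | K_xm (k : ℤ) :
      Rel F (gen F .K * gen F (.xm k) * gen F .Kinv) ((qElt F ^ (-2 : ℤ)) • gen F (.xm k))
  | h_xp (k : {l : ℤ // l ≠ 0}) (l : ℤ) :
      Rel F (gen F (.h k) * gen F (.xp l) - gen F (.xp l) * gen F (.h k))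
        ((qInt F (2 * k.1) / (k.1 : Kq F)) • (gamPow F (-|k.1|) * gen F (.xp (k.1 + l))))
  | h_xm (k : {l : ℤ // l ≠ 0}) (l : ℤ) :
      Rel F (gen F (.h k) * gen F (.xm l) - gen F (.xm l) * gen F (.h k))
        ((-(qInt F (2 * k.1) / (k.1 : Kq F))) • (gamPow F |k.1| * gen F (.xm (k.1 + l))))
  | xp_xp (k l : ℤ) :
      Rel F
        (gen F (.xp (k + 1)) * gen F (.xp l)
          - (qElt F ^ (2 : ℤ)) • (gen F (.xp l) * gen F (.xp (k + 1))))
        ((qElt F ^ (2 : ℤ)) • (gen F (.xp k) * gen F (.xp (l + 1)))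
          - gen F (.xp (l + 1)) * gen F (.xp k))
  | xm_xm (k l : ℤ) :
      Rel F
        (gen F (.xm (k + 1)) * gen F (.xm l)
          - (qElt F ^ (-2 : ℤ)) • (gen F (.xm l) * gen F (.xm (k + 1))))
        ((qElt F ^ (-2 : ℤ)) • (gen F (.xm k) * gen F (.xm (l + 1)))
          - gen F (.xm (l + 1)) * gen F (.xm k))
  | xp_xm (k l : ℤ) :
      Rel F (gen F (.xp k) * gen F (.xm l) - gen F (.xm l) * gen F (.xp k))
        ((qElt F - (qElt F)⁻¹)⁻¹ •
          (gamPow F (k - l) * psi F (k + l) - gamPow F (l - k) * phi F (k + l)))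

/-- The quantum affine algebra `U_q` of type `A₁⁽¹⁾` over `𝔽(q^{1/2})`. -/
def Uq (F : Type u) [Field F] : Type u := RingQuot (Rel F)

instance (F : Type u) [Field F] : Ring (Uq F) := inferInstanceAs (Ring (RingQuot (Rel F)))

instance (F : Type u) [Field F] : Algebra (Kq F) (Uq F) :=
  inferInstanceAs (Algebra (Kq F) (RingQuot (Rel F)))

/-- The image of a generator in `U_q`. -/
def ug (F : Type u) [Field F] (g : Gen) : Uq F := RingQuot.mkAlgHom (Kq F) (Rel F) (gen F g)

/-- The element `x⁻_m` of `U_q`. -/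
def xm (F : Type u) [Field F] (m : ℤ) : Uq F := ug F (.xm m)

/-- The monomial `x⁻_{n_1} ⋯ x⁻_{n_k}` of `U_q`. -/
def mon (F : Type u) [Field F] (w : List ℤ) : Uq F := (w.map (xm F)).prod

/-! ### Weights and reduced quantized imaginary Verma modules -/

/-- An element `λ` of the weight lattice `Λ` of `A₁⁽¹⁾`, given by the integers `λ(h)`, `λ(c)`,
`λ(d)`. -/
@[ext]
structure Weight : Type where
  h : ℤ
  c : ℤ
  d : ℤ
deriving DecidableEq

instance : Add Weight := ⟨fun a b => ⟨a.h + b.h, a.c + b.c, a.d + b.d⟩⟩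

/-- The weight `-k α + m δ`, where `α(h) = 2`, `α(c) = α(d) = 0`, `δ(h) = δ(c) = 0`, `δ(d) = 1`. -/
def rootShift (k m : ℤ) : Weight := ⟨-(2 * k), 0, m⟩

/-- The set `λ + P`, where `P = {-k α + m δ | k > 0, m ∈ ℤ} ∪ {0}`. -/
def weightsBelow (lam : Weight) : Set Weight :=
  {mu | mu = lam + rootShift 0 0 ∨ ∃ k m : ℤ, 0 < k ∧ mu = lam + rootShift k m}

/-- The generators of the left ideal `J^q(λ)`. -/
def verGens (F : Type u) [Field F] (lam : Weight) : Set (Uq F) :=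
  {a | (∃ k, a = ug F (.xp k)) ∨ (∃ l, a = ug F (.h l)) ∨
    a = ug F .K - algebraMap (Kq F) (Uq F) (qElt F ^ lam.h) ∨
    a = ug F .Kinv - algebraMap (Kq F) (Uq F) (qElt F ^ (-lam.h)) ∨
    a = ug F .gam - algebraMap (Kq F) (Uq F) (qHalf F ^ lam.c) ∨
    a = ug F .gamInv - algebraMap (Kq F) (Uq F) (qHalf F ^ (-lam.c)) ∨
    a = ug F .D - algebraMap (Kq F) (Uq F) (qElt F ^ lam.d) ∨
    a = ug F .Dinv - algebraMap (Kq F) (Uq F) (qElt F ^ (-lam.d))}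

/-- The left ideal `J^q(λ)` of `U_q`. -/
def Jq (F : Type u) [Field F] (lam : Weight) : Submodule (Uq F) (Uq F) :=
  Submodule.span (Uq F) (verGens F lam)

/-- The reduced quantized imaginary Verma module `M̃_q(λ) = U_q / J^q(λ)`. -/
def RedVerma (F : Type u) [Field F] (lam : Weight) : Type u := Uq F ⧸ Jq F lam

section

variable (F : Type u) [Field F] (lam : Weight)

instance : AddCommGroup (RedVerma F lam) := inferInstanceAs (AddCommGroup (Uq F ⧸ Jq F lam))

instance : Module (Uq F) (RedVerma F lam) := inferInstanceAs (Module (Uq F) (Uq F ⧸ Jq F lam))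

instance : Module (Kq F) (RedVerma F lam) := inferInstanceAs (Module (Kq F) (Uq F ⧸ Jq F lam))

instance : IsScalarTower (Kq F) (Uq F) (RedVerma F lam) :=
  inferInstanceAs (IsScalarTower (Kq F) (Uq F) (Uq F ⧸ Jq F lam))

instance : Module F (RedVerma F lam) := Module.compHom _ (algebraMap F (Kq F))

instance : IsScalarTower F (Kq F) (RedVerma F lam) :=
  IsScalarTower.of_algebraMap_smul fun _ _ => rfl

end

/-- The canonical generator `v_λ`. -/
def vlam (F : Type u) [Field F] (lam : Weight) : RedVerma F lam :=
  (Submodule.Quotient.mk 1 : Uq F ⧸ Jq F lam)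

/-! ### The operators `Ω̃_ψ(m)` and `x̃⁻_m` -/

/-- The coefficients of `g_{q⁻¹}(t) = ∑_r g_{q⁻¹}(r) t^r`, the Taylor series at `t = 0` of
`(q^{-2} t - 1) / (t - q^{-2})`. -/
def gCoeff (F : Type u) [Field F] (r : ℕ) : Kq F :=
  PowerSeries.coeff r
    ((PowerSeries.C (qElt F ^ (-2 : ℤ)) * PowerSeries.X - 1) *
      (PowerSeries.X - PowerSeries.C (qElt F ^ (-2 : ℤ)))⁻¹)

/-- For `p = [n_1, …, n_s]`, the sum of
`g_{q⁻¹}(r_1) ⋯ g_{q⁻¹}(r_s) x⁻_{n_1 + r_1} ⋯ x⁻_{n_s + r_s}` over all `r_1, …, r_s ≥ 0` with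
`r_1 + ⋯ + r_s = t`. It is the coefficient of `v_1^{-n_1} ⋯ v_s^{-n_s} v^{-t}` in
`∏_j g_{q⁻¹}(v_j / v) · x⁻(v_1) ⋯ x⁻(v_s)`. -/
def shiftSum (F : Type u) [Field F] : ℕ → List ℤ → Uq F
  | t, [] => if t = 0 then 1 else 0
  | t, n :: p => ∑ a ∈ Finset.HasAntidiagonal.antidiagonal t,
      gCoeff F a.1 • (xm F (n + (a.1 : ℤ)) * shiftSum F a.2 p)

/-- The value of `Ω_ψ(k)` on the monomial `x⁻_{n_1} ⋯ x⁻_{n_s}` (with `γ = 1`): the coefficient of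
`u^{-k} v_1^{-n_1} ⋯ v_s^{-n_s}` in
`∑_l (∏_{j < l} g_{q⁻¹}(v_j / v_l)) x⁻(v_1) ⋯ x⁻(v_{l-1}) x⁻(v_{l+1}) ⋯ x⁻(v_s) δ(u / v_l)`. -/
def omegaMon (F : Type u) [Field F] (k : ℤ) (w : List ℤ) : Uq F :=
  ∑ l : Fin w.length,
    if 0 ≤ k + w.get l then
      shiftSum F (k + w.get l).toNat (w.take l) * mon F (w.drop ((l : ℕ) + 1))
    else 0

open Classical in
/-- The operator `Ω̃_ψ(k)` on `M̃_q(λ)`: the `𝔽(q^{1/2})`-linear map that sends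
`x⁻_{n_1} ⋯ x⁻_{n_s} v_λ` to `Ω_ψ(k)(x⁻_{n_1} ⋯ x⁻_{n_s}) v_λ` for all integers `n_1, …, n_s`.
(That such a map exists is part of the theorem; it is unique since these vectors span.) -/
def omegaTilde (F : Type u) [Field F] (lam : Weight) (k : ℤ) :
    Module.End (Kq F) (RedVerma F lam) :=
  if h : ∃ T : Module.End (Kq F) (RedVerma F lam),
      ∀ w : List ℤ, T (mon F w • vlam F lam) = omegaMon F k w • vlam F lam
  then h.choose else 0

/-! ### Imaginary crystal lattices and bases -/

/-- `𝔸₀`, the ring of rational functions in `q^{1/2}` over `F` that are regular at `0`. -/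
def A0 (F : Type u) [Field F] : Subalgebra F (Kq F) where
  carrier := {f | ∃ a b : F[X], b.eval 0 ≠ 0 ∧
    f = algebraMap F[X] (Kq F) a / algebraMap F[X] (Kq F) b}
  mul_mem' := by
    rintro _ _ ⟨a, b, hb, rfl⟩ ⟨c, d, hd, rfl⟩
    refine ⟨a * c, b * d, ?_, ?_⟩
    · rw [eval_mul]; exact mul_ne_zero hb hd
    · rw [map_mul, map_mul, div_mul_div_comm]
  add_mem' := by
    rintro _ _ ⟨a, b, hb, rfl⟩ ⟨c, d, hd, rfl⟩
    have hb' : algebraMap F[X] (Kq F) b ≠ 0 :=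
      RatFunc.algebraMap_ne_zero (by rintro rfl; simp at hb)
    have hd' : algebraMap F[X] (Kq F) d ≠ 0 :=
      RatFunc.algebraMap_ne_zero (by rintro rfl; simp at hd)
    refine ⟨a * d + b * c, b * d, ?_, ?_⟩
    · rw [eval_mul]; exact mul_ne_zero hb hd
    · rw [div_add_div _ _ hb' hd']; simp only [map_add, map_mul]
  algebraMap_mem' r := ⟨C r, 1, by simp, by simp [RatFunc.algebraMap_eq_C]⟩

/-- `q^{1/2}` as an element of `𝔸₀`. -/
def a0qHalf (F : Type u) [Field F] : A0 F :=
  ⟨qHalf F, X, 1, by simp, by simp [qHalf]⟩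

/-- `q` as an element of `𝔸₀`. -/
def a0q (F : Type u) [Field F] : A0 F := a0qHalf F ^ 2

open scoped Pointwise in
/-- The natural map `N / b N → N / a N`, where `b = a²`. -/
def reduceSq {R : Type*} [CommRing R] (a b : R) (h : b = a ^ 2) (N : Type*) [AddCommGroup N]
    [Module R N] : QuotSMulTop b N →ₗ[R] QuotSMulTop a N :=
  Submodule.factor (p := b • (⊤ : Submodule R N)) (p' := a • (⊤ : Submodule R N)) (by
    rw [h, pow_two, mul_smul]
    exact smul_mono_right a le_top)

lemma reduceSq_mk {R : Type*} [CommRing R] (a b : R) (h : b = a ^ 2) (N : Type*) [AddCommGroup N]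
    [Module R N] (x : N) :
    reduceSq a b h N (Submodule.Quotient.mk x) = Submodule.Quotient.mk x := rfl

section Crystal

variable {F : Type u} [Field F] {M : Type u} [AddCommGroup M] [Module (Uq F) M]
  [Module (Kq F) M] [IsScalarTower (Kq F) (Uq F) M]

/-- The operator `x̃⁻_m`: left multiplication by `x⁻_m`. -/
def xTilde (F : Type u) [Field F] (M : Type u) [AddCommGroup M] [Module (Uq F) M]
    [Module (Kq F) M] [IsScalarTower (Kq F) (Uq F) M] (m : ℤ) : Module.End (Kq F) M :=
  Algebra.lsmul (Kq F) (Kq F) M (xm F m)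

/-- The weight space `M_μ`. -/
def weightSpace (M : Type u) [AddCommGroup M] [Module (Uq F) M]
    [Module (Kq F) M] [IsScalarTower (Kq F) (Uq F) M] (mu : Weight) : Submodule (Kq F) M where
  carrier := {x | ug F .K • x = (qElt F ^ mu.h) • x ∧ ug F .D • x = (qElt F ^ mu.d) • x}
  zero_mem' := by simp
  add_mem' := by
    rintro x y ⟨h1, h2⟩ ⟨h3, h4⟩
    exact ⟨by rw [smul_add, h1, h3, smul_add], by rw [smul_add, h2, h4, smul_add]⟩
  smul_mem' := by
    rintro a x ⟨h1, h2⟩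
    exact ⟨by rw [smul_comm, h1, smul_comm], by rw [smul_comm, h2, smul_comm]⟩

/-- `L_μ = L ∩ M_μ`, as an `𝔸₀`-submodule of `L`. -/
def latticeWeight (L : Submodule (A0 F) M) (mu : Weight) : Submodule (A0 F) L :=
  ((weightSpace (F := F) M mu).restrictScalars (A0 F)).comap L.subtype

/-- `L` is an imaginary crystal `𝔸₀`-lattice of the `U_q`-module `M`, whose weights lie in `wts`
and on which the operators `Ω̃_ψ(m)` are given by `Om`. -/
structure IsCrystalLattice (wts : Set Weight) (Om : ℤ → Module.End (Kq F) M)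
    (L : Submodule (A0 F) M) : Prop where
  free : Module.Free (A0 F) L
  /-- The natural map `𝔽(q^{1/2}) ⊗_{𝔸₀} L → M` is an isomorphism. -/
  baseChange : IsBaseChange (Kq F) L.subtype
  /-- `L` is the direct sum of the `L_μ`. -/
  weights : DirectSum.IsInternal fun mu : wts => latticeWeight L mu
  omega_mem : ∀ m, ∀ x ∈ L, Om m x ∈ L
  x_mem : ∀ m, ∀ x ∈ L, xTilde F M m x ∈ L

/-- The operator that an operator `T` with `T L ⊆ L` induces on `L / q L`. -/
def induced {L : Submodule (A0 F) M} (T : Module.End (Kq F) M) (hT : ∀ x ∈ L, T x ∈ L) :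
    QuotSMulTop (a0q F) L →ₗ[A0 F] QuotSMulTop (a0q F) L :=
  QuotSMulTop.map (a0q F) ((T.restrictScalars (A0 F)).restrict hT)

/-- The natural map from `L / q L` to `L / q^{1/2} L ≅ 𝔽 ⊗_{𝔸₀} L` (specialization at
`q^{1/2} = 0`). -/
def toFibre (L : Submodule (A0 F) M) :
    QuotSMulTop (a0q F) L →ₗ[A0 F] QuotSMulTop (a0qHalf F) L :=
  reduceSq (a0qHalf F) (a0q F) rfl L

variable [Module F M] [IsScalarTower F (Kq F) M]

/-- `(L, B)` is an imaginary crystal basis of the `U_q`-module `M`, whose weights lie in `wts` and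
on which the operators `Ω̃_ψ(m)` are given by `Om`. -/
structure IsCrystalBasis (wts : Set Weight) (Om : ℤ → Module.End (Kq F) M)
    (L : Submodule (A0 F) M) (B : Set (QuotSMulTop (a0q F) L)) : Prop where
  lattice : IsCrystalLattice wts Om L
  /-- `B` gives an `F`-basis of `𝔽 ⊗_{𝔸₀} L`: linear independence (in particular distinct elements
  of `B` have distinct images) ... -/
  linInd : LinearIndependent F fun b : B => toFibre L b.1
  /-- ... and spanning. -/
  span : Submodule.span F (toFibre L '' B) = ⊤
  /-- `B` is the union of the `B_μ = B ∩ (L_μ / q L_μ)`. -/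
  weights : B = ⋃ mu ∈ wts, B ∩ Submodule.Quotient.mk '' (latticeWeight L mu : Set L)
  x_mem : ∀ m, ∀ b ∈ B, induced (xTilde F M m) (lattice.x_mem m) b = 0 ∨
    induced (xTilde F M m) (lattice.x_mem m) b ∈ B ∨
    -induced (xTilde F M m) (lattice.x_mem m) b ∈ B
  omega_mem : ∀ m, ∀ b ∈ B, induced (Om m) (lattice.omega_mem m) b = 0 ∨
    induced (Om m) (lattice.omega_mem m) b ∈ B ∨
    -induced (Om m) (lattice.omega_mem m) b ∈ B
  comm : ∀ m, ∀ b ∈ B, induced (Om (-m)) (lattice.omega_mem (-m)) b ≠ 0 →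
    induced (xTilde F M m) (lattice.x_mem m) b ≠ 0 →
    induced (xTilde F M m) (lattice.x_mem m) (induced (Om (-m)) (lattice.omega_mem (-m)) b) =
      induced (Om (-m)) (lattice.omega_mem (-m)) (induced (xTilde F M m) (lattice.x_mem m) b)

end Crystal

/-! ### The pair `(L(λ), B(λ))` -/

/-- `L(λ)`: the `𝔸₀`-span of the vectors `x⁻_{i_1} ⋯ x⁻_{i_k} v_λ` with `k ≥ 0` and
`i_1 ≥ ⋯ ≥ i_k`. -/
def Llam (F : Type u) [Field F] (lam : Weight) : Submodule (A0 F) (RedVerma F lam) :=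
  Submodule.span (A0 F) {x | ∃ w : List ℤ, w.Pairwise (· ≥ ·) ∧ x = mon F w • vlam F lam}

/-- `B(λ)`: the classes modulo `q L(λ)` of the vectors `x⁻_{i_1} ⋯ x⁻_{i_k} v_λ` with `k ≥ 0` and
`i_1 ≥ ⋯ ≥ i_k`. -/
def Blam (F : Type u) [Field F] (lam : Weight) : Set (QuotSMulTop (a0q F) (Llam F lam)) :=
  {b | ∃ (w : List ℤ) (hw : w.Pairwise (· ≥ ·)),
    b = Submodule.Quotient.mk ⟨mon F w • vlam F lam, Submodule.subset_span ⟨w, hw, rfl⟩⟩}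

end ImaginaryCrystal

end

/-! The theorem reduces to statements about the algebra N generated by the x⁻_n subject only to
their own quadratic relations (`CurrentAlg` at p = q⁻²). Since λ(c) = 0, γ can act by 1, and U_q
acts on N: x⁻_n by left multiplication, K and D by rescaling, h_l by a multiple of the derivation
x_n ↦ x_{n+l}, and x⁺_m as the operator that kills 1 and has the Cartan modes as commutators with
the x⁻_n. This action gives an inverse to the map N → M̃_q(λ), u ↦ u v_λ, so the module is free of
rank one over N (`negEquiv`). An operator on N with prescribed commutation rules is obtained as the
off-diagonal entry of a homomorphism from N to upper triangular 2×2 matrices, so its existence only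
requires the quadratic relations for the matrices attached to the generators. Both x⁺_m and Ω_ψ(m)
are constructed in this way; for Ω_ψ the entries are Laurent-type series and the required identity
is (t - p) g(t) = p t - 1.

Multiplied by q², the relations become x_a x_b = -x_{b-1} x_{a+1} + q²(…) and Ω(m) x_n = δ_{m+n,0} -
x_{n+1} Ω(m-1) + q²(…), and the coefficients g(r) are regular at 0. Hence decreasing words can be
straightened over 𝔸₀, and both families of operators preserve the lattice. Modulo q only the leading
terms survive: this is the straightening rule of Schur functions, x_a x_b = -x_{b-1} x_{a+1} with
x_a x_{a+1} = 0, together with an adjoint family of annihilation operators. There, every operator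
sends a decreasing word to zero or to a signed decreasing word, and creation and annihilation undo
each other where they do not vanish (`IsSpecialized.X_O_word`, `IsSpecialized.O_X_word_of_ne_zero`).

Iterated annihilation followed by the vacuum functional is dual to the decreasing words at q^{1/2} =
0 (`IsSpecialized.pairing_word`). This gives linear independence in the fibre, and over 𝔸₀ because a
matrix that reduces to the identity has nonzero determinant (`linearIndependent_of_dual_mod`). -/

noncomputable section

namespace ImaginaryCrystal

/-! ### The algebra generated by the current `x⁻` -/

section NegPart

variable {k : Type*} [Field k]

/-- The quadratic relations between the modes of a current. -/
inductive CurrentRel (p : k) : FreeAlgebra k ℤ → FreeAlgebra k ℤ → Prop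
  | quad (a b : ℤ) : CurrentRel p
      (FreeAlgebra.ι k (a + 1) * FreeAlgebra.ι k b + FreeAlgebra.ι k (b + 1) * FreeAlgebra.ι k a)
      (p • (FreeAlgebra.ι k b * FreeAlgebra.ι k (a + 1) +
        FreeAlgebra.ι k a * FreeAlgebra.ι k (b + 1)))

/-- The algebra generated by the modes of a current subject to the quadratic relations. -/
def CurrentAlg (p : k) : Type _ := RingQuot (CurrentRel p)

instance (p : k) : Ring (CurrentAlg p) := inferInstanceAs (Ring (RingQuot (CurrentRel p)))

instance (p : k) : Algebra k (CurrentAlg p) :=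
  inferInstanceAs (Algebra k (RingQuot (CurrentRel p)))

namespace CurrentAlg

variable (p : k)

/-- The quotient map from the free algebra. -/
def mk : FreeAlgebra k ℤ →ₐ[k] CurrentAlg p := RingQuot.mkAlgHom k (CurrentRel p)

/-- The modes of the current. -/
def x (n : ℤ) : CurrentAlg p := mk p (FreeAlgebra.ι k n)

/-- The quadratic relations for a family of elements of an algebra. -/
def Quad {A : Type*} [Ring A] [Algebra k A] (p : k) (f : ℤ → A) : Prop :=
  ∀ a b, f (a + 1) * f b + f (b + 1) * f a = p • (f b * f (a + 1) + f a * f (b + 1))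

lemma quad_x : Quad p (x p) := fun a b => by
  have : mk p _ = mk p _ := RingQuot.mkAlgHom_rel k (CurrentRel.quad (p := p) a b)
  simpa [x] using this

variable {p}

/-- The universal property. -/
def lift {A : Type*} [Ring A] [Algebra k A] (f : ℤ → A) (hf : Quad p f) : CurrentAlg p →ₐ[k] A :=
  RingQuot.liftAlgHom k ⟨FreeAlgebra.lift k f, by
    rintro _ _ ⟨a, b⟩
    simpa using hf a b⟩

@[simp] lemma lift_x {A : Type*} [Ring A] [Algebra k A] (f : ℤ → A) (hf : Quad p f) (n : ℤ) :
    lift f hf (x p n) = f n := by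
  simp only [lift, x, mk]
  erw [RingQuot.liftAlgHom_mkAlgHom_apply]
  simp

lemma algHom_ext {A : Type*} [Ring A] [Algebra k A] {f g : CurrentAlg p →ₐ[k] A}
    (h : ∀ n, f (x p n) = g (x p n)) : f = g := by
  apply RingQuot.ringQuot_ext'
  apply FreeAlgebra.hom_ext
  funext n
  exact h n

lemma submodule_eq_top (S : Submodule k (CurrentAlg p)) (h1 : 1 ∈ S)
    (hx : ∀ n, ∀ u ∈ S, x p n * u ∈ S) : S = ⊤ := by
  have key : ∀ a : FreeAlgebra k ℤ, ∀ u ∈ S, mk p a * u ∈ S := by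
    intro a
    induction a using FreeAlgebra.induction with
    | grade0 r =>
      intro u hu
      rw [AlgHom.commutes, ← Algebra.smul_def]
      exact S.smul_mem _ hu
    | grade1 n => exact fun u hu => hx n u hu
    | mul a b ha hb =>
      intro u hu
      rw [map_mul, mul_assoc]
      exact ha _ (hb u hu)
    | add a b ha hb =>
      intro u hu
      rw [map_add, add_mul]
      exact S.add_mem (ha u hu) (hb u hu)
  rw [eq_top_iff]
  rintro u -
  obtain ⟨a, rfl⟩ := RingQuot.mkAlgHom_surjective k (CurrentRel p) u
  have := key a 1 h1
  rwa [mul_one] at this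

lemma linearMap_ext {M : Type*} [AddCommGroup M] [Module k M] {f g : CurrentAlg p →ₗ[k] M}
    (h1 : f 1 = g 1) (hx : ∀ n u, f u = g u → f (x p n * u) = g (x p n * u)) : f = g := by
  have := submodule_eq_top (LinearMap.eqLocus f g) h1 hx
  ext u
  have hu : u ∈ LinearMap.eqLocus f g := this ▸ Submodule.mem_top
  exact hu

variable (p)

/-- Left multiplication by a mode. -/
def xL (n : ℤ) : Module.End k (CurrentAlg p) := LinearMap.mulLeft k (x p n)

variable {p}

@[simp] lemma xL_apply (n : ℤ) (u : CurrentAlg p) : xL p n u = x p n * u := rfl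

lemma quad_xL : Quad p (xL p) := fun a b => by
  ext u
  have := congrArg (· * u) (quad_x p a b)
  simpa [add_mul, mul_assoc] using this

lemma end_ext {f g : Module.End k (CurrentAlg p)} (h1 : f 1 = g 1)
    (hx : ∀ n u, f u = g u → f (x p n * u) = g (x p n * u)) : f = g := linearMap_ext h1 hx

/-- Families of operators that are the commutators of an operator with the modes. -/
def Compat (t : ℤ → Module.End k (CurrentAlg p)) : Prop :=
  ∀ a b, xL p (a + 1) * t b + t (a + 1) * xL p b + (xL p (b + 1) * t a + t (b + 1) * xL p a) =
    p • (xL p b * t (a + 1) + t b * xL p (a + 1) + (xL p a * t (b + 1) + t a * xL p (b + 1)))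

/-- The diagonal entries of the matrix relation are the quadratic relations themselves, and the
upper right entry is exactly `Compat`. A twisted Leibniz rule thus becomes multiplicativity of a map
into matrices, which the universal property supplies. -/
lemma Compat.quad {t : ℤ → Module.End k (CurrentAlg p)} (ht : Compat t) :
    Quad p (fun n => !![xL p n, t n; 0, xL p n]) := fun a b => by
  have h1 := quad_xL (p := p) a b
  have h2 := ht a b
  refine Matrix.ext fun i j => ?_
  fin_cases i <;> fin_cases j
  · simpa [Matrix.mul_apply] using h1
  · simpa [Matrix.mul_apply] using h2
  · simp
  · simpa [Matrix.mul_apply] using h1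

/-- The operator that kills `1` and has prescribed commutators with the modes. -/
def opOfComm (t : ℤ → Module.End k (CurrentAlg p)) (ht : Compat t) :
    Module.End k (CurrentAlg p) :=
  LinearMap.applyₗ 1 ∘ₗ (LinearMap.proj 1 ∘ₗ LinearMap.proj 0 :
    Matrix (Fin 2) (Fin 2) (Module.End k (CurrentAlg p)) →ₗ[k] _) ∘ₗ (lift _ ht.quad).toLinearMap

lemma opOfComm_apply (t : ℤ → Module.End k (CurrentAlg p)) (ht : Compat t) (u : CurrentAlg p) :
    opOfComm t ht u = lift _ ht.quad u 0 1 1 := rfl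

@[simp] lemma opOfComm_one (t : ℤ → Module.End k (CurrentAlg p)) (ht : Compat t) :
    opOfComm t ht 1 = 0 := by
  rw [opOfComm_apply, map_one (lift _ ht.quad)]; simp

/-- The lower right entry is left multiplication by the argument, so evaluation at 1 returns it;
this turns the product of matrices into the commutator rule for `opOfComm`. -/
lemma lift_one_one (t : ℤ → Module.End k (CurrentAlg p)) (ht : Compat t) (u : CurrentAlg p) :
    lift _ ht.quad u 1 0 = 0 ∧ lift _ ht.quad u 1 1 1 = u := by
  let S : Submodule k (CurrentAlg p) :=
    { carrier := {u | lift _ ht.quad u 1 0 = 0 ∧ lift _ ht.quad u 1 1 1 = u}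
      zero_mem' := by simp
      add_mem' := by
        rintro u w ⟨h1, h2⟩ ⟨h3, h4⟩
        simp [h1, h2, h3, h4]
      smul_mem' := by
        rintro c u ⟨h1, h2⟩
        simp [h1, h2] }
  have : S = ⊤ := by
    apply submodule_eq_top
    · simp [S]
    · rintro n u ⟨h1, h2⟩
      constructor
      · simp [Matrix.mul_apply, h1]
      · simp [Matrix.mul_apply, h2]
  have hu : u ∈ S := this ▸ Submodule.mem_top
  exact hu

lemma opOfComm_x_mul (t : ℤ → Module.End k (CurrentAlg p)) (ht : Compat t) (n : ℤ)
    (u : CurrentAlg p) : opOfComm t ht (x p n * u) = x p n * opOfComm t ht u + t n u := by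
  simp [opOfComm_apply, Matrix.mul_apply, (lift_one_one t ht u).2]

lemma opOfComm_mul_xL (t : ℤ → Module.End k (CurrentAlg p)) (ht : Compat t) (n : ℤ) :
    opOfComm t ht * xL p n = xL p n * opOfComm t ht + t n := by
  ext u
  simpa using opOfComm_x_mul t ht n u

/-- The automorphism `x_n ↦ a bⁿ x_n`. -/
def scale (a b : kˣ) : CurrentAlg p →ₐ[k] CurrentAlg p :=
  lift (fun n => ((a * b ^ n : kˣ) : k) • x p n) fun m n => by
    have h1 (m n : ℤ) : ((a * b ^ (m + 1) : kˣ) : k) * ((a * b ^ n : kˣ) : k) =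
        ((a ^ 2 * b ^ (m + n + 1) : kˣ) : k) := by
      rw [← Units.val_mul]; congr 1
      rw [mul_mul_mul_comm, ← zpow_add, pow_two]; congr 2; ring
    simp only [smul_mul_smul_comm, h1]
    rw [mul_comm _ ((a * b ^ (m + 1) : kˣ) : k), mul_comm _ ((a * b ^ (n + 1) : kˣ) : k), h1, h1,
      add_comm n m, ← smul_add, ← smul_add, quad_x p m n, smul_comm]

@[simp] lemma scale_x (a b : kˣ) (n : ℤ) :
    scale a b (x p n) = ((a * b ^ n : kˣ) : k) • x p n := by simp [scale]

lemma scale_scale (a b a' b' : kˣ) (u : CurrentAlg p) :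
    scale a b (scale a' b' u) = scale (a * a') (b * b') u := by
  have : (scale a b).comp (scale a' b') = scale (p := p) (a * a') (b * b') :=
    algHom_ext fun n => by
      simp [smul_smul, mul_zpow]
      ring_nf
  exact DFunLike.congr_fun this u

@[simp] lemma scale_one_one (u : CurrentAlg p) : scale 1 1 u = u := by
  have : scale (p := p) 1 1 = AlgHom.id k _ := algHom_ext fun n => by simp
  rw [this]; rfl

/-- The derivation `x_n ↦ x_{n+l}`. -/
def shift (l : ℤ) : Module.End k (CurrentAlg p) :=
  opOfComm (fun n => xL p (n + l)) fun a b => by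
    have h1 := quad_xL (p := p) a (b + l)
    have h2 := quad_xL (p := p) (a + l) b
    simp only [add_right_comm _ l 1] at *
    have := congrArg₂ (· + ·) h1 h2
    simp only [← smul_add] at this
    calc _ = _ := by abel
      _ = _ := this
      _ = _ := by congr 1; abel

@[simp] lemma shift_one (l : ℤ) : shift l (1 : CurrentAlg p) = 0 := opOfComm_one _ _

@[simp] lemma shift_x_mul (l n : ℤ) (u : CurrentAlg p) :
    shift l (x p n * u) = x p n * shift l u + x p (n + l) * u := opOfComm_x_mul _ _ _ _

lemma shift_shift (l m : ℤ) (u : CurrentAlg p) :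
    shift l (shift m u) = shift m (shift l u) := by
  have : (shift l : Module.End k (CurrentAlg p)) * shift m = shift m * shift l := by
    apply end_ext
    · simp
    · intro n u h
      simp only [Module.End.mul_apply] at h
      simp [h, add_right_comm n m l]
      abel
  exact DFunLike.congr_fun this u

lemma scale_shift (a b : kˣ) (l : ℤ) (u : CurrentAlg p) :
    scale a b (shift l u) = ((b ^ l : kˣ) : k) • shift l (scale a b u) := by
  have : ((scale a b).toLinearMap : Module.End k (CurrentAlg p)) * shift l =
      ((b ^ l : kˣ) : k) • (shift l * (scale a b).toLinearMap) := by
    apply end_ext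
    · simp
    · intro n u h
      simp only [Module.End.mul_apply, LinearMap.smul_apply, AlgHom.toLinearMap_apply] at h
      simp only [Module.End.mul_apply, shift_x_mul, AlgHom.toLinearMap_apply, map_add, map_mul,
        scale_x, h, LinearMap.smul_apply, smul_add, Algebra.smul_mul_assoc, map_smul,
        Algebra.mul_smul_comm, smul_smul]
      congr 2
      rw [← Units.val_mul]; congr 1
      rw [zpow_add]; simp [mul_comm, mul_left_comm]
  exact DFunLike.congr_fun this u

end CurrentAlg

end NegPart

/-! ### Exponentials of power series with commuting coefficients -/

section Exponential

open Finset PowerSeries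

variable {k : Type*} [Field k] {A : Type*} [Ring A] [Algebra k A]

/-- The coefficient of `X^n` in `exp Y`, for a power series `Y` without constant term. -/
def expCoeffIn (k : Type*) [Field k] {A : Type*} [Ring A] [Algebra k A] (n : ℕ)
    (Y : PowerSeries A) : A :=
  ∑ j ∈ range (n + 1), ((Nat.factorial j : k)⁻¹) • coeff n (Y ^ j)

/-- The derivation `X d/dX` of power series. -/
def eulerOp (f : PowerSeries A) : PowerSeries A :=
  PowerSeries.mk fun n => (n : A) * coeff n f

lemma coeff_eulerOp (f : PowerSeries A) (n : ℕ) : coeff n (eulerOp f) = n * coeff n f := by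
  simp [eulerOp]

lemma eulerOp_mul (f g : PowerSeries A) : eulerOp (f * g) = eulerOp f * g + f * eulerOp g := by
  ext n
  simp only [coeff_eulerOp, coeff_mul, map_add, mul_sum, ← sum_add_distrib]
  refine sum_congr rfl fun ij hij => ?_
  rw [← mem_antidiagonal.1 hij, Nat.cast_add, add_mul, mul_assoc, ← mul_assoc (coeff ij.1 f),
    ← Nat.cast_comm, mul_assoc]

lemma commute_of_coeff {f g : PowerSeries A} (h : ∀ i j, Commute (coeff i f) (coeff j g)) :
    Commute f g := by
  ext n
  rw [coeff_mul, coeff_mul, ← Nat.sum_antidiagonal_swap]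
  exact sum_congr rfl fun ij _ => h _ _

lemma eulerOp_pow_succ {f : PowerSeries A} (h : ∀ i j, Commute (coeff i f) (coeff j f)) (j : ℕ) :
    eulerOp (f ^ (j + 1)) = (j + 1 : ℕ) • (eulerOp f * f ^ j) := by
  have hc : Commute f (eulerOp f) := commute_of_coeff fun i l => by
    rw [coeff_eulerOp]
    exact (Nat.cast_commute l _).symm.mul_right (h i l)
  induction j with
  | zero => simp
  | succ j ih =>
    rw [pow_succ', eulerOp_mul, ih, mul_smul_comm, ← mul_assoc, hc.eq, mul_assoc, ← pow_succ',
      succ_nsmul _ (j + 1), add_comm]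

lemma coeff_pow_eq_zero {f : PowerSeries A} (h : coeff 0 f = 0) {n j : ℕ} (hn : n < j) :
    coeff n (f ^ j) = 0 := by
  induction j generalizing n with
  | zero => omega
  | succ j ih =>
    rw [pow_succ', coeff_mul]
    refine sum_eq_zero fun ab hab => ?_
    have := mem_antidiagonal.1 hab
    rcases Nat.eq_zero_or_pos ab.1 with h0 | h0
    · rw [h0, h, zero_mul]
    · rw [ih (by omega), mul_zero]

/-- `X` satisfies the recursion for the coefficients of `exp (∑ y_i z^i)`. -/
structure IsExp (k : Type*) [Field k] {A : Type*} [Ring A] [Algebra k A] (y X : ℕ → A) : Prop where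
  zero : X 0 = 1
  recursion : ∀ n : ℕ, (n : k) • X n = ∑ ij ∈ antidiagonal n, (ij.1 : k) • (y ij.1 * X ij.2)

lemma expCoeffIn_eq [CharZero k] {f : PowerSeries A} (h : coeff 0 f = 0) {n N : ℕ} (hn : n ≤ N) :
    expCoeffIn k n f = ∑ j ∈ range (N + 1), ((Nat.factorial j : k)⁻¹) • coeff n (f ^ j) := by
  refine sum_subset (range_mono (by omega)) fun j _ hj => ?_
  rw [coeff_pow_eq_zero h (by simpa using hj), smul_zero]

/-- Logarithmic derivative: the Euler operator takes exp Y to (Euler Y) · exp Y because the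
coefficients commute. In characteristic zero this recursion determines the sequence, so later
identities follow by induction on the degree and never return to the exponential. -/
lemma isExp_expCoeffIn [CharZero k] {y : ℕ → A} (h0 : y 0 = 0) (hy : ∀ i j, Commute (y i) (y j)) :
    IsExp k y fun n => expCoeffIn k n (PowerSeries.mk y) := by
  constructor
  · simp [expCoeffIn]
  · intro n
    have hY : coeff 0 (PowerSeries.mk y) = 0 := by simpa using h0
    rw [expCoeffIn_eq hY (Nat.le_succ n), sum_range_succ', smul_add, smul_sum]
    have hz : (n : k) • ((Nat.factorial 0 : k)⁻¹ • coeff n (PowerSeries.mk y ^ 0)) = 0 := by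
      rcases Nat.eq_zero_or_pos n with rfl | hn
      · simp
      · simp [coeff_one, hn.ne']
    rw [hz, add_zero]
    have key (j : ℕ) : (n : k) • ((Nat.factorial (j + 1) : k)⁻¹ •
        coeff n (PowerSeries.mk y ^ (j + 1))) = ∑ ij ∈ antidiagonal n, (ij.1 : k) •
          (y ij.1 * ((Nat.factorial j : k)⁻¹ • coeff ij.2 (PowerSeries.mk y ^ j))) := by
      have h1 := congrArg (coeff n) (eulerOp_pow_succ (f := PowerSeries.mk y)
        (by simpa using hy) j)
      rw [coeff_eulerOp, map_nsmul, coeff_mul] at h1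
      rw [smul_comm, ← map_natCast (algebraMap k A)] at *
      rw [← Algebra.smul_def] at h1
      rw [h1, ← Nat.cast_smul_eq_nsmul k, smul_smul, Nat.factorial_succ, Nat.cast_mul, mul_inv_rev,
        mul_assoc, inv_mul_cancel₀ (by exact_mod_cast j.succ_ne_zero), mul_one, smul_sum]
      refine sum_congr rfl fun ij _ => ?_
      rw [coeff_eulerOp, coeff_mk, mul_smul_comm, smul_comm, mul_assoc, Nat.cast_smul_eq_nsmul,
        nsmul_eq_mul]
    simp only [key]
    rw [sum_comm]
    refine sum_congr rfl fun ij hij => ?_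
    rw [← smul_sum, ← mul_sum,
      expCoeffIn_eq hY (show ij.2 ≤ n by have := mem_antidiagonal.1 hij; omega)]

lemma IsExp.semiconj [CharZero k] {y X : ℕ → A} (h : IsExp k y X) {d : A} {b : k}
    (hd : ∀ i, d * y i = b ^ i • (y i * d)) (n : ℕ) : d * X n = b ^ n • (X n * d) := by
  induction n using Nat.strong_induction_on with
  | _ n ih =>
    rcases Nat.eq_zero_or_pos n with rfl | hn
    · simp [h.zero]
    · have hn' : (n : k) ≠ 0 := by exact_mod_cast hn.ne'
      apply smul_right_injective A hn'
      simp only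
      rw [← mul_smul_comm, smul_comm, ← smul_mul_assoc, h.recursion, mul_sum, sum_mul, smul_sum]
      refine sum_congr rfl fun ij hij => ?_
      have := mem_antidiagonal.1 hij
      rcases Nat.eq_zero_or_pos ij.1 with h0 | h0
      · simp [h0]
      · rw [mul_smul_comm, ← mul_assoc, hd, smul_mul_assoc, mul_assoc, ih _ (by omega),
          mul_smul_comm, smul_smul, smul_smul, smul_mul_assoc, smul_smul, ← this, pow_add,
          mul_assoc]
        congr 1
        · ring
        · rw [mul_assoc]

lemma IsExp.commute [CharZero k] {y X : ℕ → A} (h : IsExp k y X) {d : A}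
    (hd : ∀ i, Commute d (y i)) (n : ℕ) : Commute d (X n) := by
  have := h.semiconj (d := d) (b := 1) (fun i => by simpa using (hd i).eq) n
  rw [one_pow, one_smul] at this
  exact this

/-- The coefficients of `(1 - p t) / (1 - P t)`. -/
def ratioCoeff (P p : k) (n : ℕ) : k :=
  if n = 0 then 1 else P ^ n - p * P ^ (n - 1)

lemma ratioCoeff_succ (P p : k) (n : ℕ) :
    ratioCoeff P p (n + 1) = P * ratioCoeff P p n - if n = 0 then p else 0 := by
  rcases n with _ | n
  · simp [ratioCoeff]
  · simp [ratioCoeff]; ring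

/-- This is the logarithmic derivative of (1 - p t)/(1 - P t): multiplying by 1/(1 - p t) leaves
1/(1 - P t), and multiplying by 1/(1 - P t) leaves the same series plus the derivative term. -/
lemma ratioCoeff_rec (P p : k) (n : ℕ) :
    ∑ ij ∈ antidiagonal n, (P ^ ij.1 - p ^ ij.1) * ratioCoeff P p ij.2 = n * ratioCoeff P p n := by
  have key (n : ℕ) : ∑ ij ∈ antidiagonal n, p ^ ij.1 * ratioCoeff P p ij.2 = P ^ n := by
    induction n with
    | zero => simp [ratioCoeff]
    | succ n ih =>
      rw [Nat.sum_antidiagonal_succ]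
      simp only [pow_succ', mul_assoc, ← mul_sum, ih]
      simp [ratioCoeff, pow_succ']
  have key2 (n : ℕ) : ∑ ij ∈ antidiagonal n, P ^ ij.1 * ratioCoeff P p ij.2 =
      P ^ n + n * ratioCoeff P p n := by
    induction n with
    | zero => simp [ratioCoeff]
    | succ n ih =>
      rw [Nat.sum_antidiagonal_succ]
      simp only [pow_succ', mul_assoc, ← mul_sum, ih]
      rw [ratioCoeff_succ]
      rcases n with _ | n
      · simp [ratioCoeff]; ring
      · simp [ratioCoeff]; ring
  simp only [sub_mul, sum_sub_distrib, key, key2]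
  ring

/-- Commutation of an exponential with a current on which the exponents act by shifts. -/
lemma IsExp.mul_current [CharZero k] {y X : ℕ → A} (h : IsExp k y X) {x : ℤ → A} {P p : k}
    {s : ℕ → k} (hs : ∀ i : ℕ, i * s i = P ^ i - p ^ i)
    (hx : ∀ (i : ℕ) (l : ℤ), y i * x l - x l * y i = s i • x (l + i)) (n : ℕ) (l : ℤ) :
    X n * x l = ∑ ij ∈ antidiagonal n, ratioCoeff P p ij.1 • (x (l + ij.1) * X ij.2) := by
  induction n using Nat.strong_induction_on with
  | _ n ih =>
    rcases Nat.eq_zero_or_pos n with rfl | hn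
    · simp [h.zero, ratioCoeff]
    have hn' : (n : k) ≠ 0 := by exact_mod_cast hn.ne'
    apply smul_right_injective A hn'
    simp only
    rw [← smul_mul_assoc, h.recursion, sum_mul]
    have step : ∀ ij ∈ antidiagonal n, (ij.1 : k) • (y ij.1 * X ij.2) * x l =
        ∑ ab ∈ antidiagonal ij.2,
          ((ratioCoeff P p ab.1 * ij.1) • (x (l + ab.1) * (y ij.1 * X ab.2)) +
          ((P ^ ij.1 - p ^ ij.1) * ratioCoeff P p ab.1) •
            (x (l + (ab.1 + ij.1 : ℕ)) * X ab.2)) := by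
      intro ij hij
      have hsum := mem_antidiagonal.1 hij
      rcases Nat.eq_zero_or_pos ij.1 with h0 | h0
      · simp [h0]
      rw [smul_mul_assoc, mul_assoc, ih _ (by omega), mul_sum, smul_sum]
      refine sum_congr rfl fun ab _ => ?_
      have h1 := hx ij.1 (l + ab.1)
      rw [sub_eq_iff_eq_add] at h1
      rw [mul_smul_comm, ← mul_assoc, h1, add_mul, smul_add, smul_add, add_comm, ← hs]
      congr 1
      · rw [smul_smul, mul_comm, mul_assoc]
      · rw [smul_mul_assoc, smul_smul, smul_smul]
        congr 1
        · ring
        · congr 2; push_cast; ring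
    rw [sum_congr rfl step]
    simp only [sum_add_distrib]
    rw [sum_sigma', sum_sigma']
    -- When y has passed x, the inner sum is again the recursion for X and contributes the weight
    -- `ab.2`; the commutator terms in `e2` contribute `ab.1` by `ratioCoeff_rec`. Together the
    -- weights add up to n.
    have e1 : ∑ z ∈ (antidiagonal n).sigma fun ij => antidiagonal ij.2,
        (ratioCoeff P p z.2.1 * z.1.1) • (x (l + z.2.1) * (y z.1.1 * X z.2.2)) =
        ∑ ab ∈ antidiagonal n, ratioCoeff P p ab.1 • (x (l + ab.1) * ((ab.2 : k) • X ab.2)) := by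
      simp only [h.recursion, mul_sum, smul_sum]
      rw [sum_sigma']
      refine sum_nbij' (fun z => ⟨(z.2.1, z.1.1 + z.2.2), (z.1.1, z.2.2)⟩)
        (fun z => ⟨(z.2.1, z.1.1 + z.2.2), (z.1.1, z.2.2)⟩) ?_ ?_ ?_ ?_ ?_
      · rintro ⟨⟨a, b⟩, ⟨c, d⟩⟩ hz; simp at hz ⊢; omega
      · rintro ⟨⟨a, b⟩, ⟨c, d⟩⟩ hz; simp at hz ⊢; omega
      · rintro ⟨⟨a, b⟩, ⟨c, d⟩⟩ hz; simp at hz ⊢; omega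
      · rintro ⟨⟨a, b⟩, ⟨c, d⟩⟩ hz; simp at hz ⊢; omega
      · rintro ⟨⟨a, b⟩, ⟨c, d⟩⟩ hz
        rw [mul_smul_comm, smul_smul]
    have e2 : ∑ z ∈ (antidiagonal n).sigma fun ij => antidiagonal ij.2,
        ((P ^ z.1.1 - p ^ z.1.1) * ratioCoeff P p z.2.1) •
            (x (l + (z.2.1 + z.1.1 : ℕ)) * X z.2.2) =
        ∑ ab ∈ antidiagonal n, ((ab.1 : k) * ratioCoeff P p ab.1) • (x (l + ab.1) * X ab.2) := by
      simp only [← ratioCoeff_rec, sum_smul]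
      rw [sum_sigma']
      refine sum_nbij' (fun z => ⟨(z.2.1 + z.1.1, z.2.2), (z.1.1, z.2.1)⟩)
        (fun z => ⟨(z.2.1, z.2.2 + z.1.2), (z.2.2, z.1.2)⟩) ?_ ?_ ?_ ?_ ?_
      · rintro ⟨⟨a, b⟩, ⟨c, d⟩⟩ hz; simp at hz ⊢; omega
      · rintro ⟨⟨a, b⟩, ⟨c, d⟩⟩ hz; simp at hz ⊢; omega
      · rintro ⟨⟨a, b⟩, ⟨c, d⟩⟩ hz; simp at hz ⊢; omega
      · rintro ⟨⟨a, b⟩, ⟨c, d⟩⟩ hz; simp at hz ⊢; omega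
      · rintro ⟨⟨a, b⟩, ⟨c, d⟩⟩ hz
        rfl
    rw [e1, e2, ← sum_add_distrib, smul_sum]
    refine sum_congr rfl fun ab hab => ?_
    rw [← mem_antidiagonal.1 hab, mul_smul_comm, smul_smul, smul_smul, ← add_smul]
    congr 1
    push_cast; ring

/-- The extension of a sequence by zero to negative indices. -/
def extendZero (X : ℕ → A) (n : ℤ) : A := if 0 ≤ n then X n.toNat else 0

/-- Multiplying `mul_current` by the denominator 1 - P t leaves a relation with finitely many terms.
The extension by zero makes it valid at every integer index, including n = -1, where it says that X
0 = 1 is central. -/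
lemma IsExp.mul_current_two_term [CharZero k] {y X : ℕ → A} (h : IsExp k y X) {x : ℤ → A}
    {P p : k} {s : ℕ → k} (hs : ∀ i : ℕ, i * s i = P ^ i - p ^ i)
    (hx : ∀ (i : ℕ) (l : ℤ), y i * x l - x l * y i = s i • x (l + i)) (n l : ℤ) :
    extendZero X (n + 1) * x l - P • (extendZero X n * x (l + 1)) =
      x l * extendZero X (n + 1) - p • (x (l + 1) * extendZero X n) := by
  rcases lt_trichotomy n (-1) with hn | rfl | hn
  · simp [extendZero, show ¬ 0 ≤ n by omega, show ¬ 0 ≤ n + 1 by omega]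
  · simp [extendZero, h.zero]
  · obtain ⟨m, rfl⟩ := Int.eq_ofNat_of_zero_le (show 0 ≤ n by omega)
    have e : ((m : ℤ) + 1).toNat = m + 1 := by omega
    simp only [extendZero, show (0 : ℤ) ≤ m by omega, show (0 : ℤ) ≤ m + 1 by omega, if_true,
      Int.toNat_natCast, e]
    rw [h.mul_current hs hx, h.mul_current hs hx, Nat.sum_antidiagonal_succ]
    simp only [ratioCoeff_succ, sub_smul, sum_sub_distrib, mul_smul, smul_sum]
    have e1 : ∑ ij ∈ antidiagonal m,
        P • ratioCoeff P p ij.1 • (x (l + (ij.1 + 1 : ℕ)) * X ij.2) =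
        ∑ ij ∈ antidiagonal m, P • ratioCoeff P p ij.1 • (x (l + 1 + ij.1) * X ij.2) :=
      sum_congr rfl fun ij _ => by congr 4; push_cast; ring
    have e2 : ∑ ij ∈ antidiagonal m,
        (if ij.1 = 0 then p else 0) • (x (l + (ij.1 + 1 : ℕ)) * X ij.2) =
        p • (x (l + 1) * X m) := by
      rw [sum_eq_single (0, m)]
      · simp
      · rintro ⟨a, b⟩ hab hne
        have : a ≠ 0 := by
          rintro rfl
          simp at hab hne
          exact hne hab
        simp [this]
      · simp
    rw [e1, e2]
    have e3 : ratioCoeff P p 0 = 1 := rfl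
    simp only [e3, one_smul, Nat.cast_zero, add_zero]
    abel

end Exponential

/-! ### Operators on the current algebra -/

section Operators

variable {k : Type*} [Field k] {A : Type*} [Ring A] [Algebra k A]

/-- Commutation of a current with a Cartan current. -/
def TwoTerm (Q : k) (T x : ℤ → A) : Prop :=
  ∀ a l, T (a + 1) * x l - Q • (T a * x (l + 1)) = Q • (x l * T (a + 1)) - x (l + 1) * T a

/-- Reversing both indices replaces Q by Q⁻¹, so a Cartan current supported in nonpositive degrees
is handled by the statement for nonnegative degrees. -/
lemma TwoTerm.reverse {Q : k} (hQ : Q ≠ 0) {T x : ℤ → A}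
    (h : TwoTerm Q⁻¹ (fun n => T (-n)) fun n => x (-n)) : TwoTerm Q T x := fun a l => by
  have h1 := congrArg (Q • ·) (h (-a - 1) (-l - 1))
  simp only [smul_sub, smul_smul, mul_inv_cancel₀ hQ, one_smul] at h1
  rw [show -(-a - 1 + 1) = a by ring, show -(-a - 1) = a + 1 by ring,
    show -(-l - 1 + 1) = l by ring, show -(-l - 1) = l + 1 by ring] at h1
  linear_combination (norm := module) -h1

lemma TwoTerm.sub {Q : k} {T S x : ℤ → A} (h : TwoTerm Q T x) (h' : TwoTerm Q S x) :
    TwoTerm Q (fun n => T n - S n) x := fun a l => by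
  simp only [sub_mul, mul_sub, smul_sub]
  linear_combination (norm := module) h a l - h' a l

lemma TwoTerm.smul {Q : k} {T x : ℤ → A} (h : TwoTerm Q T x) (c : k) :
    TwoTerm Q (fun n => c • T n) x := fun a l => by
  simp only [smul_mul_assoc, mul_smul_comm]
  linear_combination (norm := module) c • h a l

/-- The exponential alone gives the asymmetric pair P = Q, p = Q⁻¹; the factor Q from moving K
across x turns the right-hand coefficients 1 and Q⁻¹ into Q and 1. -/
lemma IsExp.twoTerm [CharZero k] {y X : ℕ → A} (h : IsExp k y X) {x : ℤ → A} {Q : k} (hQ : Q ≠ 0)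
    {s : ℕ → k} (hs : ∀ i : ℕ, i * s i = Q ^ i - Q⁻¹ ^ i)
    (hx : ∀ (i : ℕ) (l : ℤ), y i * x l - x l * y i = s i • x (l + i)) {K : A}
    (hK : ∀ l, K * x l = Q • (x l * K)) : TwoTerm Q (fun n => K * extendZero X n) x := by
  intro a l
  have h1 := congrArg (K * ·) (h.mul_current_two_term hs hx a l)
  simp only [mul_sub, mul_smul_comm, ← mul_assoc, hK, smul_mul_assoc, smul_smul,
    inv_mul_cancel₀ hQ, one_smul] at h1 ⊢
  exact h1

namespace CurrentAlg

variable {p : k}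

/-- The operator that scales `x_{n_1} ⋯ x_{n_s}` by `c a^s b^{n_1 + ⋯ + n_s}`. -/
def wt (c a b : kˣ) : Module.End k (CurrentAlg p) := (c : k) • (scale a b).toLinearMap

@[simp] lemma wt_apply (c a b : kˣ) (u : CurrentAlg p) : wt c a b u = (c : k) • scale a b u := rfl

lemma wt_mul (c a b c' a' b' : kˣ) :
    wt c a b * wt c' a' b' = wt (p := p) (c * c') (a * a') (b * b') := by
  ext u
  simp [scale_scale, smul_smul, mul_comm]

lemma wt_one : wt (p := p) 1 1 1 = 1 := by
  ext u
  simp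

lemma wt_mul_xL (c a b : kˣ) (n : ℤ) :
    wt c a b * xL p n = ((a * b ^ n : kˣ) : k) • (xL p n * wt c a b) := by
  ext u
  simp [smul_smul, mul_comm]

lemma wt_mul_shift (c a b : kˣ) (l : ℤ) :
    wt c a b * shift l = ((b ^ l : kˣ) : k) • (shift (p := p) l * wt c a b) := by
  ext u
  simp [scale_shift, smul_smul, mul_comm]

lemma shift_mul_xL (l n : ℤ) : shift l * xL p n - xL p n * shift l = xL p (n + l) := by
  ext u
  simp

lemma shift_commute (l m : ℤ) : Commute (shift (p := p) l) (shift m) :=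
  LinearMap.ext fun u => shift_shift l m u

/-- Symmetrizing: the condition is the sum of the exchange relation at (m + a, b) and the one at (m
+ b, a). -/
lemma compat_of_twoTerm {T : ℤ → Module.End k (CurrentAlg p)} (hT : TwoTerm p T (xL p)) (m : ℤ) :
    Compat fun n => T (m + n) := fun a b => by
  have h1 := hT (m + a) b
  have h2 := hT (m + b) a
  simp only [add_assoc] at *
  linear_combination (norm := module) h1 + h2

/-! ### Raising operators with a prescribed Cartan commutator -/

section Raising

variable {T : ℤ → Module.End k (CurrentAlg p)} (hT : TwoTerm p T (xL p))

/-- The operators that kill `1` and have prescribed commutators with the modes. -/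
def raise (m : ℤ) : Module.End k (CurrentAlg p) :=
  opOfComm (fun n => T (m + n)) (compat_of_twoTerm hT m)

@[simp] lemma raise_one (m : ℤ) : raise hT m 1 = 0 := opOfComm_one _ _

lemma raise_mul_xL (m n : ℤ) : raise hT m * xL p n = xL p n * raise hT m + T (m + n) :=
  opOfComm_mul_xL _ _ _

/-- The difference f - g kills 1 and commutes with each mode up to a scalar, so it kills all words.
-/
lemma end_ext_xL {f g : Module.End k (CurrentAlg p)} (h1 : f 1 = g 1)
    (hx : ∀ n, ∃ c : k, f * xL p n - g * xL p n = c • (xL p n * (f - g))) : f = g := by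
  rw [← sub_eq_zero]
  apply end_ext
  · simp [h1]
  · intro n u hu
    obtain ⟨c, hc⟩ := hx n
    have := DFunLike.congr_fun hc u
    rw [LinearMap.zero_apply] at hu ⊢
    rw [LinearMap.smul_apply, Module.End.mul_apply, hu, map_zero, smul_zero] at this
    exact this

/-- Jacobi identity: shifts commute with T and move x_n to x_{n+l}, so both sides have commutator -T
(l + m + n) with x_n, and both kill 1. -/
lemma shift_raise (hs : ∀ l n, Commute (shift l) (T n)) (l m : ℤ) :
    shift l * raise hT m - raise hT m * shift l = - raise hT (l + m) := by
  rw [sub_eq_iff_eq_add]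
  apply end_ext
  · simp
  · intro n u hu
    have e (m : ℤ) (w : CurrentAlg p) :
        raise hT m (x p n * w) = x p n * raise hT m w + T (m + n) w :=
      DFunLike.congr_fun (raise_mul_xL hT m n) w
    have e2 (m : ℤ) (w : CurrentAlg p) :
        raise hT m (x p (n + l) * w) = x p (n + l) * raise hT m w + T (m + (n + l)) w :=
      DFunLike.congr_fun (raise_mul_xL hT m (n + l)) w
    have e3 (n : ℤ) (w : CurrentAlg p) : shift l (T n w) = T n (shift l w) :=
      DFunLike.congr_fun (hs l n) w
    simp only [Module.End.mul_apply, LinearMap.add_apply, LinearMap.neg_apply] at hu ⊢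
    simp only [shift_x_mul, map_add, e, e2, e3, hu, mul_add, mul_neg]
    rw [show m + (n + l) = l + m + n by ring]
    abel

lemma wt_raise {c a b : kˣ} (hw : ∀ n, wt c a b * T n = ((b ^ n : kˣ) : k) • (T n * wt c a b))
    (m : ℤ) : wt c a b * raise hT m = ((a⁻¹ * b ^ m : kˣ) : k) • (raise hT m * wt c a b) := by
  apply end_ext_xL
  · simp
  · intro n
    have e1 : ((a⁻¹ * b ^ m : kˣ) : k) * ((a * b ^ n : kˣ) : k) = ((b ^ (m + n) : kˣ) : k) := by
      rw [← Units.val_mul, zpow_add]; congr 1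
      rw [mul_mul_mul_comm]; simp
    refine ⟨((a * b ^ n : kˣ) : k), ?_⟩
    rw [mul_assoc, raise_mul_xL, mul_add, ← mul_assoc, wt_mul_xL, hw, smul_mul_assoc, mul_assoc,
      smul_mul_assoc, mul_assoc, wt_mul_xL, mul_smul_comm, ← mul_assoc (raise hT m), raise_mul_xL,
      smul_smul, mul_sub, mul_smul_comm, e1, add_mul, smul_add, ← e1, mul_assoc, smul_sub]
    module

/-- Both sides kill 1, and their commutators with x_n agree by two instances of the exchange
relation between T and the raising operators. The relations among the x⁺ are thereby reduced to
relations linear in x⁺. -/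
lemma quad_raise {Q : k} (hr : TwoTerm Q T (raise hT)) (a b : ℤ) :
    raise hT (a + 1) * raise hT b - Q • (raise hT b * raise hT (a + 1)) =
      Q • (raise hT a * raise hT (b + 1)) - raise hT (b + 1) * raise hT a := by
  apply end_ext_xL
  · simp
  · intro n
    have e (a b : ℤ) : raise hT a * raise hT b * xL p n = xL p n * (raise hT a * raise hT b) +
        T (a + n) * raise hT b + raise hT a * T (b + n) := by
      rw [mul_assoc, raise_mul_xL, mul_add, ← mul_assoc, raise_mul_xL, add_mul, mul_assoc]
    refine ⟨1, ?_⟩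
    have h1 := hr (a + n) b
    have h2 := hr (b + n) a
    rw [add_right_comm _ n 1] at h1 h2
    simp only [sub_mul, smul_mul_assoc, e, mul_sub, mul_smul_comm]
    linear_combination (norm := module) h1 + h2

end Raising

end CurrentAlg

end Operators

/-! ### The action of the quantum affine algebra on the current algebra -/

section Action

open CurrentAlg

variable {k : Type*} [Field k] (q : kˣ)

/-- The quantum integer `[n]`. -/
def qNum (q : k) (n : ℤ) : k := (q ^ n - q ^ (-n)) / (q - q⁻¹)

/-- The standing assumptions on the parameters. -/
class IsQuantumParam (q : kˣ) (p : outParam k) : Prop where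
  ne : (q : k) - (q : k)⁻¹ ≠ 0
  eq : p = (q : k) ^ (-2 : ℤ)

variable (p : k) (lam : Weight)

/-- The action of `h_l`. -/
def hOp (l : ℤ) : Module.End k (CurrentAlg p) := (-(qNum (q : k) (2 * l) / (l : k))) • shift l

/-- The action of `K`. -/
def KOp : Module.End k (CurrentAlg p) := wt (q ^ lam.h) (q ^ (-2 : ℤ)) 1

/-- The action of `K⁻¹`. -/
def KinvOp : Module.End k (CurrentAlg p) := wt (q ^ (-lam.h)) (q ^ (2 : ℤ)) 1

/-- The action of `D`. -/
def DOp : Module.End k (CurrentAlg p) := wt (q ^ lam.d) 1 q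

/-- The action of `D⁻¹`. -/
def DinvOp : Module.End k (CurrentAlg p) := wt (q ^ (-lam.d)) 1 q⁻¹

/-- The exponents of `ψ`. -/
def psiExponent (i : ℕ) : Module.End k (CurrentAlg p) := ((q : k) - (q : k)⁻¹) • hOp q p i

/-- The exponents of `φ`. -/
def phiExponent (i : ℕ) : Module.End k (CurrentAlg p) := (-((q : k) - (q : k)⁻¹)) • hOp q p (-i)

/-- The coefficients of the exponential in `ψ`. -/
def psiExp (n : ℕ) : Module.End k (CurrentAlg p) :=
  expCoeffIn k n (PowerSeries.mk (psiExponent q p))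

/-- The coefficients of the exponential in `φ`. -/
def phiExp (n : ℕ) : Module.End k (CurrentAlg p) :=
  expCoeffIn k n (PowerSeries.mk (phiExponent q p))

/-- The action of `ψ(n)`. -/
def psiOp (n : ℤ) : Module.End k (CurrentAlg p) := KOp q p lam * extendZero (psiExp q p) n

/-- The action of `φ(n)`. -/
def phiOp (n : ℤ) : Module.End k (CurrentAlg p) := KinvOp q p lam * extendZero (phiExp q p) (-n)

/-- The commutator of `x⁺_k` and `x⁻_l`, for `k + l = n`. -/
def cartanOp (n : ℤ) : Module.End k (CurrentAlg p) :=
  ((q : k) - (q : k)⁻¹)⁻¹ • (psiOp q p lam n - phiOp q p lam n)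

lemma psiExponent_eq [hq : IsQuantumParam q p] (i : ℕ) : psiExponent q p i =
    (-(((q : k) ^ (2 * (i : ℤ)) - (q : k) ^ (-(2 * (i : ℤ)))) / i)) • shift (i : ℤ) := by
  have := hq.ne
  rw [psiExponent, hOp, smul_smul, qNum]
  congr 1
  rw [Int.cast_natCast, mul_neg, div_right_comm, mul_div_cancel₀ _ this]

lemma phiExponent_eq [hq : IsQuantumParam q p] (i : ℕ) : phiExponent q p i =
    (((q : k) ^ (-(2 * (i : ℤ))) - (q : k) ^ (2 * (i : ℤ))) / (-i)) • shift (-i : ℤ) := by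
  have := hq.ne
  rw [phiExponent, hOp, smul_smul, qNum]
  congr 1
  rw [Int.cast_neg, Int.cast_natCast, neg_mul_neg, div_right_comm, mul_div_cancel₀ _ this, mul_neg,
    neg_neg]

lemma hOp_commute (l m : ℤ) : Commute (hOp q p l) (hOp q p m) :=
  ((shift_commute l m).smul_left _).smul_right _

lemma hOp_zero : hOp q p 0 = 0 := by simp [hOp]

lemma natCast_mul_div [CharZero k] {i : ℕ} {Q : k} (h : i = 0 → Q = 0) :
    (i : k) * (Q / i) = Q := by
  rcases Nat.eq_zero_or_pos i with rfl | hi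
  · simp [h rfl]
  · exact mul_div_cancel₀ _ (Nat.cast_ne_zero.2 hi.ne')

lemma zpow_pow_natCast (j : ℤ) (i : ℕ) : ((q : k) ^ j) ^ i = (q : k) ^ (j * i) := by
  rw [zpow_mul, zpow_natCast]

lemma KOp_xL (l : ℤ) : KOp q p lam * xL p l = (q : k) ^ (-2 : ℤ) • (xL p l * KOp q p lam) := by
  rw [KOp, wt_mul_xL]; simp

lemma KinvOp_xL (l : ℤ) : KinvOp q p lam * xL p l = (q : k) ^ (2 : ℤ) • (xL p l * KinvOp q p lam) := by
  rw [KinvOp, wt_mul_xL]; simp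

variable [CharZero k]

lemma isExp_psiExp : IsExp k (psiExponent q p) (psiExp q p) :=
  isExp_expCoeffIn (by simp [psiExponent, hOp_zero])
    fun i j => ((hOp_commute q p i j).smul_left _).smul_right _

lemma isExp_phiExp : IsExp k (phiExponent q p) (phiExp q p) :=
  isExp_expCoeffIn (by simp [phiExponent, hOp_zero])
    fun i j => ((hOp_commute q p (-i) (-j)).smul_left _).smul_right _

variable [hq : IsQuantumParam q p]

/-- A current on which `h_l` and `K` act like on `x^±` satisfies the quadratic exchange relations
with `ψ` and `φ`. Here `Q = q^{±2}`. -/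
lemma twoTerm_psi_phi {x : ℤ → Module.End k (CurrentAlg p)} {e : ℤ}
    (he : e = 2 ∨ e = -2)
    (hh : ∀ i l : ℤ, i ≠ 0 → shift i * x l - x l * shift i = (-((e / 2 : ℤ) : k)) • x (l + i))
    (hK : ∀ l, KOp q p lam * x l = (q : k) ^ e • (x l * KOp q p lam))
    (hKi : ∀ l, KinvOp q p lam * x l = (q : k) ^ (-e) • (x l * KinvOp q p lam)) :
    TwoTerm ((q : k) ^ e) (psiOp q p lam) x ∧ TwoTerm ((q : k) ^ e) (phiOp q p lam) x := by
  have hQ : (q : k) ^ e ≠ 0 := zpow_ne_zero _ q.ne_zero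
  constructor
  · refine (isExp_psiExp q p).twoTerm hQ
      (s := fun i => (((q : k) ^ (e * i) - (q : k) ^ (-(e * i))) / i)) (fun i => ?_) (fun i l => ?_) hK
    · rw [natCast_mul_div (by rintro rfl; simp), ← zpow_neg, zpow_pow_natCast, zpow_pow_natCast, neg_mul]
    · rcases Nat.eq_zero_or_pos i with rfl | hi
      · simp [psiExponent, hOp_zero]
      rw [psiExponent_eq]
      have h := congrArg
        ((-(((q : k) ^ (2 * (i : ℤ)) - (q : k) ^ (-(2 * (i : ℤ)))) / i)) • ·) (hh i l (by omega))
      simp only [smul_sub, smul_smul] at h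
      rw [smul_mul_assoc, mul_smul_comm, h]
      congr 1
      rcases he with rfl | rfl
      · simp
      · simp; ring
  -- φ is supported in nonpositive degrees, so its indices are reversed and the exponential lemma is
  -- used with Q⁻¹ in place of Q.
  · refine TwoTerm.reverse hQ ?_
    have : (fun n => phiOp q p lam (-n)) = fun n => KinvOp q p lam * extendZero (phiExp q p) n := by
      funext n; rw [phiOp, neg_neg]
    rw [this]
    rw [← zpow_neg]
    refine (isExp_phiExp q p).twoTerm (zpow_ne_zero _ q.ne_zero)
      (s := fun i => (((q : k) ^ (-e * i) - (q : k) ^ (e * i)) / i)) (fun i => ?_) (fun i l => ?_)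
      fun l => hKi _
    · rw [natCast_mul_div (by rintro rfl; simp), ← zpow_neg, zpow_pow_natCast, zpow_pow_natCast, neg_neg]
    · rcases Nat.eq_zero_or_pos i with rfl | hi
      · simp [phiExponent, hOp_zero]
      rw [phiExponent_eq]
      have h := congrArg
        ((((q : k) ^ (-(2 * (i : ℤ))) - (q : k) ^ (2 * (i : ℤ))) / (-i)) • ·)
        (hh (-i) (-l) (by omega))
      simp only [smul_sub, smul_smul] at h
      rw [smul_mul_assoc, mul_smul_comm, h, ← neg_add]
      congr 1
      rcases he with rfl | rfl
      · simp [div_neg]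
      · simp [div_neg]; ring

lemma twoTerm_xL : TwoTerm p (psiOp q p lam) (xL p) ∧
    TwoTerm p (phiOp q p lam) (xL p) := by
  have h := twoTerm_psi_phi q p lam (Or.inr rfl)
    (fun i l _ => by rw [shift_mul_xL]; simp) (KOp_xL q p lam) (KinvOp_xL q p lam)
  rwa [← hq.eq] at h

/-- ψ and φ satisfy the same exchange relation with x⁻, hence so does their difference; this is what
makes `xpOp` exist. -/
lemma twoTerm_cartanOp : TwoTerm p (cartanOp q p lam) (xL p) :=
  ((twoTerm_xL q p lam).1.sub (twoTerm_xL q p lam).2).smul _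

/-- The action of `x⁺_m`. -/
def xpOp (m : ℤ) : Module.End k (CurrentAlg p) := raise (twoTerm_cartanOp q p lam) m

lemma wt_psiExp (c a b : kˣ) (n : ℕ) :
    wt c a b * psiExp q p n = (b : k) ^ n • (psiExp q p n * wt c a b) :=
  (isExp_psiExp q p).semiconj (fun i => by
    rw [psiExponent_eq, mul_smul_comm, wt_mul_shift, smul_mul_assoc, smul_comm]; simp) n

lemma wt_phiExp (c a b : kˣ) (n : ℕ) :
    wt c a b * phiExp q p n = ((b⁻¹ : kˣ) : k) ^ n • (phiExp q p n * wt c a b) :=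
  (isExp_phiExp q p).semiconj (fun i => by
    rw [phiExponent_eq, mul_smul_comm, wt_mul_shift, smul_mul_assoc, smul_comm]; simp) n

lemma wt_psiOp (c a b : kˣ) (n : ℤ) :
    wt c a b * psiOp q p lam n = ((b ^ n : kˣ) : k) • (psiOp q p lam n * wt c a b) := by
  rw [psiOp, ← mul_assoc, KOp, wt_mul, mul_comm c, mul_comm a, mul_comm b, ← wt_mul, mul_assoc,
    mul_assoc, ← mul_smul_comm]
  congr 1
  unfold extendZero
  split_ifs with h
  · obtain ⟨m, rfl⟩ := Int.eq_ofNat_of_zero_le h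
    simp [wt_psiExp]
  · simp

lemma wt_phiOp (c a b : kˣ) (n : ℤ) :
    wt c a b * phiOp q p lam n = ((b ^ n : kˣ) : k) • (phiOp q p lam n * wt c a b) := by
  rw [phiOp, ← mul_assoc, KinvOp, wt_mul, mul_comm c, mul_comm a, mul_comm b, ← wt_mul, mul_assoc,
    mul_assoc, ← mul_smul_comm]
  congr 1
  unfold extendZero
  split_ifs with h
  · obtain ⟨m, hm⟩ := Int.eq_ofNat_of_zero_le h
    obtain rfl : n = -m := by omega
    simp [wt_phiExp]
  · simp

lemma wt_cartanOp (c a b : kˣ) (n : ℤ) :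
    wt c a b * cartanOp q p lam n = ((b ^ n : kˣ) : k) • (cartanOp q p lam n * wt c a b) := by
  simp only [cartanOp, mul_smul_comm, mul_sub, smul_mul_assoc, sub_mul, wt_psiOp, wt_phiOp]
  module

lemma wt_xpOp (c a b : kˣ) (m : ℤ) :
    wt c a b * xpOp q p lam m = ((a⁻¹ * b ^ m : kˣ) : k) • (xpOp q p lam m * wt c a b) :=
  wt_raise _ (wt_cartanOp q p lam c a b) m

lemma shift_commute_cartanOp (l n : ℤ) : Commute (shift l) (cartanOp q p lam n) := by
  have h1 (c a) : Commute (shift l) (wt (p := p) c a 1) := by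
    have := wt_mul_shift (p := p) c a 1 l
    simp only [one_zpow, Units.val_one, one_smul] at this
    exact this.symm
  have h2 (n : ℤ) : Commute (shift l) (extendZero (psiExp q p) n) := by
    unfold extendZero
    split_ifs
    · refine (isExp_psiExp q p).commute (fun i => ?_) _
      rw [psiExponent_eq]; exact (shift_commute l i).smul_right _
    · exact Commute.zero_right _
  have h3 (n : ℤ) : Commute (shift l) (extendZero (phiExp q p) n) := by
    unfold extendZero
    split_ifs
    · refine (isExp_phiExp q p).commute (fun i => ?_) _
      rw [phiExponent_eq]; exact (shift_commute l (-i)).smul_right _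
    · exact Commute.zero_right _
  exact (((h1 _ _).mul_right (h2 n)).sub_right ((h1 _ _).mul_right (h3 _))).smul_right _

lemma shift_xpOp (l m : ℤ) :
    shift l * xpOp q p lam m - xpOp q p lam m * shift l = - xpOp q p lam (l + m) :=
  shift_raise _ (shift_commute_cartanOp q p lam) l m

/-- The general exchange statement for ψ and φ applies to x⁺ as well, with e = 2: its hypotheses are
the commutators with shifts and scalings just established. -/
lemma twoTerm_xpOp : TwoTerm ((q : k) ^ (2 : ℤ)) (cartanOp q p lam) (xpOp q p lam) := by
  have := twoTerm_psi_phi q p lam (x := xpOp q p lam) (Or.inl rfl)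
    (fun i l _ => by rw [shift_xpOp, add_comm]; simp only [Int.reduceDiv, Int.cast_one]; module)
    (fun l => by rw [KOp, wt_xpOp]; simp) (fun l => by rw [KinvOp, wt_xpOp]; simp)
  exact (this.1.sub this.2).smul _

end Action

section Relations

open CurrentAlg

variable {k : Type*} [Field k] (q : kˣ) (p : k) (lam : Weight)

/-! ### The defining relations -/

lemma KOp_mul_KinvOp : KOp q p lam * KinvOp q p lam = 1 := by
  rw [KOp, KinvOp, wt_mul, ← wt_one, ← zpow_add, ← zpow_add]; simp

lemma KinvOp_mul_KOp : KinvOp q p lam * KOp q p lam = 1 := by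
  rw [KOp, KinvOp, wt_mul, ← wt_one, ← zpow_add, ← zpow_add]; simp

lemma DOp_mul_DinvOp : DOp q p lam * DinvOp q p lam = 1 := by
  rw [DOp, DinvOp, wt_mul, ← wt_one, ← zpow_add]; simp

lemma DinvOp_mul_DOp : DinvOp q p lam * DOp q p lam = 1 := by
  rw [DOp, DinvOp, wt_mul, ← wt_one, ← zpow_add]; simp

lemma DOp_mul_KOp : DOp q p lam * KOp q p lam = KOp q p lam * DOp q p lam := by
  rw [KOp, DOp, wt_mul, wt_mul, mul_comm, mul_comm 1, mul_comm q 1]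

lemma wt_mul_hOp (c a b : kˣ) (l : ℤ) :
    wt c a b * hOp q p l = ((b ^ l : kˣ) : k) • (hOp q p l * wt c a b) := by
  rw [hOp, mul_smul_comm, wt_mul_shift, smul_mul_assoc, smul_comm]

lemma hOp_mul_KOp (l : ℤ) : hOp q p l * KOp q p lam = KOp q p lam * hOp q p l := by
  rw [KOp, wt_mul_hOp]; simp

lemma hOp_xL (l n : ℤ) : hOp q p l * xL p n - xL p n * hOp q p l =
    (-(qNum (q : k) (2 * l) / (l : k))) • xL p (l + n) := by
  have h := congrArg ((-(qNum (q : k) (2 * l) / (l : k))) • ·) (shift_mul_xL (p := p) l n)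
  simp only [smul_sub] at h
  rw [hOp, smul_mul_assoc, mul_smul_comm, h, add_comm]

lemma conj_eq {d d' y : Module.End k (CurrentAlg p)} {c : k} (h : d * y = c • (y * d))
    (hd : d * d' = 1) : d * y * d' = c • y := by
  rw [h, smul_mul_assoc, mul_assoc, hd, mul_one]

lemma conj_DOp_hOp (l : ℤ) : DOp q p lam * hOp q p l * DinvOp q p lam = (q : k) ^ l • hOp q p l :=
  conj_eq p (by rw [DOp, wt_mul_hOp q p, Units.val_zpow_eq_zpow_val]) (DOp_mul_DinvOp q p lam)

lemma conj_DOp_xL (l : ℤ) : DOp q p lam * xL p l * DinvOp q p lam = (q : k) ^ l • xL p l :=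
  conj_eq p (by rw [DOp, wt_mul_xL, one_mul, Units.val_zpow_eq_zpow_val]) (DOp_mul_DinvOp q p lam)

lemma conj_KOp_xL (l : ℤ) : KOp q p lam * xL p l * KinvOp q p lam = (q : k) ^ (-2 : ℤ) • xL p l :=
  conj_eq p (KOp_xL q p lam l) (KOp_mul_KinvOp q p lam)

lemma quad_xL_sub [hq : IsQuantumParam q p] (a b : ℤ) : xL p (a + 1) * xL p b - (q : k) ^ (-2 : ℤ) • (xL p b * xL p (a + 1)) =
    (q : k) ^ (-2 : ℤ) • (xL p a * xL p (b + 1)) - xL p (b + 1) * xL p a := by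
  rw [← hq.eq]
  linear_combination (norm := module) quad_xL (p := p) a b

variable [CharZero k] [hq : IsQuantumParam q p]

lemma conj_DOp_xpOp (l : ℤ) :
    DOp q p lam * xpOp q p lam l * DinvOp q p lam = (q : k) ^ l • xpOp q p lam l :=
  conj_eq p (by rw [DOp, wt_xpOp q p, inv_one, one_mul, Units.val_zpow_eq_zpow_val])
    (DOp_mul_DinvOp q p lam)

lemma conj_KOp_xpOp (l : ℤ) :
    KOp q p lam * xpOp q p lam l * KinvOp q p lam = (q : k) ^ (2 : ℤ) • xpOp q p lam l :=
  conj_eq p (by rw [KOp, wt_xpOp q p]; simp) (KOp_mul_KinvOp q p lam)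

lemma hOp_xpOp (l n : ℤ) : hOp q p l * xpOp q p lam n - xpOp q p lam n * hOp q p l =
    (qNum (q : k) (2 * l) / (l : k)) • xpOp q p lam (l + n) := by
  have h := congrArg ((-(qNum (q : k) (2 * l) / (l : k))) • ·) (shift_xpOp q p lam l n)
  simp only [smul_sub] at h
  rw [hOp, smul_mul_assoc, mul_smul_comm, h]
  module

lemma quad_xpOp (a b : ℤ) : xpOp q p lam (a + 1) * xpOp q p lam b -
    (q : k) ^ (2 : ℤ) • (xpOp q p lam b * xpOp q p lam (a + 1)) =
      (q : k) ^ (2 : ℤ) • (xpOp q p lam a * xpOp q p lam (b + 1)) -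
        xpOp q p lam (b + 1) * xpOp q p lam a :=
  quad_raise _ (twoTerm_xpOp q p lam) a b

lemma xpOp_xL (a b : ℤ) : xpOp q p lam a * xL p b - xL p b * xpOp q p lam a =
    cartanOp q p lam (a + b) := by
  rw [xpOp, raise_mul_xL, add_sub_cancel_left]

end Relations

/-! ### The reduced imaginary Verma module as the current algebra -/

section Verma

open CurrentAlg

universe u

variable (F : Type u) [Field F]

lemma qHalf_ne_zero : qHalf F ≠ 0 := RatFunc.X_ne_zero

lemma qElt_ne_zero : qElt F ≠ 0 := pow_ne_zero _ (qHalf_ne_zero F)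

lemma qElt_eq : qElt F = algebraMap (Polynomial F) (Kq F) (Polynomial.X ^ 2) := by
  simp [qElt, qHalf]

lemma qElt_pow_injective : Function.Injective fun n : ℕ => qElt F ^ n := fun m n h => by
  simp only [qElt_eq, ← map_pow, ← pow_mul] at h
  have := congrArg Polynomial.natDegree (RatFunc.algebraMap_injective F h)
  simpa using this

lemma qElt_zpow_injective : Function.Injective fun n : ℤ => qElt F ^ n := by
  have key (m n : ℤ) (hmn : m ≤ n) (h : qElt F ^ m = qElt F ^ n) : m = n := by
    obtain ⟨j, rfl⟩ := Int.le.dest hmn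
    rw [zpow_add₀ (qElt_ne_zero F), left_eq_mul₀ (zpow_ne_zero _ (qElt_ne_zero F)),
      zpow_natCast, ← pow_zero (qElt F)] at h
    simp [qElt_pow_injective F h]
  intro m n h
  rcases le_total m n with hmn | hmn
  · exact key m n hmn h
  · exact (key n m hmn h.symm).symm

lemma qElt_sub_inv_ne_zero : qElt F - (qElt F)⁻¹ ≠ 0 := fun h => by
  rw [sub_eq_zero, ← zpow_neg_one, ← zpow_one (qElt F), ← zpow_mul] at h
  have := qElt_zpow_injective F h
  omega

/-- The unit `q`. -/
def qUnit : (Kq F)ˣ := Units.mk0 (qElt F) (qElt_ne_zero F)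

@[simp] lemma val_qUnit : (qUnit F : Kq F) = qElt F := rfl


/-- The parameter `q⁻²` of the quadratic relations between the `x⁻_n`. -/
irreducible_def qParam : Kq F := qElt F ^ (-2 : ℤ)

instance : IsQuantumParam (qUnit F) (qParam F) where
  ne := qElt_sub_inv_ne_zero F
  eq := by rw [qParam, val_qUnit]

/-- The algebra presented by the relations between the `x⁻_n`. -/
abbrev NegAlg : Type u := CurrentAlg (qParam F)

lemma map_expCoeff {A : Type*} [Ring A] [Algebra (Kq F) A] (f : FreeGen F →ₐ[Kq F] A) (n : ℕ)
    (Y : PowerSeries (FreeGen F)) :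
    f (expCoeff F n Y) = expCoeffIn (Kq F) n (PowerSeries.map (f : FreeGen F →+* A) Y) := by
  simp only [expCoeff, expCoeffIn, map_sum, map_smul, ← map_pow, PowerSeries.coeff_map]
  rfl

variable [CharZero F] (lam : Weight)

/-- The operators by which the generators act. -/
def genOp : Gen → Module.End (Kq F) (NegAlg F)
  | .xp n => xpOp (qUnit F) (qParam F) lam n
  | .xm n => xL (qParam F) n
  | .h l => hOp (qUnit F) (qParam F) l.1
  | .K => KOp (qUnit F) (qParam F) lam
  | .Kinv => KinvOp (qUnit F) (qParam F) lam
  | .D => DOp (qUnit F) (qParam F) lam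
  | .Dinv => DinvOp (qUnit F) (qParam F) lam
  | .gam => 1
  | .gamInv => 1

/-- The action of the free algebra. -/
def freeAct : FreeGen F →ₐ[Kq F] Module.End (Kq F) (NegAlg F) :=
  FreeAlgebra.lift (Kq F) (genOp F lam)

@[simp] lemma freeAct_gen (g : Gen) : freeAct F lam (gen F g) = genOp F lam g :=
  FreeAlgebra.lift_ι_apply _ _

@[simp] lemma freeAct_gamPow (n : ℤ) : freeAct F lam (gamPow F n) = 1 := by
  unfold gamPow
  split_ifs <;> simp [genOp]

lemma freeAct_psi (n : ℤ) : freeAct F lam (psi F n) = psiOp (qUnit F) (qParam F) lam n := by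
  unfold psi psiOp extendZero
  split_ifs with h
  · rw [map_mul, freeAct_gen, map_expCoeff]
    congr 2
    ext i : 1
    rw [PowerSeries.coeff_map, PowerSeries.coeff_mk, PowerSeries.coeff_mk, psiExponent]
    split_ifs with hi
    · simp [genOp]
    · obtain rfl : i = 0 := by omega
      simp [hOp_zero]
  · simp

lemma freeAct_phi (n : ℤ) : freeAct F lam (phi F n) = phiOp (qUnit F) (qParam F) lam n := by
  unfold phi phiOp extendZero
  simp only [Left.nonneg_neg_iff]
  split_ifs with h
  · rw [map_mul, freeAct_gen, map_expCoeff]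
    congr 2
    ext i : 1
    rw [PowerSeries.coeff_map, PowerSeries.coeff_mk, PowerSeries.coeff_mk, phiExponent]
    split_ifs with hi
    · simp [genOp]
    · obtain rfl : i = 0 := by omega
      simp [hOp_zero]
  · simp

lemma freeAct_rel {a b : FreeGen F} (h : Rel F a b) : freeAct F lam a = freeAct F lam b := by
  induction h with
  | D_Dinv => simpa [genOp] using DOp_mul_DinvOp _ _ _
  | Dinv_D => simpa [genOp] using DinvOp_mul_DOp _ _ _
  | K_Kinv => simpa [genOp] using KOp_mul_KinvOp _ _ _
  | Kinv_K => simpa [genOp] using KinvOp_mul_KOp _ _ _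
  | gam_gamInv => simp [genOp]
  | gamInv_gam => simp [genOp]
  | gam_central g => simp [genOp]
  | gamInv_central g => simp [genOp]
  | h_h i j =>
    rw [map_sub, map_mul, map_mul, freeAct_gen, freeAct_gen, sub_eq_zero.2]
    · split_ifs
      -- Since γ acts by 1, the Heisenberg term vanishes and the h_l need only commute.
      · rw [map_smul, map_sub, freeAct_gamPow, freeAct_gamPow, sub_self, smul_zero]
      · simp
    · exact (hOp_commute (qUnit F) (qParam F) i j).eq
  | h_K i => 
    rw [map_mul, map_mul, freeAct_gen, freeAct_gen]
    exact hOp_mul_KOp _ _ _ _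
  | D_K =>
    rw [map_mul, map_mul, freeAct_gen, freeAct_gen]
    exact DOp_mul_KOp _ _ _
  | D_h i =>
    rw [map_mul, map_mul, map_smul, freeAct_gen, freeAct_gen, freeAct_gen]
    exact conj_DOp_hOp _ _ _ _
  | D_xp i =>
    rw [map_mul, map_mul, map_smul, freeAct_gen, freeAct_gen, freeAct_gen]
    exact conj_DOp_xpOp _ _ _ _
  | D_xm i =>
    rw [map_mul, map_mul, map_smul, freeAct_gen, freeAct_gen, freeAct_gen]
    exact conj_DOp_xL _ _ _ _
  | K_xp i =>
    rw [map_mul, map_mul, map_smul, freeAct_gen, freeAct_gen, freeAct_gen]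
    exact conj_KOp_xpOp _ _ _ _
  | K_xm i =>
    rw [map_mul, map_mul, map_smul, freeAct_gen, freeAct_gen, freeAct_gen]
    exact conj_KOp_xL _ _ _ _
  | h_xp i j =>
    rw [map_sub, map_mul, map_mul, map_smul, map_mul, freeAct_gen, freeAct_gen, freeAct_gen,
      freeAct_gamPow, one_mul]
    exact hOp_xpOp _ _ _ _ _
  | h_xm i j =>
    rw [map_sub, map_mul, map_mul, map_smul, map_mul, freeAct_gen, freeAct_gen, freeAct_gen,
      freeAct_gamPow, one_mul]
    exact hOp_xL _ _ _ _
  | xp_xp i j =>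
    simp only [map_sub, map_mul, map_smul, freeAct_gen]
    exact quad_xpOp _ _ _ _ _
  | xm_xm i j =>
    simp only [map_sub, map_mul, map_smul, freeAct_gen]
    exact quad_xL_sub (qUnit F) _ _ _
  | xp_xm i j =>
    rw [map_sub, map_mul, map_mul, map_smul, map_sub, map_mul, map_mul, freeAct_gen, freeAct_gen,
      freeAct_gamPow, freeAct_gamPow, one_mul, one_mul, freeAct_psi, freeAct_phi]
    exact xpOp_xL _ _ _ _ _

/-- The action of the quantum affine algebra. -/
def act : Uq F →ₐ[Kq F] Module.End (Kq F) (NegAlg F) :=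
  RingQuot.liftAlgHom (Kq F) ⟨freeAct F lam, fun _ _ h => freeAct_rel F lam h⟩

lemma act_ug (g : Gen) : act F lam (ug F g) = genOp F lam g := by
  unfold act ug
  erw [RingQuot.liftAlgHom_mkAlgHom_apply]
  simp

end Verma

/-! ### Freeness of the reduced Verma module over the current algebra -/

section VermaEquiv

open CurrentAlg

universe u

variable (F : Type u) [Field F]

/-- The quotient map onto the quantum affine algebra. -/
def toUq : FreeGen F →ₐ[Kq F] Uq F := RingQuot.mkAlgHom (Kq F) (Rel F)

@[simp] lemma toUq_gen (g : Gen) : toUq F (gen F g) = ug F g := rfl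

lemma toUq_surjective : Function.Surjective (toUq F) :=
  RingQuot.mkAlgHom_surjective (Kq F) (Rel F)

lemma toUq_rel {a b : FreeGen F} (h : Rel F a b) : toUq F a = toUq F b :=
  RingQuot.mkAlgHom_rel (Kq F) h

lemma ug_inv (a b : Gen) (h : Rel F (gen F a * gen F b) 1) : ug F a * ug F b = 1 := by
  simpa using toUq_rel F h

lemma ug_mul_of_conj {g h h' : Gen} {c : Kq F} (hh : ug F h' * ug F h = 1)
    (hr : Rel F (gen F h * gen F g * gen F h') (c • gen F g)) :
    ug F h * ug F g = (c • ug F g) * ug F h := by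
  have := congrArg (· * ug F h) (toUq_rel F hr)
  simpa [mul_assoc, hh] using this

lemma quad_xm : Quad (qParam F) (xm F) := fun a b => by
  have h := toUq_rel F (Rel.xm_xm a b)
  simp only [map_sub, map_mul, map_smul, toUq_gen] at h
  rw [qParam]
  simp only [xm]
  rw [sub_eq_iff_eq_add] at h
  rw [h, smul_add]
  abel

/-- The inclusion of the current algebra into the quantum affine algebra. -/
def negIncl : NegAlg F →ₐ[Kq F] Uq F := lift (xm F) (quad_xm F)

@[simp] lemma negIncl_x (n : ℤ) : negIncl F (x _ n) = xm F n := lift_x _ _ _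

variable (lam : Weight)

/-- The action of the current algebra on `v_λ`. -/
def fromNeg : NegAlg F →ₗ[Kq F] RedVerma F lam :=
  (LinearMap.toSpanSingleton (Uq F) (RedVerma F lam) (vlam F lam)).restrictScalars (Kq F) ∘ₗ
    (negIncl F).toLinearMap

lemma fromNeg_apply (u : NegAlg F) : fromNeg F lam u = negIncl F u • vlam F lam := rfl

@[simp] lemma fromNeg_one : fromNeg F lam 1 = vlam F lam := by
  rw [fromNeg_apply, map_one, one_smul]

lemma fromNeg_x_mul (n : ℤ) (u : NegAlg F) :
    fromNeg F lam (x _ n * u) = xm F n • fromNeg F lam u := by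
  rw [fromNeg_apply, fromNeg_apply, map_mul, negIncl_x, mul_smul]

lemma mk_eq_smul_vlam (a : Uq F) : (Submodule.Quotient.mk a : Uq F ⧸ Jq F lam) = a • vlam F lam := by
  rw [vlam]
  have : (Submodule.Quotient.mk a : Uq F ⧸ Jq F lam) = a • Submodule.Quotient.mk 1 := by
    rw [← Submodule.Quotient.mk_smul, smul_eq_mul, mul_one]
  exact this

lemma smul_vlam_eq_zero {a : Uq F} (h : a ∈ verGens F lam) : a • vlam F lam = 0 := by
  rw [← mk_eq_smul_vlam]
  exact (Submodule.Quotient.mk_eq_zero _).2 (Submodule.subset_span h)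

lemma smul_vlam_of_sub {g : Uq F} {c : Kq F} (h : g - algebraMap (Kq F) (Uq F) c ∈ verGens F lam) :
    g • vlam F lam = c • vlam F lam := by
  have := smul_vlam_eq_zero F lam h
  rw [sub_smul, sub_eq_zero, algebraMap_smul] at this
  exact this

lemma coeff_pow_mem {R A : Type*} [CommRing R] [Ring A] [Algebra R A] (S : Subalgebra R A)
    {Y : PowerSeries A} (hY : ∀ n, PowerSeries.coeff n Y ∈ S) (j n : ℕ) :
    PowerSeries.coeff n (Y ^ j) ∈ S := by
  induction j generalizing n with
  | zero =>
    rw [pow_zero, PowerSeries.coeff_one]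
    split_ifs
    exacts [S.one_mem, S.zero_mem]
  | succ j ih =>
    rw [pow_succ, PowerSeries.coeff_mul]
    exact S.sum_mem fun ij _ => S.mul_mem (ih _) (hY _)

lemma expCoeff_mem (S : Subalgebra (Kq F) (FreeGen F)) {Y : PowerSeries (FreeGen F)}
    (hY : ∀ n, PowerSeries.coeff n Y ∈ S) (n : ℕ) : expCoeff F n Y ∈ S :=
  S.sum_mem fun j _ => S.smul_mem (coeff_pow_mem S hY j n) _

variable [CharZero F]

lemma act_negIncl (u w : NegAlg F) : act F lam (negIncl F u) w = u * w := by
  have : (act F lam).comp (negIncl F) = Algebra.lmul (Kq F) (NegAlg F) := by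
    apply algHom_ext
    intro n
    rw [AlgHom.comp_apply, negIncl_x, xm, act_ug]
    rfl
  exact DFunLike.congr_fun (DFunLike.congr_fun this u) w

/-- The elements of the quantum affine algebra whose actions are intertwined by `fromNeg`. -/
def intertwined : Subalgebra (Kq F) (Uq F) where
  carrier := {a | ∀ u, a • fromNeg F lam u = fromNeg F lam (act F lam a u)}
  mul_mem' := by
    intro a b ha hb u
    rw [mul_smul, hb, ha, map_mul, Module.End.mul_apply]
  add_mem' := by
    intro a b ha hb u
    rw [add_smul, hb, ha, map_add, LinearMap.add_apply, map_add]
  algebraMap_mem' := by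
    intro c u
    rw [algebraMap_smul, AlgHom.commutes, Module.algebraMap_end_apply, map_smul]

lemma xm_mem_intertwined (n : ℤ) : xm F n ∈ intertwined F lam := fun u => by
  rw [xm, act_ug]
  exact (fromNeg_x_mul F lam n u).symm

/-- Induction on words: the two ways of applying g agree on 1, and g moves past x⁻_n at the cost of
elements already known to be intertwined. -/
lemma mem_intertwined_of_comm {g : Uq F}
    (h1 : g • vlam F lam = fromNeg F lam (act F lam g 1))
    (hx : ∀ n, ∃ e ∈ intertwined F lam, ∃ e' ∈ intertwined F lam, g * xm F n = e * g + e') :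
    g ∈ intertwined F lam := by
  have : (Algebra.lsmul (Kq F) (Kq F) (RedVerma F lam) g) ∘ₗ fromNeg F lam =
      fromNeg F lam ∘ₗ act F lam g := by
    apply linearMap_ext
    · simpa using h1
    · intro n u hu
      simp only [LinearMap.comp_apply, Algebra.lsmul_coe] at hu ⊢
      obtain ⟨e, he, e', he', h⟩ := hx n
      have h2 : act F lam g (x _ n * u) = act F lam (g * xm F n) u := by
        rw [map_mul (act F lam), Module.End.mul_apply, xm, act_ug]; rfl
      rw [fromNeg_x_mul, ← mul_smul, h2, h, add_smul, mul_smul, hu, he, he', map_add, map_mul (act F lam),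
        LinearMap.add_apply, map_add, Module.End.mul_apply]
  exact fun u => DFunLike.congr_fun this u

lemma inv_mem_intertwined {a b : Uq F} (ha : a ∈ intertwined F lam) (hab : a * b = 1)
    (hba : b * a = 1) : b ∈ intertwined F lam := fun u => by
  have h1 : u = act F lam a (act F lam b u) := by
    rw [← Module.End.mul_apply, ← map_mul, hab, map_one, Module.End.one_apply]
  conv_lhs => rw [h1, ← ha, ← mul_smul, hba, one_smul]

lemma ug_K_mem : ug F .K ∈ intertwined F lam := by
  apply mem_intertwined_of_comm
  · rw [smul_vlam_of_sub F lam (c := qElt F ^ lam.h) (by simp [verGens]), act_ug, genOp, KOp,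
      wt_apply, map_one, map_smul, fromNeg_one, Units.val_zpow_eq_zpow_val, val_qUnit]
  · refine fun n => ⟨qElt F ^ (-2 : ℤ) • xm F n, Subalgebra.smul_mem _ (xm_mem_intertwined F lam n) _,
      0, zero_mem _, ?_⟩
    rw [add_zero]
    exact ug_mul_of_conj F (ug_inv F _ _ .Kinv_K) (.K_xm n)

lemma ug_D_mem : ug F .D ∈ intertwined F lam := by
  apply mem_intertwined_of_comm
  · rw [smul_vlam_of_sub F lam (c := qElt F ^ lam.d) (by simp [verGens]), act_ug, genOp, DOp,
      wt_apply, map_one, map_smul, fromNeg_one, Units.val_zpow_eq_zpow_val, val_qUnit]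
  · refine fun n => ⟨qElt F ^ n • xm F n, Subalgebra.smul_mem _ (xm_mem_intertwined F lam n) _,
      0, zero_mem _, ?_⟩
    rw [add_zero]
    exact ug_mul_of_conj F (ug_inv F _ _ .Dinv_D) (.D_xm n)

lemma ug_Kinv_mem : ug F .Kinv ∈ intertwined F lam :=
  inv_mem_intertwined F lam (ug_K_mem F lam) (ug_inv F _ _ .K_Kinv) (ug_inv F _ _ .Kinv_K)

lemma ug_Dinv_mem : ug F .Dinv ∈ intertwined F lam :=
  inv_mem_intertwined F lam (ug_D_mem F lam) (ug_inv F _ _ .D_Dinv) (ug_inv F _ _ .Dinv_D)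

variable (hc : lam.c = 0)
include hc

lemma ug_gam_mem : ug F .gam ∈ intertwined F lam := by
  apply mem_intertwined_of_comm
  · rw [smul_vlam_of_sub F lam (c := qHalf F ^ lam.c) (by simp [verGens]), act_ug, genOp, hc]
    simp
  · refine fun n => ⟨xm F n, xm_mem_intertwined F lam n, 0, zero_mem _, ?_⟩
    simpa [xm] using toUq_rel F (Rel.gam_central (.xm n))

lemma ug_gamInv_mem : ug F .gamInv ∈ intertwined F lam :=
  inv_mem_intertwined F lam (ug_gam_mem F lam hc) (ug_inv F _ _ .gam_gamInv)
    (ug_inv F _ _ .gamInv_gam)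

lemma gamPow_mem (n : ℤ) : toUq F (gamPow F n) ∈ intertwined F lam := by
  unfold gamPow
  split_ifs
  · rw [map_pow]; exact pow_mem (ug_gam_mem F lam hc) _
  · rw [map_pow]; exact pow_mem (ug_gamInv_mem F lam hc) _

lemma ug_h_mem (l : {l : ℤ // l ≠ 0}) : ug F (.h l) ∈ intertwined F lam := by
  apply mem_intertwined_of_comm
  · rw [smul_vlam_eq_zero F lam (Or.inr (Or.inl ⟨_, rfl⟩)), act_ug, genOp, hOp]
    simp
  · intro n
    have h := toUq_rel F (Rel.h_xm l n)
    rw [map_sub, map_mul, map_mul] at h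
    refine ⟨xm F n, xm_mem_intertwined F lam n, _, ?_, sub_eq_iff_eq_add'.1 h⟩
    rw [map_smul, map_mul]
    exact Subalgebra.smul_mem _ (mul_mem (gamPow_mem F lam hc _) (xm_mem_intertwined F lam _)) _

lemma psi_mem (n : ℤ) : toUq F (psi F n) ∈ intertwined F lam := by
  unfold psi
  split_ifs
  · rw [map_mul]
    refine mul_mem (ug_K_mem F lam) (expCoeff_mem F ((intertwined F lam).comap (toUq F)) ?_ _)
    intro i
    rw [PowerSeries.coeff_mk]
    split_ifs
    · exact Subalgebra.smul_mem ((intertwined F lam).comap (toUq F)) (ug_h_mem F lam hc _) _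
    · exact zero_mem _
  · rw [map_zero]; exact zero_mem _

lemma phi_mem (n : ℤ) : toUq F (phi F n) ∈ intertwined F lam := by
  unfold phi
  split_ifs
  · rw [map_mul]
    refine mul_mem (ug_Kinv_mem F lam) (expCoeff_mem F ((intertwined F lam).comap (toUq F)) ?_ _)
    intro i
    rw [PowerSeries.coeff_mk]
    split_ifs
    · exact Subalgebra.smul_mem ((intertwined F lam).comap (toUq F)) (ug_h_mem F lam hc _) _
    · exact zero_mem _
  · rw [map_zero]; exact zero_mem _

lemma ug_xp_mem (m : ℤ) : ug F (.xp m) ∈ intertwined F lam := by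
  apply mem_intertwined_of_comm
  · rw [smul_vlam_eq_zero F lam (Or.inl ⟨_, rfl⟩), act_ug, genOp, xpOp]
    simp
  · intro n
    have h := toUq_rel F (Rel.xp_xm m n)
    rw [map_sub, map_mul, map_mul] at h
    refine ⟨xm F n, xm_mem_intertwined F lam n, _, ?_, sub_eq_iff_eq_add'.1 h⟩
    rw [map_smul, map_sub, map_mul, map_mul]
    exact Subalgebra.smul_mem _ (sub_mem (mul_mem (gamPow_mem F lam hc _) (psi_mem F lam hc _))
      (mul_mem (gamPow_mem F lam hc _) (phi_mem F lam hc _))) _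

/-- The generators enter in the order in which their commutators with x⁻ become available: x⁻, then
K, D and γ, then h, and then x⁺, whose commutators involve ψ and φ. -/
lemma intertwined_eq_top : intertwined F lam = ⊤ := by
  have h : (intertwined F lam).comap (toUq F) = ⊤ := by
    rw [eq_top_iff, ← FreeAlgebra.adjoin_range_ι, Algebra.adjoin_le_iff]
    rintro _ ⟨g, rfl⟩
    change ug F g ∈ intertwined F lam
    cases g with
    | xp n => exact ug_xp_mem F lam hc n
    | xm n => exact xm_mem_intertwined F lam n
    | h l => exact ug_h_mem F lam hc l
    | K => exact ug_K_mem F lam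
    | Kinv => exact ug_Kinv_mem F lam
    | D => exact ug_D_mem F lam
    | Dinv => exact ug_Dinv_mem F lam
    | gam => exact ug_gam_mem F lam hc
    | gamInv => exact ug_gamInv_mem F lam hc
  rw [eq_top_iff]
  rintro a -
  obtain ⟨b, rfl⟩ := toUq_surjective F a
  have : b ∈ (intertwined F lam).comap (toUq F) := h ▸ Algebra.mem_top
  exact this

lemma smul_fromNeg (a : Uq F) (u : NegAlg F) :
    a • fromNeg F lam u = fromNeg F lam (act F lam a u) := by
  have : a ∈ intertwined F lam := intertwined_eq_top F lam hc ▸ Algebra.mem_top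
  exact this u

lemma fromNeg_surjective : Function.Surjective (fromNeg F lam) := by
  intro y
  obtain ⟨a, rfl⟩ := Submodule.Quotient.mk_surjective _ y
  refine ⟨act F lam a 1, ?_⟩
  rw [← smul_fromNeg F lam hc, fromNeg_one]
  exact (mk_eq_smul_vlam F lam a).symm

/-- Hence a ↦ (action of a on 1) descends to the module, where it inverts `fromNeg`. The condition
λ(c) = 0 matches the action of γ by 1 with its eigenvalue on v_λ. -/
lemma act_one_eq_zero {a : Uq F} (ha : a ∈ Jq F lam) : act F lam a 1 = 0 := by
  induction ha using Submodule.span_induction with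
  | mem a ha =>
    rcases ha with ⟨n, rfl⟩ | ⟨n, rfl⟩ | rfl | rfl | rfl | rfl | rfl | rfl
    · rw [act_ug, genOp, xpOp, raise_one]
    · rw [act_ug, genOp, hOp, LinearMap.smul_apply, shift_one, smul_zero]
    all_goals rw [map_sub, act_ug, AlgHom.commutes, LinearMap.sub_apply, Module.algebraMap_end_apply,
      genOp, sub_eq_zero]
    · simp [KOp]
    · simp [KinvOp]
    · simp [hc]
    · simp [hc]
    · simp [DOp]
    · simp [DinvOp]
  | zero => simp
  | add a b _ _ ha hb => rw [map_add, LinearMap.add_apply, ha, hb, add_zero]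
  | smul b a _ ha => rw [smul_eq_mul, map_mul, Module.End.mul_apply, ha, map_zero]

/-- If u v_λ = 0, then u lies in the left ideal, so its action kills 1; but u acts on 1 as u itself.
-/
lemma fromNeg_injective : Function.Injective (fromNeg F lam) := by
  rw [injective_iff_map_eq_zero]
  intro u hu
  rw [fromNeg_apply, ← mk_eq_smul_vlam] at hu
  have := act_one_eq_zero F lam hc ((Submodule.Quotient.mk_eq_zero _).1 hu)
  rwa [act_negIncl, mul_one] at this

/-- The reduced imaginary Verma module is a free module of rank one over the current algebra. -/
def negEquiv : NegAlg F ≃ₗ[Kq F] RedVerma F lam :=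
  LinearEquiv.ofBijective (fromNeg F lam) ⟨fromNeg_injective F lam hc, fromNeg_surjective F lam hc⟩

lemma negEquiv_apply (u : NegAlg F) : negEquiv F lam hc u = negIncl F u • vlam F lam := rfl

end VermaEquiv

/-! ### The operators `Ω_ψ(m)` on the current algebra -/

section Omega

open CurrentAlg HahnSeries

variable {k : Type*} [Field k] (p : k) (g : ℕ → k)

/-- The current `x` twisted by a power series. -/
def twist (n : ℤ) : PowerSeries (CurrentAlg p) := PowerSeries.mk fun r => g r • x p (n + r)

lemma coeff_twist (n : ℤ) (r : ℕ) : PowerSeries.coeff r (twist p g n) = g r • x p (n + r) :=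
  PowerSeries.coeff_mk _ _

lemma quad_twist : Quad p (twist p g) := fun a b => by
  ext n
  have e (c d : ℤ) : PowerSeries.coeff n (twist p g c * twist p g d) =
      ∑ ij ∈ Finset.HasAntidiagonal.antidiagonal n, (g ij.1 * g ij.2) • (x p (c + ij.1) * x p (d + ij.2)) := by
    rw [PowerSeries.coeff_mul]
    refine Finset.sum_congr rfl fun ij _ => ?_
    rw [coeff_twist, coeff_twist, smul_mul_smul_comm]
  -- The antidiagonal is reversed for half of the products, so that for each pair of exponents the
  -- four terms form the quadratic relation at (a + i, b + j).
  have e' (c d : ℤ) : PowerSeries.coeff n (twist p g c * twist p g d) =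
      ∑ ij ∈ Finset.HasAntidiagonal.antidiagonal n, (g ij.1 * g ij.2) • (x p (c + ij.2) * x p (d + ij.1)) := by
    rw [e, ← Finset.Nat.sum_antidiagonal_swap]
    exact Finset.sum_congr rfl fun ij _ => by rw [Prod.fst_swap, Prod.snd_swap, mul_comm]
  have hs : PowerSeries.coeff n (p • (twist p g b * twist p g (a + 1) +
      twist p g a * twist p g (b + 1))) = p • PowerSeries.coeff n (twist p g b * twist p g (a + 1) +
      twist p g a * twist p g (b + 1)) := rfl
  rw [hs, map_add, map_add, e (a + 1), e' (b + 1), e' b, e a, ← Finset.sum_add_distrib,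
    ← Finset.sum_add_distrib, Finset.smul_sum]
  refine Finset.sum_congr rfl fun ij _ => ?_
  have := quad_x p (a + ij.1) (b + ij.2)
  rw [← smul_add, ← smul_add, smul_comm p]
  congr 1
  simpa only [add_right_comm _ (1 : ℤ)] using this

/-- The defining recursion of the Taylor coefficients of `(p t - 1) / (t - p)`. -/
structure IsTaylor : Prop where
  zero : p * g 0 = 1
  succ : ∀ r, g r - p * g (r + 1) = if r = 0 then p else 0

/-- The matrices that determine `Ω_ψ`. -/
def omegaMat (n : ℤ) : Matrix (Fin 2) (Fin 2) (HahnSeries ℤ (CurrentAlg p)) :=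
  !![ofPowerSeries ℤ _ (twist p g n), single (-n) 1; 0, single 0 (x p n)]

variable {p g}

lemma coeff_ofPowerSeries_twist (n m : ℤ) : (ofPowerSeries ℤ _ (twist p g n)).coeff m =
    if m < 0 then 0 else g m.natAbs • x p (n + m) := by
  rw [PowerSeries.coeff_coe]
  split_ifs with h
  · rfl
  · rw [coeff_twist]
    congr 3
    omega

/-- The identity (t - p) g(t) = p t - 1 read off coefficientwise: combining two adjacent twisted
modes leaves only boundary terms, at m = 0 and m = -1. -/
lemma twist_exchange (hg : IsTaylor p g) (a m : ℤ) :
    (ofPowerSeries ℤ _ (twist p g (a + 1))).coeff m -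
      p • (ofPowerSeries ℤ _ (twist p g a)).coeff (m + 1) =
    p • (if m = 0 then x p (a + 1) else 0) - (if m + 1 = 0 then x p a else 0) := by
  rw [coeff_ofPowerSeries_twist, coeff_ofPowerSeries_twist]
  rcases lt_trichotomy m (-1) with h | rfl | h
  · simp [show m < 0 by omega, show m + 1 < 0 by omega, show m ≠ 0 by omega,
      show m + 1 ≠ 0 by omega]
  · simp [smul_smul, hg.zero]
  · obtain ⟨r, rfl⟩ := Int.eq_ofNat_of_zero_le (show 0 ≤ m by omega)
    have h1 := hg.succ r
    have e : ((r : ℤ) + 1).natAbs = r + 1 := by omega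
    rw [if_neg (by omega), if_neg (by omega), if_neg (by omega : ¬ ((r : ℤ) + 1 = 0)), e,
      Int.natAbs_natCast, sub_zero, smul_smul, show a + 1 + (r : ℤ) = a + (r + 1) by ring,
      ← sub_smul, h1]
    rcases Nat.eq_zero_or_pos r with rfl | hr
    · simp
    · simp [hr.ne']

lemma coeff_smul_hahn {A : Type*} [Ring A] [Algebra k A] (c : k) (f : HahnSeries ℤ A) (m : ℤ) :
    (c • f).coeff m = c • f.coeff m := rfl

lemma ofPowerSeries_smul {A : Type*} [Ring A] [Algebra k A] (c : k) (f : PowerSeries A) :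
    ofPowerSeries ℤ A (c • f) = c • ofPowerSeries ℤ A f := by
  ext m
  rw [coeff_smul_hahn, PowerSeries.coeff_coe, PowerSeries.coeff_coe]
  split_ifs
  · rw [smul_zero]
  · rfl

lemma single_smul' {A : Type*} [Ring A] [Algebra k A] (c : k) (n : ℤ) (a : A) :
    single n (c • a) = c • single n a := by
  ext m
  rw [coeff_smul_hahn, coeff_single, coeff_single]
  split_ifs <;> simp

/-- The diagonal entries satisfy the quadratic relations of the twisted and the untwisted current.
In the corner, the powers of the variable turn the relation into two instances of `twist_exchange`.
This is why Ω_ψ is well defined for precisely this g. -/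
lemma quad_omegaMat (hg : IsTaylor p g) : Quad p (omegaMat p g) := fun a b => by
  refine Matrix.ext fun i j => ?_
  fin_cases i <;> fin_cases j
  · have h := congrArg (ofPowerSeries ℤ _) (quad_twist p g a b)
    simp only [map_add, map_mul, ofPowerSeries_smul] at h
    simpa [omegaMat, Matrix.mul_apply] using h
  · ext m
    have h1 := twist_exchange hg a (m + b)
    have h2 := twist_exchange hg b (m + a)
    simp only [omegaMat, Matrix.add_apply, Matrix.smul_apply, Matrix.mul_apply, Fin.sum_univ_two,
      Fin.zero_eta, Fin.mk_one, Matrix.of_apply, Matrix.cons_val_zero, Matrix.cons_val_one,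
      Matrix.cons_val', Matrix.cons_val_fin_one, coeff_add, coeff_smul_hahn, coeff_mul_single,
      mul_one, single_mul_single, one_mul, coeff_single, sub_neg_eq_add, add_zero]
    simp only [show m + b + 1 = m + (b + 1) by ring, show m + (b + 1) = 0 ↔ m = -(b + 1) by omega,
      show m + b = 0 ↔ m = -b by omega] at h1
    simp only [show m + a + 1 = m + (a + 1) by ring, show m + (a + 1) = 0 ↔ m = -(a + 1) by omega,
      show m + a = 0 ↔ m = -a by omega] at h2
    rw [sub_eq_iff_eq_add] at h1 h2
    rw [h1, h2]
    simp only [smul_add]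
    split_ifs <;> (try simp only [smul_zero]) <;> abel
  · simp [omegaMat]
  · have h := quad_x p a b
    ext m
    simp only [omegaMat, Matrix.add_apply, Matrix.smul_apply, Matrix.mul_apply, Fin.sum_univ_two,
      Fin.mk_one, Matrix.of_apply, Matrix.cons_val_zero, Matrix.cons_val_one, Matrix.cons_val',
      Matrix.cons_val_fin_one, zero_mul, zero_add, coeff_add, coeff_smul_hahn,
      single_mul_single, coeff_single]
    split_ifs
    · exact h
    · simp

section Operator

variable (hg : IsTaylor p g)

/-- The generating series of the values of the operators `Ω_ψ(m)`. -/
def omegaSeries : CurrentAlg p →ₗ[k] HahnSeries ℤ (CurrentAlg p) :=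
  (LinearMap.proj 1 ∘ₗ LinearMap.proj 0 :
    Matrix (Fin 2) (Fin 2) (HahnSeries ℤ (CurrentAlg p)) →ₗ[k] _) ∘ₗ
      (lift _ (quad_omegaMat hg)).toLinearMap

lemma omegaSeries_apply (u : CurrentAlg p) :
    omegaSeries hg u = lift _ (quad_omegaMat hg) u 0 1 := rfl

@[simp] lemma omegaSeries_one : omegaSeries hg 1 = 0 := by
  rw [omegaSeries_apply, map_one (lift _ (quad_omegaMat hg))]; simp

lemma lift_omegaMat_lower (u : CurrentAlg p) : lift _ (quad_omegaMat hg) u 1 0 = 0 ∧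
    lift _ (quad_omegaMat hg) u 1 1 = single 0 u := by
  let S : Submodule k (CurrentAlg p) :=
    { carrier := {u | lift _ (quad_omegaMat hg) u 1 0 = 0 ∧
        lift _ (quad_omegaMat hg) u 1 1 = single 0 u}
      zero_mem' := by simp
      add_mem' := by
        rintro u w ⟨h1, h2⟩ ⟨h3, h4⟩
        simp [h1, h2, h3, h4]
      smul_mem' := by
        rintro c u ⟨h1, h2⟩
        simp [h1, h2, single_smul'] }
  have : S = ⊤ := by
    apply submodule_eq_top
    · simp [S]
    · rintro n u ⟨h1, h2⟩
      constructor
      · simp [omegaMat, Matrix.mul_apply, h1]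
      · simp [omegaMat, Matrix.mul_apply, h2]
  have hu : u ∈ S := this ▸ Submodule.mem_top
  exact hu

lemma omegaSeries_x_mul (n : ℤ) (u : CurrentAlg p) : omegaSeries hg (x p n * u) =
    ofPowerSeries ℤ _ (twist p g n) * omegaSeries hg u + single (-n) u := by
  simp [omegaSeries_apply, Matrix.mul_apply, omegaMat, (lift_omegaMat_lower hg u).2]

/-- The operator `Ω_ψ(m)` on the current algebra. -/
def omegaOp (m : ℤ) : Module.End k (CurrentAlg p) where
  toFun u := (omegaSeries hg u).coeff m
  map_add' u w := by rw [map_add, coeff_add]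
  map_smul' c u := by rw [map_smul]; rfl

lemma omegaOp_apply (m : ℤ) (u : CurrentAlg p) : omegaOp hg m u = (omegaSeries hg u).coeff m := rfl

@[simp] lemma omegaOp_one (m : ℤ) : omegaOp hg m 1 = 0 := by simp [omegaOp_apply]

lemma single_one_mul_comm (n : ℤ) (f : HahnSeries ℤ (CurrentAlg p)) :
    single n 1 * f = f * single n 1 := by
  ext m
  rw [coeff_single_mul, coeff_mul_single, one_mul, mul_one]

/-- `twist_exchange` multiplied by the generating series for u; the inhomogeneous terms z^{-n} of
the two products combine into (1 - p) u when m + n = 0. -/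
lemma omegaOp_exchange (m n : ℤ) (u : CurrentAlg p) :
    omegaOp hg (m - 1) (x p (n + 1) * u) - p • omegaOp hg m (x p n * u) =
      (if m + n = 0 then (1 - p) • u else 0) + p • (x p (n + 1) * omegaOp hg (m - 1) u) -
        x p n * omegaOp hg m u := by
  have key : ofPowerSeries ℤ _ (twist p g (n + 1)) * single 1 1 -
      p • ofPowerSeries ℤ _ (twist p g n) = p • single 1 (x p (n + 1)) - single 0 (x p n) := by
    ext j
    have := twist_exchange hg n (j - 1)
    rw [sub_add_cancel] at this
    simp only [coeff_sub, coeff_smul_hahn, coeff_mul_single, mul_one, coeff_single, this,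
      sub_eq_zero]
    split_ifs <;> rfl
  have h := congrArg (fun f => (f * omegaSeries hg u).coeff m) key
  simp only [sub_mul, mul_assoc, single_one_mul_comm, smul_mul_assoc] at h
  rw [← mul_assoc] at h
  simp only [coeff_sub, coeff_smul_hahn, coeff_mul_single, coeff_single_mul, mul_one,
    sub_zero] at h
  simp only [omegaOp_apply, omegaSeries_x_mul, coeff_add, coeff_single]
  rw [sub_eq_iff_eq_add] at h
  rw [h]
  simp only [show m - 1 = -(n + 1) ↔ m + n = 0 by omega, show m = -n ↔ m + n = 0 by omega, smul_add,
    sub_smul, one_smul]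
  split_ifs
  · abel
  · simp only [smul_zero, add_zero, zero_add]; abel

/-- The exchange relation is no recursion, because another value of Ω on a product remains in it.
Membership is instead read off the product of series, each coefficient of which is a finite sum. -/
lemma omegaOp_x_mul_mem (S : AddSubgroup (CurrentAlg p)) {n : ℤ} {u : CurrentAlg p} (hu : u ∈ S)
    (h : ∀ (r : ℕ) (j : ℤ), g r • (x p (n + r) * omegaOp hg j u) ∈ S) (m : ℤ) :
    omegaOp hg m (x p n * u) ∈ S := by
  rw [omegaOp_apply, omegaSeries_x_mul, coeff_add, coeff_mul]
  refine S.add_mem (S.sum_mem fun ij _ => ?_) ?_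
  · rw [coeff_ofPowerSeries_twist]
    split_ifs with h0
    · rw [zero_mul]; exact S.zero_mem
    · obtain ⟨r, hr⟩ := Int.eq_ofNat_of_zero_le (not_lt.1 h0)
      rw [hr, Int.natAbs_natCast, smul_mul_assoc]
      exact h r ij.2
  · rw [coeff_single]
    split_ifs
    exacts [hu, S.zero_mem]

/-- In a product of upper triangular matrices, a path from the first row to the second column takes
the off-diagonal entry exactly once, at position l: twisted modes stand before it and plain ones
after it. -/
lemma omegaSeries_prod (w : List ℤ) : omegaSeries hg (w.map (x p)).prod =
    ∑ l : Fin w.length, ofPowerSeries ℤ _ ((w.take l).map (twist p g)).prod *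
      single (-w.get l) ((w.drop (l + 1)).map (x p)).prod := by
  induction w with
  | nil => simp
  | cons n w ih =>
    rw [List.map_cons, List.prod_cons, omegaSeries_x_mul, ih, Finset.mul_sum, add_comm]
    refine Eq.trans ?_ (Fin.sum_univ_succ (n := w.length) _).symm
    simp [mul_assoc]

lemma omegaOp_prod (m : ℤ) (w : List ℤ) : omegaOp hg m (w.map (x p)).prod =
    ∑ l : Fin w.length, if 0 ≤ m + w.get l then
      PowerSeries.coeff (m + w.get l).toNat ((w.take l).map (twist p g)).prod *
        ((w.drop (l + 1)).map (x p)).prod else 0 := by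
  rw [omegaOp_apply, omegaSeries_prod, coeff_sum]
  refine Finset.sum_congr rfl fun l _ => ?_
  rw [coeff_mul_single, sub_neg_eq_add, PowerSeries.coeff_coe]
  split_ifs with h1 h2 h2
  · omega
  · rw [zero_mul]
  · congr 3; omega
  · omega

end Operator

end Omega

/-! ### Transport of the operators to the Verma module -/

section OmegaTilde

open CurrentAlg

universe u

variable (F : Type u) [Field F]

lemma qParam_mul : qElt F ^ 2 * qParam F = 1 := by
  rw [qParam, ← zpow_natCast, ← zpow_add₀ (qElt_ne_zero F)]; simp

lemma isTaylor_gCoeff : IsTaylor (qParam F) (gCoeff F) := by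
  set f : PowerSeries (Kq F) := (PowerSeries.C (qElt F ^ (-2 : ℤ)) * PowerSeries.X - 1) *
      (PowerSeries.X - PowerSeries.C (qElt F ^ (-2 : ℤ)))⁻¹ with hf
  have hc : PowerSeries.constantCoeff (R := Kq F)
      (PowerSeries.X - PowerSeries.C (qElt F ^ (-2 : ℤ))) ≠ 0 := by
    simpa using qElt_ne_zero F
  have h : (PowerSeries.X - PowerSeries.C (qElt F ^ (-2 : ℤ))) * f =
      PowerSeries.C (qElt F ^ (-2 : ℤ)) * PowerSeries.X - 1 := by
    rw [hf, mul_left_comm, PowerSeries.mul_inv_cancel _ hc, mul_one]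
  have hg (r : ℕ) : gCoeff F r = PowerSeries.coeff r f := rfl
  constructor
  · have h0 := congrArg (PowerSeries.coeff 0) h
    simp only [sub_mul, map_sub, PowerSeries.coeff_zero_X_mul, PowerSeries.coeff_C_mul,
      PowerSeries.coeff_zero_X, mul_zero, PowerSeries.coeff_zero_one, zero_sub, neg_inj] at h0
    rw [hg, qParam, h0]
  · intro r
    have h0 := congrArg (PowerSeries.coeff (r + 1)) h
    simp only [sub_mul, map_sub, PowerSeries.coeff_succ_X_mul, PowerSeries.coeff_C_mul,
      PowerSeries.coeff_X, PowerSeries.coeff_one] at h0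
    rw [hg, hg, qParam, h0]
    simp

lemma negIncl_prod (w : List ℤ) : negIncl F (w.map (x _)).prod = mon F w := by
  rw [map_list_prod, List.map_map, mon]
  congr 2
  funext n
  exact negIncl_x F n

lemma negIncl_coeff_twist_prod (t : ℕ) (w : List ℤ) : negIncl F (PowerSeries.coeff t
    (w.map (twist (qParam F) (gCoeff F))).prod) = shiftSum F t w := by
  induction w generalizing t with
  | nil =>
    simp only [List.map_nil, List.prod_nil, PowerSeries.coeff_one, shiftSum]
    split_ifs <;> simp
  | cons n w ih =>
    rw [List.map_cons, List.prod_cons, PowerSeries.coeff_mul, map_sum, shiftSum]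
    refine Finset.sum_congr rfl fun a _ => ?_
    rw [map_mul, ih, coeff_twist, map_smul, negIncl_x, smul_mul_assoc]

lemma negIncl_omegaOp (m : ℤ) (w : List ℤ) :
    negIncl F (omegaOp (isTaylor_gCoeff F) m (w.map (x _)).prod) = omegaMon F m w := by
  rw [omegaOp_prod, map_sum, omegaMon]
  refine Finset.sum_congr rfl fun l _ => ?_
  split_ifs
  · rw [map_mul, negIncl_coeff_twist_prod, negIncl_prod]
  · exact map_zero _

lemma span_prod {k : Type*} [Field k] (p : k) :
    Submodule.span k (Set.range fun w : List ℤ => (w.map (x p)).prod) = ⊤ := by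
  apply submodule_eq_top
  · exact Submodule.subset_span ⟨[], rfl⟩
  · intro n u hu
    induction hu using Submodule.span_induction with
    | mem u hu =>
      obtain ⟨w, rfl⟩ := hu
      exact Submodule.subset_span ⟨n :: w, by simp⟩
    | zero => rw [mul_zero]; exact zero_mem _
    | add a b _ _ ha hb => rw [mul_add]; exact add_mem ha hb
    | smul c a _ ha => rw [mul_smul_comm]; exact Submodule.smul_mem _ _ ha

variable {lam : Weight}

lemma xTilde_mon (n : ℤ) (w : List ℤ) : xTilde F (RedVerma F lam) n (mon F w • vlam F lam) =
    mon F (n :: w) • vlam F lam := by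
  rw [mon, mon, List.map_cons, List.prod_cons, mul_smul]; rfl

lemma mon_mem_weightSpace (w : List ℤ) : mon F w • vlam F lam ∈
    weightSpace (F := F) (RedVerma F lam) (lam + rootShift w.length w.sum) := by
  induction w with
  | nil =>
    rw [mon, List.map_nil, List.prod_nil, one_smul]
    constructor
    · rw [smul_vlam_of_sub F lam (c := qElt F ^ lam.h) (by simp [verGens])]
      congr 2
      change lam.h = lam.h + -(2 * 0)
      simp
    · rw [smul_vlam_of_sub F lam (c := qElt F ^ lam.d) (by simp [verGens])]
      congr 2
      change lam.d = lam.d + 0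
      simp
  | cons n w ih =>
    have h1 := ug_mul_of_conj F (ug_inv F _ _ .Kinv_K) (.K_xm n)
    have h2 := ug_mul_of_conj F (ug_inv F _ _ .Dinv_D) (.D_xm n)
    rw [mon, List.map_cons, List.prod_cons, mul_smul]
    constructor
    · rw [← mul_smul, xm, h1, mul_smul, ← mon, ih.1, smul_assoc, smul_comm (ug F _), smul_smul,
        ← zpow_add₀ (qElt_ne_zero F)]
      congr 2
      change -2 + (lam.h + -(2 * (w.length : ℤ))) = lam.h + -(2 * ((n :: w).length : ℤ))
      rw [List.length_cons]; push_cast; ring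
    · rw [← mul_smul, xm, h2, mul_smul, ← mon, ih.2, smul_assoc, smul_comm (ug F _), smul_smul,
        ← zpow_add₀ (qElt_ne_zero F)]
      congr 2
      change n + (lam.d + w.sum) = lam.d + (n :: w).sum
      rw [List.sum_cons]; ring

variable [CharZero F] (hc : lam.c = 0)
include hc

lemma negEquiv_prod (w : List ℤ) :
    negEquiv F lam hc (w.map (x _)).prod = mon F w • vlam F lam := by
  rw [negEquiv_apply, negIncl_prod]

lemma span_mon : Submodule.span (Kq F) (Set.range fun w : List ℤ => mon F w • vlam F lam) = ⊤ := by
  have h := congrArg (Submodule.map (negEquiv F lam hc).toLinearMap) (span_prod (qParam F))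
  rw [Submodule.map_span, Submodule.map_top, LinearEquiv.range, ← Set.range_comp] at h
  rw [← h]
  congr 2
  funext w
  exact (negEquiv_prod F hc w).symm

lemma xTilde_negEquiv (n : ℤ) (u : NegAlg F) :
    xTilde F (RedVerma F lam) n (negEquiv F lam hc u) = negEquiv F lam hc (x _ n * u) :=
  (fromNeg_x_mul F lam n u).symm

lemma omegaTilde_exists (m : ℤ) : ∃ T : Module.End (Kq F) (RedVerma F lam),
    ∀ w : List ℤ, T (mon F w • vlam F lam) = omegaMon F m w • vlam F lam := by
  refine ⟨(negEquiv F lam hc).toLinearMap ∘ₗ omegaOp (isTaylor_gCoeff F) m ∘ₗ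
    (negEquiv F lam hc).symm.toLinearMap, fun w => ?_⟩
  rw [← negEquiv_prod F hc, LinearMap.comp_apply, LinearMap.comp_apply, LinearEquiv.coe_coe,
    LinearEquiv.coe_coe, LinearEquiv.symm_apply_apply, negEquiv_apply, negIncl_omegaOp]

lemma omegaTilde_mon (m : ℤ) (w : List ℤ) :
    omegaTilde F lam m (mon F w • vlam F lam) = omegaMon F m w • vlam F lam := by
  unfold omegaTilde
  rw [dif_pos (omegaTilde_exists F hc m)]
  exact (omegaTilde_exists F hc m).choose_spec w

lemma omegaTilde_negEquiv (m : ℤ) (u : NegAlg F) : omegaTilde F lam m (negEquiv F lam hc u) =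
    negEquiv F lam hc (omegaOp (isTaylor_gCoeff F) m u) := by
  have : omegaTilde F lam m ∘ₗ (negEquiv F lam hc).toLinearMap =
      (negEquiv F lam hc).toLinearMap ∘ₗ omegaOp (isTaylor_gCoeff F) m := by
    refine LinearMap.ext_on_range (span_prod (qParam F)) fun w => ?_
    rw [LinearMap.comp_apply, LinearMap.comp_apply, LinearEquiv.coe_coe, negEquiv_prod,
      omegaTilde_mon F hc, negEquiv_apply, negIncl_omegaOp]
  exact DFunLike.congr_fun this u

lemma omegaTilde_vlam (m : ℤ) : omegaTilde F lam m (vlam F lam) = 0 := by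
  rw [← fromNeg_one]
  exact (omegaTilde_negEquiv F hc m 1).trans (by rw [omegaOp_one, map_zero])

/-- The relation is divided by p = q⁻², so that all coefficients are regular at 0 and everything
beyond the first two terms carries q². -/
lemma omegaTilde_xTilde (m n : ℤ) (y : RedVerma F lam) :
    omegaTilde F lam m (xTilde F _ n y) =
      (if m + n = 0 then y else 0) - xTilde F _ (n + 1) (omegaTilde F lam (m - 1) y) +
      qElt F ^ 2 • (omegaTilde F lam (m - 1) (xTilde F _ (n + 1) y) -
        (if m + n = 0 then y else 0) + xTilde F _ n (omegaTilde F lam m y)) := by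
  obtain ⟨u, rfl⟩ := (negEquiv F lam hc).surjective y
  simp only [xTilde_negEquiv, omegaTilde_negEquiv]
  have h := congrArg (qElt F ^ 2 • negEquiv F lam hc ·)
    (omegaOp_exchange (isTaylor_gCoeff F) m n u)
  simp only [map_sub, map_smul, map_add, smul_sub, smul_add, smul_smul, qParam_mul, one_smul] at h
  rw [smul_add, smul_sub]
  split_ifs at h ⊢
  · simp only [sub_smul, one_smul, map_sub, map_smul, smul_sub, smul_smul, qParam_mul] at h
    linear_combination (norm := abel) -h
  · simp only [map_zero, smul_zero] at h ⊢
    linear_combination (norm := abel) -h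

lemma omegaTilde_xTilde_mem (S : AddSubgroup (RedVerma F lam)) {n : ℤ} {y : RedVerma F lam}
    (hy : y ∈ S)
    (h : ∀ (r : ℕ) (j : ℤ), gCoeff F r • xTilde F _ (n + r) (omegaTilde F lam j y) ∈ S) (m : ℤ) :
    omegaTilde F lam m (xTilde F _ n y) ∈ S := by
  obtain ⟨u, rfl⟩ := (negEquiv F lam hc).surjective y
  simp only [xTilde_negEquiv, omegaTilde_negEquiv] at h ⊢
  refine omegaOp_x_mul_mem (isTaylor_gCoeff F) (S.comap (negEquiv F lam hc).toLinearMap.toAddMonoidHom)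
    hy (fun r j => ?_) m
  have := h r j
  rwa [← map_smul] at this

lemma xTilde_exchange (a b : ℤ) (y : RedVerma F lam) :
    xTilde F _ a (xTilde F _ b y) = - xTilde F _ (b - 1) (xTilde F _ (a + 1) y) +
      qElt F ^ 2 • (xTilde F _ b (xTilde F _ a y) +
        xTilde F _ (a + 1) (xTilde F _ (b - 1) y)) := by
  obtain ⟨u, rfl⟩ := (negEquiv F lam hc).surjective y
  simp only [xTilde_negEquiv]
  have h0 := congrArg (· * u) (quad_x (qParam F) (b - 1) a)
  simp only [sub_add_cancel, add_mul, smul_mul_assoc, mul_assoc] at h0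
  have h := congrArg (qElt F ^ 2 • negEquiv F lam hc ·) h0
  simp only [map_smul, map_add, smul_add, smul_smul, qParam_mul, one_smul] at h ⊢
  linear_combination (norm := abel) -h

/-- The coefficient of `v_λ`. -/
def vacuum : RedVerma F lam →ₗ[Kq F] Kq F :=
  (lift (A := Kq F) (p := qParam F) (fun _ => 0) fun _ _ => by simp).toLinearMap ∘ₗ
    (negEquiv F lam hc).symm.toLinearMap

lemma vacuum_vlam : vacuum F hc (vlam F lam) = 1 := by
  have : (negEquiv F lam hc).symm (vlam F lam) = 1 := by
    rw [LinearEquiv.symm_apply_eq]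
    exact (fromNeg_one F lam).symm
  simp [vacuum, this]

lemma vacuum_xTilde (n : ℤ) (y : RedVerma F lam) : vacuum F hc (xTilde F _ n y) = 0 := by
  obtain ⟨u, rfl⟩ := (negEquiv F lam hc).surjective y
  simp only [xTilde_negEquiv, vacuum, LinearMap.comp_apply, LinearEquiv.coe_coe,
    LinearEquiv.symm_apply_apply, AlgHom.toLinearMap_apply, map_mul]
  exact (congrArg (· * _) (lift_x _ _ n)).trans (zero_mul _)

end OmegaTilde

/-! ### Words in families of operators -/

section Words

variable {R E : Type*} [CommRing R] [AddCommGroup E] [Module R E]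

/-- The vector `X_{n_1} ⋯ X_{n_s} v`. -/
def word (X : ℤ → Module.End R E) (v : E) (w : List ℤ) : E := w.foldr (fun n e => X n e) v

@[simp] lemma word_nil (X : ℤ → Module.End R E) (v : E) : word X v [] = v := rfl

@[simp] lemma word_cons (X : ℤ → Module.End R E) (v : E) (n : ℤ) (w : List ℤ) :
    word X v (n :: w) = X n (word X v w) := rfl

/-- The weakly decreasing words with letters at most `M`. -/
def IsDecr (M : ℤ) (w : List ℤ) : Prop := w.Pairwise (· ≥ ·) ∧ ∀ a ∈ w, a ≤ M

lemma isDecr_nil (M : ℤ) : IsDecr M [] := ⟨List.Pairwise.nil, by simp⟩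

lemma isDecr_cons {M n : ℤ} {w : List ℤ} : IsDecr M (n :: w) ↔ n ≤ M ∧ IsDecr n w := by
  simp only [IsDecr, List.pairwise_cons, List.mem_cons, forall_eq_or_imp]
  constructor
  · rintro ⟨⟨h1, h2⟩, h3, h4⟩
    exact ⟨h3, h2, h1⟩
  · rintro ⟨h1, h2, h3⟩
    exact ⟨⟨h3, h2⟩, h1, fun a ha => (h3 a ha).trans h1⟩

lemma IsDecr.mono {M N : ℤ} {w : List ℤ} (h : IsDecr M w) (hMN : M ≤ N) : IsDecr N w :=
  ⟨h.1, fun a ha => (h.2 a ha).trans hMN⟩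

lemma exists_isDecr {w : List ℤ} (h : w.Pairwise (· ≥ ·)) : ∃ M, IsDecr M w := by
  cases w with
  | nil => exact ⟨0, isDecr_nil 0⟩
  | cons n w => exact ⟨n, h, by
      have := (List.pairwise_cons.1 h).1
      simpa using this⟩

section Straightening

/-- The span of the weakly decreasing words of length `s` with letters at most `M`. -/
def decrSpan (X : ℤ → Module.End R E) (v : E) (s : ℕ) (M : ℤ) : Submodule R E :=
  Submodule.span R {e | ∃ w : List ℤ, IsDecr M w ∧ w.length = s ∧ e = word X v w}

lemma decrSpan_mono {X : ℤ → Module.End R E} {v : E} {s : ℕ} {M N : ℤ} (h : M ≤ N) :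
    decrSpan X v s M ≤ decrSpan X v s N :=
  Submodule.span_mono fun _ ⟨w, hw, hs, he⟩ => ⟨w, hw.mono h, hs, he⟩

lemma map_mem_decrSpan {X : ℤ → Module.End R E} {v : E} {s s' : ℕ} {M M' : ℤ}
    {T : Module.End R E}
    (hT : ∀ w : List ℤ, IsDecr M w → w.length = s → T (word X v w) ∈ decrSpan X v s' M')
    {e : E} (he : e ∈ decrSpan X v s M) : T e ∈ decrSpan X v s' M' := by
  have : decrSpan X v s M ≤ (decrSpan X v s' M').comap T :=
    Submodule.span_le.2 fun e ⟨w, hw, hs, he⟩ => by rw [he]; exact hT w hw hs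
  exact this he

/-- Induction on the length of the word and, within it, on the gap d = M - m. After an exchange the
inner letter acts on a shorter word, and the outer letter is strictly larger than m and at most n ≤
M, so its gap is smaller. -/
lemma X_word_mem_decrSpan {X : ℤ → Module.End R E} {c : R}
    (hX : ∀ a b e, X a (X b e) = -X (b - 1) (X (a + 1) e) +
      c • (X b (X a e) + X (a + 1) (X (b - 1) e)))
    (hX1 : ∀ a e, X a (X (a + 1) e) = c • X (a + 1) (X a e)) (v : E) (s d : ℕ) :
    ∀ (m M : ℤ) (w : List ℤ), M = m + d → IsDecr M w → w.length = s →
      X m (word X v w) ∈ decrSpan X v (s + 1) M := by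
  induction s generalizing d with
  | zero =>
    intro m M w hM hw hs
    rw [List.length_eq_zero_iff] at hs
    subst hs
    exact Submodule.subset_span ⟨[m], isDecr_cons.2 ⟨by omega, isDecr_nil m⟩, rfl, rfl⟩
  | succ s ihs =>
    induction d using Nat.strong_induction_on with
    | _ d ihd =>
    intro m M w hM hw hs
    obtain ⟨n, w, rfl⟩ := List.exists_cons_of_length_eq_add_one hs
    obtain ⟨hn, hw⟩ := isDecr_cons.1 hw
    have hs : w.length = s := by simpa using hs
    rcases le_or_gt n m with hnm | hnm
    · exact Submodule.subset_span ⟨m :: n :: w, isDecr_cons.2 ⟨by omega, isDecr_cons.2 ⟨hnm, hw⟩⟩,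
        by simp [hs], rfl⟩
    refine decrSpan_mono hn ?_
    have first (j : ℤ) (hj : j ≤ n) : X j (word X v w) ∈ decrSpan X v (s + 1) n :=
      ihs (n - j).toNat j n w (by omega) hw hs
    have top {e : E} (he : e ∈ decrSpan X v (s + 1) n) : X n e ∈ decrSpan X v (s + 2) n :=
      map_mem_decrSpan (fun w' hw' hs' => Submodule.subset_span
        ⟨n :: w', isDecr_cons.2 ⟨le_rfl, hw'⟩, by simp [hs'], rfl⟩) he
    have second (j : ℤ) (hj : m < j) (hjn : j ≤ n) {e : E} (he : e ∈ decrSpan X v (s + 1) n) :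
        X j e ∈ decrSpan X v (s + 2) n :=
      map_mem_decrSpan (fun w' hw' hs' =>
        ihd (n - j).toNat (by omega) j n w' (by omega) hw' hs') he
    rw [word_cons]
    -- For n = m + 1 the exchange reproduces the product on the left, so the separate relation `hX1`
    -- is needed.
    rcases eq_or_ne n (m + 1) with rfl | hne
    · rw [hX1]
      exact Submodule.smul_mem _ _ (top (first m (by omega)))
    · rw [hX]
      exact add_mem (neg_mem (second _ (by omega) (by omega) (first _ (by omega))))
        (Submodule.smul_mem _ _ (add_mem (top (first _ (by omega)))
          (second _ (by omega) (by omega) (first _ (by omega)))))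

end Straightening

/-! ### Signed permutation behaviour at `q = 0` -/

section Specialized

/-- The relations between creation and annihilation operators at `q = 0`. -/
structure IsSpecialized (X O : ℤ → Module.End R E) (v : E) : Prop where
  swap : ∀ a b e, X a (X b e) = -X (b - 1) (X (a + 1) e)
  vanish : ∀ a e, X a (X (a + 1) e) = 0
  exchange : ∀ m n e, O m (X n e) = (if m + n = 0 then e else 0) - X (n + 1) (O (m - 1) e)
  vac : ∀ m, O m v = 0

/-- The vectors that are zero or, up to sign, weakly decreasing words with letters at most `M`. -/
def IsSigned (X : ℤ → Module.End R E) (v : E) (M : ℤ) (e : E) : Prop :=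
  e = 0 ∨ ∃ w, IsDecr M w ∧ (e = word X v w ∨ e = -word X v w)

variable {X O : ℤ → Module.End R E} {v : E}

lemma IsSigned.neg {M : ℤ} {e : E} (h : IsSigned X v M e) : IsSigned X v M (-e) := by
  rcases h with rfl | ⟨w, hw, rfl | rfl⟩
  · exact Or.inl neg_zero
  · exact Or.inr ⟨w, hw, Or.inr rfl⟩
  · exact Or.inr ⟨w, hw, Or.inl (neg_neg _)⟩

lemma IsSigned.mono {M N : ℤ} {e : E} (h : IsSigned X v M e) (hMN : M ≤ N) :
    IsSigned X v N e := by
  rcases h with rfl | ⟨w, hw, h⟩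
  · exact Or.inl rfl
  · exact Or.inr ⟨w, hw.mono hMN, h⟩

lemma IsSigned.apply {M : ℤ} {e : E} (h : IsSigned X v M e) : IsSigned X v M (X M e) := by
  rcases h with rfl | ⟨w, hw, rfl | rfl⟩
  · exact Or.inl (map_zero _)
  · exact Or.inr ⟨M :: w, isDecr_cons.2 ⟨le_rfl, hw⟩, Or.inl rfl⟩
  · exact Or.inr ⟨M :: w, isDecr_cons.2 ⟨le_rfl, hw⟩, Or.inr (map_neg _ _)⟩

/-- The iterated pairing with a sequence of annihilation operators. -/
def pairing {E' : Type*} [AddCommGroup E'] [Module R E'] (O : ℤ → Module.End R E)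
    (ε : E →ₗ[R] E') (js : List ℤ) : E →ₗ[R] E' :=
  js.foldr (fun j f => f ∘ₗ O (-j)) ε

variable (h : IsSpecialized X O v)
include h

/-- The word may contain letters up to M + 1 although the result is bounded by M: an exchange turns
the leading letter n into n - 1, and a leading letter m + 1 gives zero. This slack of one is what
closes the induction. -/
lemma IsSpecialized.X_word {w : List ℤ} : ∀ {m M : ℤ}, m ≤ M → IsDecr (M + 1) w →
    IsSigned X v M (X m (word X v w)) := by
  induction w with
  | nil => exact fun {m M} hm _ => Or.inr ⟨[m], isDecr_cons.2 ⟨hm, isDecr_nil m⟩, Or.inl rfl⟩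
  | cons n w ih =>
    intro m M hm hw
    obtain ⟨hn, hw⟩ := isDecr_cons.1 hw
    rcases le_or_gt n m with hnm | hnm
    · exact Or.inr ⟨m :: n :: w, isDecr_cons.2 ⟨hm, isDecr_cons.2 ⟨hnm, hw⟩⟩, Or.inl rfl⟩
    · rw [word_cons]
      rcases eq_or_ne n (m + 1) with rfl | hne
      · exact Or.inl (h.vanish _ _)
      · rw [h.swap]
        have := (ih (m := m + 1) (M := n - 1) (by omega) (by rwa [sub_add_cancel])).apply.neg
        exact this.mono (by omega)

/-- No delta term can occur, and each letter passed replaces j by j + 1, so j stays above all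
letters until the vacuum is reached. -/
lemma IsSpecialized.O_word_eq_zero {w : List ℤ} : ∀ {j M : ℤ}, M < j → IsDecr M w →
    O (-j) (word X v w) = 0 := by
  induction w with
  | nil => exact fun {j M} _ _ => h.vac _
  | cons n w ih =>
    intro j M hj hw
    obtain ⟨hn, hw⟩ := isDecr_cons.1 hw
    rw [word_cons, h.exchange, if_neg (by omega), show -j - 1 = -(j + 1) by ring,
      ih (j := j + 1) (by omega) hw, map_zero, sub_zero]

lemma IsSpecialized.O_X_word {n : ℤ} {w : List ℤ} (hw : IsDecr n w) (j : ℤ) :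
    O (-j) (X n (word X v w)) =
      if j = n then word X v w else -X (n + 1) (O (-(j + 1)) (word X v w)) := by
  rw [h.exchange, show -j - 1 = -(j + 1) by ring]
  split_ifs with h1 h2 h2
  -- When the delta term is present, the other term contains O (-(n + 1)) on a word with letters at
  -- most n, hence vanishes.
  · rw [h.O_word_eq_zero (M := n) (by omega) hw, map_zero, sub_zero]
  · omega
  · omega
  · rw [zero_sub]

/-- Annihilation deletes one letter and raises the letters it has passed by one, whence the bound M
+ 1. -/
lemma IsSpecialized.O_word {w : List ℤ} : ∀ {j M : ℤ}, IsDecr M w →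
    IsSigned X v (M + 1) (O (-j) (word X v w)) := by
  induction w with
  | nil => exact fun {j M} _ => Or.inl (h.vac _)
  | cons n w ih =>
    intro j M hw
    obtain ⟨hn, hw⟩ := isDecr_cons.1 hw
    rw [word_cons, h.O_X_word hw]
    split_ifs
    · exact Or.inr ⟨w, hw.mono (by omega), Or.inl rfl⟩
    · exact ((ih (j := j + 1) hw).apply.neg).mono (by omega)

/-- If annihilation passes the leading letter n, it leaves -X (n + 1); the exchange of X m with X (n
+ 1) restores X n, cancels the sign, and leaves the same claim for m + 1 on the tail. -/
lemma IsSpecialized.X_O_word {w : List ℤ} : ∀ {m M : ℤ}, IsDecr M w → O (-m) (word X v w) ≠ 0 →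
    X m (O (-m) (word X v w)) = word X v w := by
  induction w with
  | nil => exact fun {m M} _ h0 => absurd (h.vac _) h0
  | cons n w ih =>
    intro m M hw h0
    have hmn : m ≤ n := by
      by_contra hlt
      exact h0 (h.O_word_eq_zero (M := n) (by omega)
        (isDecr_cons.2 ⟨le_rfl, (isDecr_cons.1 hw).2⟩))
    obtain ⟨hn, hw⟩ := isDecr_cons.1 hw
    rw [word_cons, h.O_X_word hw] at h0 ⊢
    split_ifs at h0 ⊢ with he
    · rw [he]
    · have h1 : O (-(m + 1)) (word X v w) ≠ 0 := fun h2 => h0 (by rw [h2, map_zero, neg_zero])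
      rw [map_neg, h.swap, neg_neg, add_sub_cancel_right, ih hw h1]

/-- Were O (-(m + 1)) nonzero on the word, the word would be in the image of X (m + 1), and X m
would kill it by `vanish`. So only the delta term of the exchange remains. -/
lemma IsSpecialized.O_X_word_of_ne_zero {w : List ℤ} {m M : ℤ} (hw : IsDecr M w)
    (h0 : X m (word X v w) ≠ 0) : O (-m) (X m (word X v w)) = word X v w := by
  have h1 : O (-(m + 1)) (word X v w) = 0 := by
    by_contra h2
    apply h0
    rw [← h.X_O_word hw h2, h.vanish]
  rw [h.exchange, if_pos (by ring), show -m - 1 = -(m + 1) by ring, h1, map_zero, sub_zero]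

variable {E' : Type*} [AddCommGroup E'] [Module R E'] {ε : E →ₗ[R] E'}

/-- Annihilators with smaller labels only push the letter n upwards, so it survives to the end,
where the functional kills it. -/
lemma IsSpecialized.pairing_X (hε : ∀ n e, ε (X n e) = 0) {js : List ℤ} :
    ∀ {n : ℤ}, (∀ j ∈ js, j < n) → ∀ e, pairing O ε js (X n e) = 0 := by
  induction js with
  | nil => exact fun {n} _ e => hε n e
  | cons j js ih =>
    intro n hn e
    have hj := hn j (by simp)
    have : pairing O ε (j :: js) (X n e) = pairing O ε js (O (-j) (X n e)) := rfl
    rw [this, h.exchange, if_neg (by omega), zero_sub, map_neg,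
      ih (fun i hi => (hn i (by simp [hi])).trans (by omega)), neg_zero]

/-- Compare leading letters j and n: for j > n the annihilator already kills the word, for j < n a
letter too large for the remaining annihilators is left over, and for j = n both letters are
removed. -/
lemma IsSpecialized.pairing_word (hε : ∀ n e, ε (X n e) = 0) {js : List ℤ} :
    ∀ {w : List ℤ}, js.Pairwise (· ≥ ·) → w.Pairwise (· ≥ ·) →
      pairing O ε js (word X v w) = if js = w then ε v else 0 := by
  induction js with
  | nil =>
    intro w _ hw
    cases w with
    | nil => rfl
    | cons n w => exact (hε _ _).trans (by simp)
  | cons j js ih =>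
    intro w hj hw
    have hu (e : E) : pairing O ε (j :: js) e = pairing O ε js (O (-j) e) := rfl
    rw [hu]
    cases w with
    | nil => rw [word_nil, h.vac, map_zero]; simp
    | cons n w =>
      obtain ⟨M, hM⟩ := exists_isDecr hw
      have hw' := (isDecr_cons.1 hM).2
      rcases lt_trichotomy j n with hjn | rfl | hjn
      · rw [word_cons, h.O_X_word hw', if_neg hjn.ne, map_neg, h.pairing_X hε, neg_zero, if_neg]
        · simp [hjn.ne]
        · intro i hi
          have := (List.pairwise_cons.1 hj).1 i hi
          omega
      · rw [word_cons, h.O_X_word hw', if_pos rfl, ih (List.pairwise_cons.1 hj).2 hw'.1]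
        simp
      · rw [h.O_word_eq_zero hjn (isDecr_cons.2 ⟨le_rfl, hw'⟩), map_zero, if_neg]
        simp [hjn.ne']

end Specialized

end Words

/-! ### Lattices carrying creation and annihilation operators -/

section Lattice

variable {R L : Type*} [CommRing R] [AddCommGroup L] [Module R L]

/-- The relations between creation and annihilation operators on a lattice, with parameter `c`. -/
structure IsLattice (c : R) (X O : ℤ → Module.End R L) (v : L) : Prop where
  swap : ∀ a b e, X a (X b e) = -X (b - 1) (X (a + 1) e) +
    c • (X b (X a e) + X (a + 1) (X (b - 1) e))
  vanish : ∀ a e, X a (X (a + 1) e) = c • X (a + 1) (X a e)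
  exchange : ∀ m n e, O m (X n e) = (if m + n = 0 then e else 0) - X (n + 1) (O (m - 1) e) +
    c • (O (m - 1) (X (n + 1) e) - (if m + n = 0 then e else 0) + X n (O m e))
  vac : ∀ m, O m v = 0

/-- The operator on `L / a L` induced by an operator on `L`. -/
abbrev redOp (a : R) (T : ℤ → Module.End R L) (n : ℤ) : Module.End R (QuotSMulTop a L) :=
  QuotSMulTop.map a (T n)

lemma mk_smul_eq_zero {a c : R} (h : a ∣ c) (e : L) :
    (Submodule.Quotient.mk (c • e) : QuotSMulTop a L) = 0 := by
  obtain ⟨b, rfl⟩ := h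
  rw [Submodule.Quotient.mk_eq_zero, mul_smul]
  exact Submodule.smul_mem_pointwise_smul _ _ _ Submodule.mem_top

lemma mk_add_mul_smul (a r b : R) (e : L) :
    (Submodule.Quotient.mk ((r + a * b) • e) : QuotSMulTop a L) = r • Submodule.Quotient.mk e := by
  rw [add_smul, Submodule.Quotient.mk_add, mk_smul_eq_zero (Dvd.intro b rfl), add_zero,
    Submodule.Quotient.mk_smul]

variable {c : R} {X O : ℤ → Module.End R L} {v : L}

lemma mk_word (a : R) (w : List ℤ) : (Submodule.Quotient.mk (word X v w) : QuotSMulTop a L) =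
    word (redOp a X) (Submodule.Quotient.mk v) w := by
  induction w with
  | nil => rfl
  | cons n w ih => rw [word_cons, word_cons, ← ih]; rfl

/-- Stated for any divisor a of c because two reductions are used: modulo q for the crystal
operators and modulo q^{1/2} for the bases. -/
lemma IsLattice.isSpecialized (h : IsLattice c X O v) {a : R} (ha : a ∣ c) :
    IsSpecialized (redOp a X) (redOp a O) (Submodule.Quotient.mk v) where
  swap m n e := by
    obtain ⟨e, rfl⟩ := Submodule.Quotient.mk_surjective _ e
    simp only [QuotSMulTop.map_apply_mk]
    rw [h.swap, Submodule.Quotient.mk_add, mk_smul_eq_zero ha, add_zero, Submodule.Quotient.mk_neg]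
  vanish m e := by
    obtain ⟨e, rfl⟩ := Submodule.Quotient.mk_surjective _ e
    simp only [QuotSMulTop.map_apply_mk]
    rw [h.vanish, mk_smul_eq_zero ha]
  exchange m n e := by
    obtain ⟨e, rfl⟩ := Submodule.Quotient.mk_surjective _ e
    simp only [QuotSMulTop.map_apply_mk]
    rw [h.exchange, Submodule.Quotient.mk_add, mk_smul_eq_zero ha, add_zero,
      Submodule.Quotient.mk_sub]
    split_ifs <;> rfl
  vac m := by rw [QuotSMulTop.map_apply_mk, h.vac]; rfl

/-- The reduction modulo `a` of a functional. -/
def redFun (a : R) (ε : L →ₗ[R] R) : QuotSMulTop a L →ₗ[R] R ⧸ Ideal.span {a} :=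
  Submodule.liftQ _ (Submodule.mkQ (Ideal.span {a}) ∘ₗ ε) (by
    intro e he
    obtain ⟨e, -, rfl⟩ := Submodule.mem_smul_pointwise_iff_exists _ _ _ |>.1 he
    rw [LinearMap.mem_ker, LinearMap.comp_apply, map_smul, Submodule.mkQ_apply,
      Submodule.Quotient.mk_eq_zero, smul_eq_mul]
    exact Ideal.mul_mem_right _ _ (Ideal.mem_span_singleton_self a))

lemma redFun_mk (a : R) (ε : L →ₗ[R] R) (e : L) :
    redFun a ε (Submodule.Quotient.mk e) = Ideal.Quotient.mk _ (ε e) := rfl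

lemma pairing_redFun (a : R) (ε : L →ₗ[R] R) (js : List ℤ) (e : L) :
    pairing (redOp a O) (redFun a ε) js (Submodule.Quotient.mk e) =
      Ideal.Quotient.mk _ (pairing O ε js e) := by
  induction js generalizing e with
  | nil => rfl
  | cons j js ih => exact ih (O (-j) e)

variable (h : IsLattice c X O v) {ε : L →ₗ[R] R} (hε : ∀ n e, ε (X n e) = 0) (hv : ε v = 1)
include h hε hv

lemma IsLattice.pairing_redOp_word {a : R} (ha : a ∣ c) {js w : List ℤ}
    (hj : js.Pairwise (· ≥ ·)) (hw : w.Pairwise (· ≥ ·)) :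
    pairing (redOp a O) (redFun a ε) js (word (redOp a X) (Submodule.Quotient.mk v) w) =
      if js = w then 1 else 0 := by
  rw [(h.isSpecialized ha).pairing_word _ hj hw, redFun_mk, hv, map_one]
  intro n e
  obtain ⟨e, rfl⟩ := Submodule.Quotient.mk_surjective _ e
  rw [QuotSMulTop.map_apply_mk, redFun_mk, hε, map_zero]

end Lattice

lemma linearIndependent_of_dual {k A E E' ι : Type*} [Field k] [CommRing A]
    [Algebra k A] [AddCommGroup E] [AddCommGroup E'] [Module A E] [Module A E'] [Module k E]
    [Module k E'] [IsScalarTower k A E] [IsScalarTower k A E'] [DecidableEq ι] {x : ι → E}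
    {o : E'} (ho : o ≠ 0)
    (f : ι → E →ₗ[A] E') (hf : ∀ i j, f i (x j) = if i = j then o else 0) :
    LinearIndependent k x := by
  rw [linearIndependent_iff']
  intro s g hg i hi
  have h := congrArg (f i) hg
  rw [map_sum, map_zero, Finset.sum_eq_single i, ← algebraMap_smul A, map_smul, hf, if_pos rfl,
    algebraMap_smul] at h
  · exact (smul_eq_zero.1 h).resolve_right ho
  · intro j _ hj
    rw [← algebraMap_smul A, map_smul, hf, if_neg (Ne.symm hj), smul_zero]
  · exact fun h => absurd hi h

/-- A finite relation is killed by the matrix of values of the functionals. That matrix is the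
identity modulo I, so its determinant is nonzero, and over a domain the relation is trivial. -/
lemma linearIndependent_of_dual_mod {A E ι : Type*} [CommRing A] [IsDomain A] [AddCommGroup E]
    [Module A E] [DecidableEq ι] {x : ι → E} {I : Ideal A} (hI : I ≠ ⊤) (f : ι → E →ₗ[A] A)
    (hf : ∀ i j, Ideal.Quotient.mk I (f i (x j)) = if i = j then 1 else 0) :
    LinearIndependent A x := by
  have : Nontrivial (A ⧸ I) := Ideal.Quotient.nontrivial_iff.2 hI
  rw [linearIndependent_iff']
  intro s g hg i hi
  let N : Matrix s s A := Matrix.of fun i j => f i.1 (x j.1)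
  have hN : N.map (Ideal.Quotient.mk I) = 1 := by
    ext i j
    simp only [N, Matrix.map_apply, Matrix.of_apply, hf, Matrix.one_apply, Subtype.ext_iff]
  have hdet : N.det ≠ 0 := fun h0 => by
    have := congrArg (Ideal.Quotient.mk I) h0
    rw [RingHom.map_det, RingHom.mapMatrix_apply, hN, Matrix.det_one, map_zero] at this
    exact one_ne_zero this
  have hmul : N.mulVec (fun j => g j.1) = 0 := by
    ext i
    have := congrArg (f i.1) hg
    rw [map_sum, map_zero] at this
    rw [Matrix.mulVec, dotProduct, Pi.zero_apply, ← this, ← Finset.sum_coe_sort s]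
    exact Finset.sum_congr rfl fun j _ => by rw [map_smul, smul_eq_mul, mul_comm]; rfl
  exact congrFun (Matrix.eq_zero_of_mulVec_eq_zero hdet hmul) ⟨i, hi⟩

/-! ### The local ring of functions regular at zero -/

section LocalRing

universe u

open Polynomial

variable (F : Type u) [Field F]

lemma a0qHalf_not_isUnit : ¬ IsUnit (a0qHalf F) := by
  rintro ⟨u, hu⟩
  obtain ⟨a, b, hb, hab⟩ := (↑u⁻¹ : A0 F).2
  have hb0 : algebraMap F[X] (Kq F) b ≠ 0 :=
    RatFunc.algebraMap_ne_zero (by rintro rfl; simp at hb)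
  have h1 : (a0qHalf F : Kq F) * (↑u⁻¹ : A0 F) = 1 := by
    rw [← hu, ← MulMemClass.coe_mul, Units.mul_inv]; rfl
  have h2 : (a0qHalf F : Kq F) = algebraMap F[X] (Kq F) X := RatFunc.algebraMap_X.symm
  rw [hab, h2, mul_div_assoc', div_eq_one_iff_eq hb0, ← map_mul] at h1
  have := RatFunc.algebraMap_injective F h1
  rw [← this] at hb
  simp at hb

lemma span_a0qHalf_ne_top : Ideal.span {a0qHalf F} ≠ ⊤ := fun h =>
  a0qHalf_not_isUnit F (Ideal.span_singleton_eq_top.1 h)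

/-- The residue field at q^{1/2} = 0 is F: subtract the value at 0, after which the numerator is
divisible by the variable. -/
lemma exists_eq_algebraMap_add (a : A0 F) :
    ∃ (f : F) (b : A0 F), a = algebraMap F (A0 F) f + a0qHalf F * b := by
  obtain ⟨_, n, d, hd, rfl⟩ := a
  have hd0 : algebraMap F[X] (Kq F) d ≠ 0 :=
    RatFunc.algebraMap_ne_zero (by rintro rfl; simp at hd)
  set f : F := n.eval 0 / d.eval 0
  obtain ⟨r, hr⟩ : X ∣ n - C f * d := by
    rw [X_dvd_iff, coeff_zero_eq_eval_zero]
    simp [f, hd]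
  refine ⟨f, ⟨_, r, d, hd, rfl⟩, Subtype.ext ?_⟩
  have h2 : (a0qHalf F : Kq F) = algebraMap F[X] (Kq F) X := RatFunc.algebraMap_X.symm
  have h3 : ((algebraMap F (A0 F) f : A0 F) : Kq F) = algebraMap F[X] (Kq F) (C f) := by
    rw [RatFunc.algebraMap_C, ← RatFunc.algebraMap_eq_C]; rfl
  rw [AddMemClass.coe_add, MulMemClass.coe_mul, h2, h3, mul_div_assoc', ← map_mul, ← hr, map_sub,
    map_mul]
  field_simp
  ring

instance : IsFractionRing (A0 F) (Kq F) := IsFractionRing.of_field _ _ fun z => by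
  have h (p : F[X]) : algebraMap F[X] (Kq F) p ∈ A0 F := ⟨p, 1, by simp, by simp⟩
  exact ⟨⟨_, h z.num⟩, ⟨_, h z.denom⟩, (RatFunc.num_div_denom z).symm⟩

/-- Solved for the next coefficient, the Taylor recursion involves only q²: g(0) = q² and g(r + 1) =
q² g(r) - δ_{r,0}. -/
lemma gCoeff_mem (r : ℕ) : gCoeff F r ∈ A0 F := by
  have hq : qElt F ^ 2 ∈ A0 F := pow_mem (a0q F).2 2
  have h1 := (isTaylor_gCoeff F).zero
  have h2 := (isTaylor_gCoeff F).succ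
  have h3 := qParam_mul F
  induction r with
  | zero =>
    rwa [show gCoeff F 0 = qElt F ^ 2 by linear_combination qElt F ^ 2 * h1 - gCoeff F 0 * h3]
  | succ r ih =>
    have h4 : gCoeff F (r + 1) = qElt F ^ 2 * gCoeff F r - if r = 0 then 1 else 0 := by
      have := h2 r
      split_ifs at this ⊢
      · linear_combination -qElt F ^ 2 * this - gCoeff F (r + 1) * h3 - h3
      · linear_combination -qElt F ^ 2 * this - gCoeff F (r + 1) * h3
    rw [h4]
    refine sub_mem (mul_mem hq ih) ?_
    split_ifs
    exacts [one_mem _, zero_mem _]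

end LocalRing

/-! ### The lattice `L(λ)` -/

section LlamLattice

universe u

attribute [local instance 1100] Submodule.module Submodule.Quotient.module

variable (F : Type u) [Field F] {lam : Weight}

lemma word_xTilde (w : List ℤ) :
    word (fun n => (xTilde F (RedVerma F lam) n).restrictScalars (A0 F)) (vlam F lam) w =
      mon F w • vlam F lam := by
  induction w with
  | nil => simp [mon]
  | cons n w ih => rw [word_cons, ih, LinearMap.restrictScalars_apply, xTilde_mon]

lemma a0q_sq_smul (y : RedVerma F lam) : a0q F ^ 2 • y = qElt F ^ 2 • y := by
  rw [← algebraMap_smul (Kq F) (a0q F ^ 2), map_pow]; rfl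

lemma mon_mem_Llam {w : List ℤ} (hw : w.Pairwise (· ≥ ·)) :
    mon F w • vlam F lam ∈ Llam F lam :=
  Submodule.subset_span ⟨w, hw, rfl⟩

lemma vlam_mem_Llam : vlam F lam ∈ Llam F lam := by
  simpa [mon] using mon_mem_Llam F (lam := lam) List.Pairwise.nil

variable [CharZero F] (hc : lam.c = 0)

include hc

/-- At b = a + 1 the exchange relation has the same product on both sides; collecting them and
dividing by 2 gives the claim. -/
lemma xTilde_vanish (a : ℤ) (y : RedVerma F lam) :
    xTilde F _ a (xTilde F _ (a + 1) y) = qElt F ^ 2 • xTilde F _ (a + 1) (xTilde F _ a y) := by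
  have h := xTilde_exchange F hc a (a + 1) y
  rw [add_sub_cancel_right, smul_add] at h
  have h2 : (2 : Kq F) • xTilde F _ a (xTilde F _ (a + 1) y) =
      (2 : Kq F) • (qElt F ^ 2 • xTilde F _ (a + 1) (xTilde F _ a y)) := by
    rw [two_smul, two_smul]
    nth_rw 1 [h]
    abel
  exact (IsUnit.mk0 (2 : Kq F) two_ne_zero).smul_left_cancel.1 h2

lemma xTilde_mem_Llam (m : ℤ) {y : RedVerma F lam} (hy : y ∈ Llam F lam) :
    xTilde F _ m y ∈ Llam F lam := by
  suffices h : Llam F lam ≤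
      (Llam F lam).comap ((xTilde F (RedVerma F lam) m).restrictScalars (A0 F)) from h hy
  refine Submodule.span_le.2 ?_
  rintro _ ⟨w, hw, rfl⟩
  obtain ⟨M, hM⟩ := exists_isDecr hw
  have h := X_word_mem_decrSpan (c := a0q F ^ 2)
    (X := fun n => (xTilde F (RedVerma F lam) n).restrictScalars (A0 F))
    (fun a b e => (xTilde_exchange F hc a b e).trans (by rw [a0q_sq_smul]; rfl))
    (fun a e => (xTilde_vanish F hc a e).trans (a0q_sq_smul F _).symm) (vlam F lam)
    w.length (max M m - m).toNat m (max M m) w (by omega) (hM.mono (by omega)) rfl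
  rw [word_xTilde] at h
  refine (Submodule.span_le.2 ?_ : decrSpan _ _ _ _ ≤ Llam F lam) h
  rintro _ ⟨w, hw, -, rfl⟩
  rw [word_xTilde]
  exact mon_mem_Llam F hw.1

lemma mon_mem_Llam_of_list (w : List ℤ) : mon F w • vlam F lam ∈ Llam F lam := by
  induction w with
  | nil => exact mon_mem_Llam F List.Pairwise.nil
  | cons n w ih => rw [← xTilde_mon]; exact xTilde_mem_Llam F hc n ih

lemma omegaTilde_mon_mem_Llam (w : List ℤ) (m : ℤ) :
    omegaTilde F lam m (mon F w • vlam F lam) ∈ Llam F lam := by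
  induction w generalizing m with
  | nil =>
    have : mon F [] • vlam F lam = vlam F lam := by simp [mon]
    rw [this, omegaTilde_vlam F hc]
    exact zero_mem _
  | cons n w ih =>
    rw [← xTilde_mon]
    refine omegaTilde_xTilde_mem F hc (Llam F lam).toAddSubgroup (mon_mem_Llam_of_list F hc w)
      (fun r j => ?_) m
    exact (Llam F lam).smul_mem ⟨_, gCoeff_mem F r⟩ (xTilde_mem_Llam F hc _ (ih j))

lemma omegaTilde_mem_Llam (m : ℤ) {y : RedVerma F lam} (hy : y ∈ Llam F lam) :
    omegaTilde F lam m y ∈ Llam F lam := by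
  suffices h : Llam F lam ≤
      (Llam F lam).comap ((omegaTilde F lam m).restrictScalars (A0 F)) from h hy
  refine Submodule.span_le.2 ?_
  rintro _ ⟨w, -, rfl⟩
  exact omegaTilde_mon_mem_Llam F hc w m

lemma vacuum_mem {y : RedVerma F lam} (hy : y ∈ Llam F lam) : vacuum F hc y ∈ A0 F := by
  suffices h : Llam F lam ≤ (Subalgebra.toSubmodule (⊥ : Subalgebra (A0 F) (Kq F))).comap
      ((vacuum F hc).restrictScalars (A0 F)) by
    obtain ⟨a, ha⟩ := Algebra.mem_bot.1 (h hy)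
    exact ha ▸ a.2
  refine Submodule.span_le.2 ?_
  rintro _ ⟨w, -, rfl⟩
  cases w with
  | nil =>
    refine Algebra.mem_bot.2 ⟨1, ?_⟩
    have : mon F [] • vlam F lam = vlam F lam := by simp [mon]
    rw [LinearMap.restrictScalars_apply, this, vacuum_vlam, map_one]
  | cons n w =>
    refine Algebra.mem_bot.2 ⟨0, ?_⟩
    rw [LinearMap.restrictScalars_apply, ← xTilde_mon, vacuum_xTilde, map_zero]

/-- The operators `x̃⁻_n` on `L(λ)`. -/
abbrev xLat (n : ℤ) : Module.End (A0 F) (Llam F lam) :=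
  ((xTilde F (RedVerma F lam) n).restrictScalars (A0 F)).restrict fun _ => xTilde_mem_Llam F hc n

/-- The operators `Ω̃_ψ(n)` on `L(λ)`. -/
abbrev omegaLat (n : ℤ) : Module.End (A0 F) (Llam F lam) :=
  ((omegaTilde F lam n).restrictScalars (A0 F)).restrict fun _ => omegaTilde_mem_Llam F hc n

omit hc [CharZero F] in
variable (lam) in
/-- The vector `v_λ` of `L(λ)`. -/
def vLat : Llam F lam := ⟨vlam F lam, vlam_mem_Llam F⟩

/-- The vacuum expectation on `L(λ)`. -/
def vacuumLat : Llam F lam →ₗ[A0 F] A0 F where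
  toFun y := ⟨vacuum F hc y.1, vacuum_mem F hc y.2⟩
  map_add' x y := Subtype.ext (map_add (vacuum F hc) x.1 y.1)
  map_smul' a x := Subtype.ext (map_smul (vacuum F hc) (a : Kq F) x.1)

lemma vacuumLat_vLat : vacuumLat F hc (vLat F lam) = 1 := Subtype.ext (vacuum_vlam F hc)

lemma vacuumLat_xLat (n : ℤ) (e : Llam F lam) : vacuumLat F hc (xLat F hc n e) = 0 :=
  Subtype.ext (vacuum_xTilde F hc n e.1)

lemma coe_word_xLat (w : List ℤ) :
    ((word (xLat F hc) (vLat F lam) w : Llam F lam) : RedVerma F lam) = mon F w • vlam F lam := by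
  induction w with
  | nil => simp [mon, vLat]
  | cons n w ih => exact (congrArg (xTilde F (RedVerma F lam) n) ih).trans (xTilde_mon F n w)

lemma isLattice_Llam : IsLattice (a0q F ^ 2) (xLat F hc) (omegaLat F hc) (vLat F lam) where
  swap a b e := Subtype.ext <|
    (xTilde_exchange F hc a b e.1).trans (by rw [← a0q_sq_smul]; rfl)
  vanish a e := Subtype.ext <| (xTilde_vanish F hc a e.1).trans (a0q_sq_smul F _).symm
  exchange m n e := Subtype.ext (by
    refine (omegaTilde_xTilde F hc m n e.1).trans ?_
    rw [← a0q_sq_smul]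
    split_ifs <;> rfl)
  vac m := Subtype.ext (omegaTilde_vlam F hc m)

end LlamLattice

/-! ### Bases and weights -/

/-- The weakly decreasing words. -/
abbrev DecrWord : Type := {w : List ℤ // w.Pairwise (· ≥ ·)}

section Weights

universe u

attribute [local instance 1100] Submodule.module Submodule.Quotient.module

variable (F : Type u) [Field F] (lam : Weight)

/-- Weight spaces are joint eigenspaces of the commuting operators K and D. Distinct weights in λ +
P have distinct eigenvalue pairs, since the powers of q are distinct and the value at c is constant
on λ + P. -/
lemma iSupIndep_weightSpace :
    iSupIndep fun mu : weightsBelow lam => weightSpace (F := F) (RedVerma F lam) mu := by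
  let f : Bool → Module.End (Kq F) (RedVerma F lam) := fun i =>
    Algebra.lsmul (Kq F) (Kq F) (RedVerma F lam) (bif i then ug F .K else ug F .D)
  have hKD : Commute (ug F .K) (ug F .D) := by
    have := toUq_rel F (Rel.D_K (F := F))
    rw [map_mul, map_mul] at this
    exact this.symm
  have hcomm (i j : Bool) : Commute (f i) (f j) := by
    refine Commute.map ?_ (Algebra.lsmul (Kq F) (Kq F) (RedVerma F lam))
    cases i <;> cases j
    exacts [Commute.refl _, hKD.symm, hKD, Commute.refl _]
  have h := Module.End.independent_iInf_maxGenEigenspace_of_forall_mapsTo f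
    fun i j φ => Module.End.mapsTo_maxGenEigenspace_of_comm (hcomm j i) φ
  let χ : weightsBelow lam → Bool → Kq F := fun mu i =>
    bif i then qElt F ^ mu.1.h else qElt F ^ mu.1.d
  have hχ : Function.Injective χ := fun mu nu hmn => by
    have hc (mu : weightsBelow lam) : mu.1.c = lam.c := by
      obtain ⟨_, rfl | ⟨k, m, -, rfl⟩⟩ := mu <;> exact add_zero _
    exact Subtype.ext (Weight.ext (qElt_zpow_injective F (congrFun hmn true))
      ((hc mu).trans (hc nu).symm) (qElt_zpow_injective F (congrFun hmn false)))
  refine (h.comp hχ).mono fun mu y hy => ?_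
  rw [Function.comp_apply, Submodule.mem_iInf]
  refine fun i => Module.End.mem_maxGenEigenspace _ _ _ |>.2 ⟨1, ?_⟩
  rw [pow_one, LinearMap.sub_apply, LinearMap.smul_apply, sub_eq_zero]
  cases i
  exacts [hy.2, hy.1]

lemma add_rootShift_mem (w : List ℤ) : lam + rootShift w.length w.sum ∈ weightsBelow lam := by
  cases w with
  | nil => exact Or.inl rfl
  | cons n w => exact Or.inr ⟨_, _, by simp, rfl⟩

/-- The vector of `L(λ)` attached to a weakly decreasing word. -/
def latVec (w : DecrWord) : Llam F lam := ⟨mon F w.1 • vlam F lam, mon_mem_Llam F w.2⟩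

lemma latVec_mem (w : DecrWord) :
    latVec F lam w ∈ latticeWeight (Llam F lam) (lam + rootShift w.1.length w.1.sum) :=
  mon_mem_weightSpace F w.1

lemma span_latVec : Submodule.span (A0 F) (Set.range (latVec F lam)) = ⊤ := by
  apply Submodule.map_injective_of_injective (Llam F lam).injective_subtype
  rw [Submodule.map_top, Submodule.range_subtype, Submodule.map_span, ← Set.range_comp]
  change _ = Submodule.span (A0 F) _
  congr 1
  ext y
  constructor
  · rintro ⟨w, rfl⟩
    exact ⟨w.1, w.2, rfl⟩
  · rintro ⟨w, hw, rfl⟩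
    exact ⟨⟨w, hw⟩, rfl⟩

lemma isInternal_latticeWeight :
    DirectSum.IsInternal fun mu : weightsBelow lam => latticeWeight (Llam F lam) mu := by
  apply DirectSum.isInternal_submodule_of_iSupIndep_of_iSup_eq_top
  · rw [iSupIndep_iff_finsetSum_eq_zero_imp_eq_zero]
    intro s y hy hs mu hmu
    have h := (iSupIndep_iff_finsetSum_eq_zero_imp_eq_zero _).1 (iSupIndep_weightSpace F lam) s
      (fun mu => (y mu : RedVerma F lam)) hy
      (by simpa using congrArg (Llam F lam).subtype hs) mu hmu
    exact Subtype.ext h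
  · rw [eq_top_iff, ← span_latVec, Submodule.span_le]
    rintro _ ⟨w, rfl⟩
    exact Submodule.mem_iSup_of_mem ⟨_, add_rootShift_mem lam w.1⟩ (latVec_mem F lam w)

lemma span_mk_latVec : Submodule.span F (Set.range fun w : DecrWord =>
    (Submodule.Quotient.mk (latVec F lam w) : QuotSMulTop (a0qHalf F) (Llam F lam))) = ⊤ := by
  refine eq_top_iff.2 fun y _ => ?_
  obtain ⟨y, rfl⟩ := Submodule.Quotient.mk_surjective _ y
  have hy : y ∈ Submodule.span (A0 F) (Set.range (latVec F lam)) :=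
    (span_latVec F lam).symm ▸ Submodule.mem_top
  induction hy using Submodule.span_induction with
  | mem y hy =>
    obtain ⟨w, rfl⟩ := hy
    exact Submodule.subset_span ⟨w, rfl⟩
  | zero => exact zero_mem _
  | add y z _ _ hy hz => exact add_mem (hy trivial) (hz trivial)
  | smul a y _ hy =>
    -- Modulo q^{1/2} the scalar a acts through its value f at 0, so the 𝔸₀-span becomes an F-span.
    obtain ⟨f, b, rfl⟩ := exists_eq_algebraMap_add F a
    have h1 := mk_add_mul_smul (a0qHalf F) (algebraMap F (A0 F) f) b y
    have h2 := algebraMap_smul (A0 F) f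
      (Submodule.Quotient.mk y : QuotSMulTop (a0qHalf F) (Llam F lam))
    exact (h1.trans h2) ▸ Submodule.smul_mem _ f (hy trivial)

end Weights

/-! ### Bases of the lattice, the module and the fibre -/

section Bases

universe u

attribute [local instance 1100] Submodule.module Submodule.Quotient.module

variable (F : Type u) [Field F] [CharZero F] {lam : Weight} (hc : lam.c = 0)

include hc

lemma latVec_eq (w : DecrWord) : latVec F lam w = word (xLat F hc) (vLat F lam) w.1 :=
  Subtype.ext (coe_word_xLat F hc w.1).symm

lemma mk_latVec (a : A0 F) (w : DecrWord) :
    (Submodule.Quotient.mk (latVec F lam w) : QuotSMulTop a (Llam F lam)) =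
      word (redOp a (xLat F hc)) (Submodule.Quotient.mk (vLat F lam)) w.1 := by
  rw [latVec_eq F hc, mk_word]

lemma pairing_latVec (v w : DecrWord) :
    pairing (redOp (a0qHalf F) (omegaLat F hc)) (redFun (a0qHalf F) (vacuumLat F hc)) v.1
      (Submodule.Quotient.mk (latVec F lam w)) = if v = w then 1 else 0 := by
  have ha : a0qHalf F ∣ a0q F ^ 2 := ⟨a0qHalf F ^ 3, by rw [a0q]; ring⟩
  rw [mk_latVec F hc, (isLattice_Llam F hc).pairing_redOp_word (vacuumLat_xLat F hc)
    (vacuumLat_vLat F hc) ha v.2 w.2]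
  simp only [Subtype.ext_iff]

/-- The iterated annihilation functionals on the lattice are dual to the words only modulo q^{1/2},
which suffices over the domain 𝔸₀. -/
lemma linearIndependent_latVec : LinearIndependent (A0 F) (latVec F lam) :=
  linearIndependent_of_dual_mod (span_a0qHalf_ne_top F)
    (fun v => pairing (omegaLat F hc) (vacuumLat F hc) v.1)
    fun v w => by rw [← pairing_redFun, pairing_latVec F hc]

lemma linearIndependent_mk_latVec : LinearIndependent F fun w : DecrWord =>
    (Submodule.Quotient.mk (latVec F lam w) : QuotSMulTop (a0qHalf F) (Llam F lam)) := by
  have : Nontrivial (A0 F ⧸ Ideal.span {a0qHalf F}) :=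
    Ideal.Quotient.nontrivial_iff.2 (span_a0qHalf_ne_top F)
  exact linearIndependent_of_dual one_ne_zero
    (fun v => pairing (redOp (a0qHalf F) (omegaLat F hc))
      (redFun (a0qHalf F) (vacuumLat F hc)) v.1) (pairing_latVec F hc)

/-- The basis of `L(λ)` given by the weakly decreasing words. -/
def latBasis : Module.Basis DecrWord (A0 F) (Llam F lam) :=
  Module.Basis.mk (linearIndependent_latVec F hc) (span_latVec F lam).ge

/-- The basis of the reduced imaginary Verma module given by the weakly decreasing words. -/
def vermaBasis : Module.Basis DecrWord (Kq F) (RedVerma F lam) :=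
  Module.Basis.mk (v := fun w : DecrWord => mon F w.1 • vlam F lam)
    ((LinearIndependent.iff_fractionRing (A0 F) (Kq F)).1
      ((linearIndependent_latVec F hc).map' (Llam F lam).subtype (Submodule.ker_subtype _)))
    (by
      rw [← span_mon F hc, Submodule.span_le]
      rintro _ ⟨w, rfl⟩
      refine (Submodule.span_le_restrictScalars (A0 F) (Kq F) _)
        ((Submodule.span_mono ?_) (mon_mem_Llam_of_list F hc w))
      rintro _ ⟨w, hw, rfl⟩
      exact ⟨⟨w, hw⟩, rfl⟩)

/-- The same decreasing words form an 𝔸₀-basis of the lattice and a basis of the module over the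
fraction field. -/
lemma isBaseChange_Llam : IsBaseChange (Kq F) (Llam F lam).subtype := by
  have h := (IsBaseChange.of_basis (A0 F) (vermaBasis F hc)).comp_equiv (latBasis F hc).repr
  convert h using 1
  refine (latBasis F hc).ext fun w => ?_
  rw [LinearMap.comp_apply, LinearEquiv.coe_coe, Module.Basis.repr_self,
    Finsupp.linearCombination_single, one_smul, latBasis, vermaBasis, Module.Basis.mk_apply,
    Module.Basis.mk_apply]
  rfl

lemma isCrystalLattice_Llam :
    IsCrystalLattice (weightsBelow lam) (omegaTilde F lam) (Llam F lam) where
  free := Module.Free.of_basis (latBasis F hc)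
  baseChange := isBaseChange_Llam F hc
  weights := isInternal_latticeWeight F lam
  omega_mem m _ hx := omegaTilde_mem_Llam F hc m hx
  x_mem m _ hx := xTilde_mem_Llam F hc m hx

end Bases

/-! ### The crystal basis -/

section CrystalBasis

universe u

attribute [local instance 1100] Submodule.module Submodule.Quotient.module

variable (F : Type u) [Field F] {lam : Weight}

lemma mem_Blam_iff {b : QuotSMulTop (a0q F) (Llam F lam)} :
    b ∈ Blam F lam ↔ ∃ w : DecrWord, Submodule.Quotient.mk (latVec F lam w) = b :=
  ⟨fun ⟨w, hw, h⟩ => ⟨⟨w, hw⟩, h.symm⟩, fun ⟨w, h⟩ => ⟨w.1, w.2, h.symm⟩⟩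

lemma Blam_eq_iUnion : Blam F lam = ⋃ mu ∈ weightsBelow lam,
    Blam F lam ∩ Submodule.Quotient.mk '' (latticeWeight (Llam F lam) mu : Set (Llam F lam)) := by
  refine Set.Subset.antisymm (fun b hb => ?_) (Set.iUnion₂_subset fun _ _ => Set.inter_subset_left)
  obtain ⟨w, rfl⟩ := (mem_Blam_iff F).1 hb
  exact Set.mem_iUnion₂.2 ⟨_, add_rootShift_mem lam w.1, hb, _, latVec_mem F lam w, rfl⟩

variable [CharZero F] (hc : lam.c = 0)

include hc

lemma linearIndependent_Blam :
    LinearIndependent F fun b : Blam F lam => toFibre (Llam F lam) b.1 := by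
  -- Each class is labelled by a word, and labels of distinct classes differ; independence of the
  -- family of classes is thus inherited from that of the family of words.
  choose σ hσ using fun b : Blam F lam => (mem_Blam_iff F).1 b.2
  have hinj : Function.Injective σ := fun b b' h => Subtype.ext (by rw [← hσ b, ← hσ b', h])
  have h := (linearIndependent_mk_latVec F hc).comp σ hinj
  have he : (fun b : Blam F lam => toFibre (Llam F lam) b.1) =
      (fun w : DecrWord => (Submodule.Quotient.mk (latVec F lam w) :
        QuotSMulTop (a0qHalf F) (Llam F lam))) ∘ σ :=
    funext fun b => by rw [← hσ b]; rfl
  rw [he]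
  exact h

omit [CharZero F] hc in
lemma span_Blam : Submodule.span F (toFibre (Llam F lam) '' Blam F lam) = ⊤ := by
  rw [eq_top_iff, ← span_mk_latVec F lam]
  refine Submodule.span_mono ?_
  rintro _ ⟨w, rfl⟩
  exact ⟨_, (mem_Blam_iff F).2 ⟨w, rfl⟩, rfl⟩

lemma isSpecialized_Blam : IsSpecialized (redOp (a0q F) (xLat F hc))
    (redOp (a0q F) (omegaLat F hc)) (Submodule.Quotient.mk (vLat F lam)) :=
  (isLattice_Llam F hc).isSpecialized (Dvd.intro_left _ (pow_two _).symm)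

lemma mem_Blam_iff_word {b : QuotSMulTop (a0q F) (Llam F lam)} : b ∈ Blam F lam ↔
    ∃ w M, IsDecr M w ∧
      b = word (redOp (a0q F) (xLat F hc)) (Submodule.Quotient.mk (vLat F lam)) w := by
  rw [mem_Blam_iff]
  constructor
  · rintro ⟨w, rfl⟩
    obtain ⟨M, hM⟩ := exists_isDecr w.2
    exact ⟨w.1, M, hM, mk_latVec F hc _ w⟩
  · rintro ⟨w, M, hM, rfl⟩
    exact ⟨⟨w, hM.1⟩, mk_latVec F hc _ _⟩

lemma IsSigned.mem_Blam {M : ℤ} {b : QuotSMulTop (a0q F) (Llam F lam)}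
    (h : IsSigned (redOp (a0q F) (xLat F hc)) (Submodule.Quotient.mk (vLat F lam)) M b) :
    b = 0 ∨ b ∈ Blam F lam ∨ -b ∈ Blam F lam := by
  rcases h with h | ⟨w, hw, h | h⟩
  · exact Or.inl h
  · exact Or.inr (Or.inl ((mem_Blam_iff_word F hc).2 ⟨w, M, hw, h⟩))
  · exact Or.inr (Or.inr ((mem_Blam_iff_word F hc).2 ⟨w, M, hw, by rw [h, neg_neg]⟩))

variable {b : QuotSMulTop (a0q F) (Llam F lam)} (hb : b ∈ Blam F lam) (m : ℤ)

include hb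

lemma xLat_Blam : redOp (a0q F) (xLat F hc) m b = 0 ∨ redOp (a0q F) (xLat F hc) m b ∈ Blam F lam ∨
    -redOp (a0q F) (xLat F hc) m b ∈ Blam F lam := by
  obtain ⟨w, M, hw, rfl⟩ := (mem_Blam_iff_word F hc).1 hb
  exact IsSigned.mem_Blam F hc ((isSpecialized_Blam F hc).X_word (le_max_left m M)
    (hw.mono (by omega)))

lemma omegaLat_Blam : redOp (a0q F) (omegaLat F hc) m b = 0 ∨
    redOp (a0q F) (omegaLat F hc) m b ∈ Blam F lam ∨
    -redOp (a0q F) (omegaLat F hc) m b ∈ Blam F lam := by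
  obtain ⟨w, M, hw, rfl⟩ := (mem_Blam_iff_word F hc).1 hb
  have h := (isSpecialized_Blam F hc).O_word (j := -m) hw
  rw [neg_neg] at h
  exact IsSigned.mem_Blam F hc h

lemma omegaLat_xLat_Blam (h : redOp (a0q F) (xLat F hc) m b ≠ 0) :
    redOp (a0q F) (omegaLat F hc) (-m) (redOp (a0q F) (xLat F hc) m b) = b := by
  obtain ⟨w, M, hw, rfl⟩ := (mem_Blam_iff_word F hc).1 hb
  exact (isSpecialized_Blam F hc).O_X_word_of_ne_zero hw h

lemma xLat_omegaLat_Blam (h : redOp (a0q F) (omegaLat F hc) (-m) b ≠ 0) :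
    redOp (a0q F) (xLat F hc) m (redOp (a0q F) (omegaLat F hc) (-m) b) = b := by
  obtain ⟨w, M, hw, rfl⟩ := (mem_Blam_iff_word F hc).1 hb
  exact (isSpecialized_Blam F hc).X_O_word hw h

omit hb in
lemma isCrystalBasis_Blam :
    IsCrystalBasis (weightsBelow lam) (omegaTilde F lam) (Llam F lam) (Blam F lam) where
  lattice := isCrystalLattice_Llam F hc
  linInd := linearIndependent_Blam F hc
  span := span_Blam F
  weights := Blam_eq_iUnion F
  x_mem m _ hb := xLat_Blam F hc hb m
  omega_mem m _ hb := omegaLat_Blam F hc hb m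
  comm m _ hb hO hX := (xLat_omegaLat_Blam F hc hb m hO).trans (omegaLat_xLat_Blam F hc hb m hX).symm

end CrystalBasis

end ImaginaryCrystal

end

theorem mainTheorem1 (F : Type*) [Field F] [CharZero F]
    (lam : ImaginaryCrystal.Weight) (hc : lam.c = 0) (hh : lam.h ≠ 0) :
    -- the operators on the module are well defined
    (∀ (k : ℤ) (w : List ℤ),
      ImaginaryCrystal.omegaTilde F lam k
          (ImaginaryCrystal.mon F w • ImaginaryCrystal.vlam F lam) =
        ImaginaryCrystal.omegaMon F k w • ImaginaryCrystal.vlam F lam) ∧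
    ∃ hB : ImaginaryCrystal.IsCrystalBasis (ImaginaryCrystal.weightsBelow lam)
        (ImaginaryCrystal.omegaTilde F lam)
        (ImaginaryCrystal.Llam F lam) (ImaginaryCrystal.Blam F lam),
      -- on the basis the two operators are inverse to each other wherever they do not vanish
      ∀ m : ℤ, ∀ b ∈ ImaginaryCrystal.Blam F lam,
        (ImaginaryCrystal.induced (ImaginaryCrystal.xTilde F (ImaginaryCrystal.RedVerma F lam) m)
            (hB.lattice.x_mem m) b ≠ 0 →
          ImaginaryCrystal.induced (ImaginaryCrystal.omegaTilde F lam (-m))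
            (hB.lattice.omega_mem (-m))
            (ImaginaryCrystal.induced
              (ImaginaryCrystal.xTilde F (ImaginaryCrystal.RedVerma F lam) m)
              (hB.lattice.x_mem m) b) = b) ∧
        (ImaginaryCrystal.induced (ImaginaryCrystal.omegaTilde F lam (-m))
            (hB.lattice.omega_mem (-m)) b ≠ 0 →
          ImaginaryCrystal.induced (ImaginaryCrystal.xTilde F (ImaginaryCrystal.RedVerma F lam) m)
            (hB.lattice.x_mem m)
            (ImaginaryCrystal.induced (ImaginaryCrystal.omegaTilde F lam (-m))
              (hB.lattice.omega_mem (-m)) b) = b) :=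
  ⟨fun k w => ImaginaryCrystal.omegaTilde_mon F hc k w,
    ImaginaryCrystal.isCrystalBasis_Blam F hc, fun m _ hb =>
      ⟨ImaginaryCrystal.omegaLat_xLat_Blam F hc hb m,
        ImaginaryCrystal.xLat_omegaLat_Blam F hc hb m⟩⟩
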